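/- Let $(M,g)$ be a smooth pseudo-Riemannian manifold of dimension $n$, let $\hbar\neq 0$ be a real number, and let $\mathcal M=T^*M\times_M\Pi TM$ be its supercotangent bundle, with algebra of (complex) functions $\mathcal C^\infty(\mathcal M)=\mathcal C^\infty(T^*M)\otimes_{\mathcal C^\infty(M)}\Omega_{\mathbb C}(M)$ and with the natural coordinates $(x^i,p_i,\xi^i)$ attached to coordinates $(x^i)$ of $M$ ($p_i$ and $\xi^i$ correspond to $\partial_i$ and $dx^i$). Let $$\alpha=p_i\,dx^i+\tfrac{\hbar}{2\mathrm i}\,g_{ij}\,\xi^i d^\nabla\xi^j,\qquad d^\nabla\xi^j=d\xi^j+\Gamma^j_{kl}\xi^k dx^l,\qquad \beta=g_{ij}\,\xi^i dx^j,$$ with $\Gamma^j_{kl}$ the Christoffel symbols of $g$, and equip $\mathcal M$ with the even symplectic form $\omega=d\alpha$. The Hamiltonian vector field $V_f$ of a function $f$ is defined by $\langle V_f,\omega\rangle=-df$, and the Poisson bracket by $\{f,h\}=V_f(h)$. Let $\mathrm{conf}(M,g)$ be the Lie algebra of smooth vector fields $X$ on $M$ such that $L_Xg=\lambda g$ for some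 smooth function $\lambda$. Every $X\in\mathrm{conf}(M,g)$ has a unique lift to an even vector field $\tilde X$ on $\mathcal M$ which preserves $\alpha$, i.e. $L_{\tilde X}\alpha=0$, and the direction of $\beta$, i.e. $L_{\tilde X}\beta=f\beta$ for some $f\in\mathcal C^\infty(M)$. The even comoment map $$\mathcal J^\alpha:\mathrm{conf}(M,g)\to\mathcal C^\infty(\mathcal M),\qquad X\mapsto\mathcal J^\alpha_X,$$ of this action (so $\tilde X$ is the unique Hamiltonian vector field of $\mathcal J^\alpha_X$) is a morphism of Lie algebras: it is $\mathbb R$-linear and $\mathcal J^\alpha_{[X,Y]}=\{\mathcal J^\alpha_X,\mathcal J^\alpha_Y\}$ for all $X,Y\in\mathrm{conf}(M,g)$. It is given, in natural coordinates, by $$\mathcal J^\alpha_X=\langle\tilde X,\alpha\rangle=p_iX^i+\frac{\hbar}{2\mathrm i}\,\xi^j\xi^k\,\partial_{[k}X_{j]},$$ where $X_j=g_{jk}X^k$ and $\partial_{[k}X_{j]}=\tfrac12(\partial_kX_j-\partial_jX_k)$. -/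

import Mathlib

open scoped Manifold ContDiff

noncomputable section

namespace Supercotangent

/-! ### The Grassmann algebra `ℂ[ξ¹, …, ξⁿ]` -/

/-- The complex Grassmann algebra on `n` odd generators. -/
def Grassmann (n : ℕ) : Type := ExteriorAlgebra ℂ (Fin n → ℂ)

namespace Grassmann

variable {n : ℕ}

instance : Ring (Grassmann n) := inferInstanceAs (Ring (ExteriorAlgebra ℂ (Fin n → ℂ)))

instance : Algebra ℂ (Grassmann n) :=
  inferInstanceAs (Algebra ℂ (ExteriorAlgebra ℂ (Fin n → ℂ)))

instance : Module.Finite ℂ (Grassmann n) := by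
  have key : (⨆ i ∈ Finset.range (n + 1), (⋀[ℂ]^i (Fin n → ℂ)))
      = (⊤ : Submodule ℂ (ExteriorAlgebra ℂ (Fin n → ℂ))) := by
    rw [← (DirectSum.Decomposition.isInternal
      (fun i : ℕ => ⋀[ℂ]^i (Fin n → ℂ))).submodule_iSup_eq_top]
    refine le_antisymm (iSup₂_le fun i _ => le_iSup (fun i : ℕ => ⋀[ℂ]^i (Fin n → ℂ)) i)
      (iSup_le fun i => ?_)
    by_cases hi : i < n + 1
    · exact le_iSup₂_of_le (f := fun (i : ℕ) (_ : i ∈ Finset.range (n + 1)) =>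
        ⋀[ℂ]^i (Fin n → ℂ)) i (Finset.mem_range.2 hi) le_rfl
    · have h0 : Module.finrank ℂ (⋀[ℂ]^i (Fin n → ℂ)) = 0 := by
        rw [exteriorPower.finrank_eq, Module.finrank_fin_fun]
        exact Nat.choose_eq_zero_of_lt (by omega)
      rw [Submodule.finrank_eq_zero.1 h0]
      exact bot_le
  refine ⟨?_⟩
  change (⊤ : Submodule ℂ (ExteriorAlgebra ℂ (Fin n → ℂ))).FG
  rw [← key]
  exact Submodule.fg_biSup _ _ fun i _ => Module.Finite.iff_fg.1 inferInstance

/-- A norm on the finite-dimensional space `Grassmann n` (coefficients in a basis, sup norm). It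
only serves to speak of smooth functions with values in `Grassmann n`; all norms on a
finite-dimensional space give the same smooth functions and the same derivatives. -/
instance : NormedAddCommGroup (Grassmann n) :=
  NormedAddCommGroup.induced (Grassmann n)
    (Fin (Module.finrank ℂ (Grassmann n)) → ℂ)
    (Module.finBasis ℂ (Grassmann n)).equivFun.toLinearMap
    (Module.finBasis ℂ (Grassmann n)).equivFun.injective

instance : NormedSpace ℂ (Grassmann n) :=
  NormedSpace.induced ℂ (Grassmann n)
    (Fin (Module.finrank ℂ (Grassmann n)) → ℂ)
    (Module.finBasis ℂ (Grassmann n)).equivFun.toLinearMap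

/-- The odd generator `ξⁱ`. -/
def xi (i : Fin n) : Grassmann n := ExteriorAlgebra.ι ℂ (Pi.single i (1 : ℂ))

/-- The left odd derivative `∂_{ξⁱ}`: the odd (left) derivation with `∂_{ξⁱ} ξʲ = δᵢʲ`. -/
def dxi (i : Fin n) : Grassmann n →ₗ[ℂ] Grassmann n :=
  CliffordAlgebra.contractLeft (Q := (0 : QuadraticForm ℂ (Fin n → ℂ)))
    (LinearMap.proj i : (Fin n → ℂ) →ₗ[ℂ] ℂ)

/-- The parity automorphism: `+1` on even elements, `-1` on odd elements. -/
def parity : Grassmann n →ₐ[ℂ] Grassmann n :=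
  CliffordAlgebra.involute (Q := (0 : QuadraticForm ℂ (Fin n → ℂ)))

/-- The substitution `ξⁱ ↦ ∑ⱼ Aᵢⱼ ξʲ`, extended to an algebra morphism. -/
def subst (A : Matrix (Fin n) (Fin n) ℝ) : Grassmann n →ₐ[ℂ] Grassmann n :=
  ExteriorAlgebra.map (A.map (fun r : ℝ => (r : ℂ))).vecMulLinear

end Grassmann

/-! ### Superdomains: coordinates `(xⁱ, pᵢ, ξⁱ)` -/

/-- The model space `ℝⁿ`. -/
abbrev Model (n : ℕ) : Type := EuclideanSpace ℝ (Fin n)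

/-- The body of a superdomain: the pairs `(x, p)`. -/
abbrev Body (n : ℕ) : Type := Model n × Model n

/-- Index set of the coordinates `(xⁱ, pᵢ, ξⁱ)`. -/
inductive Idx (n : ℕ) : Type
  | x (i : Fin n) : Idx n
  | p (i : Fin n) : Idx n
  | xi (i : Fin n) : Idx n

namespace Idx

/-- The index set as a sum type. -/
def equivSum (n : ℕ) : Idx n ≃ Fin n ⊕ Fin n ⊕ Fin n where
  toFun a := match a with
    | x i => Sum.inl i
    | p i => Sum.inr (Sum.inl i)
    | xi i => Sum.inr (Sum.inr i)
  invFun s := match s with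
    | Sum.inl i => x i
    | Sum.inr (Sum.inl i) => p i
    | Sum.inr (Sum.inr i) => xi i
  left_inv a := by cases a <;> rfl
  right_inv s := by rcases s with i | i | i <;> rfl

instance (n : ℕ) : Fintype (Idx n) := Fintype.ofEquiv _ (equivSum n).symm

/-- The parity `|a| ∈ {0, 1}` of a coordinate: `xⁱ, pᵢ` are even and `ξⁱ` is odd. -/
def par {n : ℕ} : Idx n → ℕ
  | x _ => 0
  | p _ => 0
  | xi _ => 1

end Idx

/-- A function `f(x, p, ξ)` of the coordinates `(x, p, ξ)`. -/
abbrev LocalFun (n : ℕ) : Type := Body n → Grassmann n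

/-- A vector field `∑ Vᵃ ∂ₐ`, given by its (left) coefficients `Vᵃ`. -/
abbrev LocalVF (n : ℕ) : Type := Idx n → LocalFun n

/-- A `1`-form `∑ dzᵃ θₐ`, given by its (right) coefficients `θₐ`. -/
abbrev LocalForm (n : ℕ) : Type := Idx n → LocalFun n

section Local

variable {n : ℕ}

/-- The left partial derivatives `∂_{xⁱ}`, `∂_{pᵢ}`, `∂_{ξⁱ}`. -/
def partialD : Idx n → LocalFun n → LocalFun n
  | Idx.x i, F => fun z => fderiv ℝ F z (EuclideanSpace.single i 1, 0)
  | Idx.p i, F => fun z => fderiv ℝ F z (0, EuclideanSpace.single i 1)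
  | Idx.xi i, F => fun z => Grassmann.dxi i (F z)

/-- The action of a vector field on a function: `V f = ∑ Vᵃ ∂ₐ f`. -/
def act (V : LocalVF n) (F : LocalFun n) : LocalFun n :=
  fun z => ∑ a, V a z * partialD a F z

/-- The differential `df = ∑ dzᵃ ∂ₐ f`. -/
def diff (F : LocalFun n) : LocalForm n := fun a => partialD a F

/-- The contraction `⟨V, θ⟩ = ∑ Vᵃ θₐ` of a vector field with a `1`-form. -/
def pairing (V : LocalVF n) (θ : LocalForm n) : LocalFun n :=
  fun z => ∑ a, V a z * θ a z

/-- The contraction `⟨V, dθ⟩` of a vector field with the exact `2`-form `dθ`, where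
`d (∑ dzᵃ θₐ) = - ∑ dzᵃ ∧ dzᵇ ∂_b θₐ`. By the sign rule
`dzᵃ ∧ dzᵇ = - (-1)^{|a||b|} dzᵇ ∧ dzᵃ` one has
`⟨∂_c, dθ⟩ = ∑ dzᵇ ((-1)^{|b||c|} ∂_c θ_b - ∂_b θ_c)`, and moving the coefficient `Vᶜ` to the
right of `dzᵇ` applies the parity automorphism to it when `b` is odd. -/
def contractD (V : LocalVF n) (θ : LocalForm n) : LocalForm n := fun b z =>
  ∑ c, (Grassmann.parity^[b.par] (V c z)) *
    ((-1 : Grassmann n) ^ (b.par * c.par) * partialD c (θ b) z - partialD b (θ c) z)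

/-- The Lie derivative of a `1`-form along an even vector field, by Cartan's formula
`L_V θ = d ⟨V, θ⟩ + ⟨V, dθ⟩`. -/
def lieDerivForm (V : LocalVF n) (θ : LocalForm n) : LocalForm n :=
  fun b z => diff (pairing V θ) b z + contractD V θ b z

end Local

/-! ### Pseudo-Riemannian manifolds and conformal vector fields -/

section Geometry

variable (n : ℕ) (M : Type*) [TopologicalSpace M] [ChartedSpace (Model n) M]

/-- The charts `(xⁱ)` of the smooth manifold `M`: all elements of the maximal atlas. -/
abbrev Chart : Type _ := {e : OpenPartialHomeomorph M (Model n) //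
  e ∈ IsManifold.maximalAtlas (𝓡 n) ∞ M}

/-- Vector fields on `M` (without any regularity). -/
abbrev VField : Type _ := (x : M) → TangentSpace (𝓡 n) x

/-- A smooth pseudo-Riemannian metric on `M`: a smooth field of nondegenerate symmetric bilinear
forms on the tangent spaces. -/
structure PseudoRiemannianMetric [IsManifold (𝓡 n) ∞ M] where
  /-- The bilinear form on each tangent space. -/
  val (x : M) : TangentSpace (𝓡 n) x →L[ℝ] TangentSpace (𝓡 n) x →L[ℝ] ℝ
  symm (x : M) (v w : TangentSpace (𝓡 n) x) : val x v w = val x w v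
  nondegenerate (x : M) (v : TangentSpace (𝓡 n) x) (hv : ∀ w, val x v w = 0) : v = 0
  contMDiff : ContMDiff (𝓡 n) ((𝓡 n).prod 𝓘(ℝ, Model n →L[ℝ] Model n →L[ℝ] ℝ)) ∞
    (fun x ↦ Bundle.TotalSpace.mk' (Model n →L[ℝ] Model n →L[ℝ] ℝ)
      (E := fun x : M ↦ TangentSpace (𝓡 n) x →L[ℝ] TangentSpace (𝓡 n) x →L[ℝ] ℝ) x (val x))

variable {n M}

/-- A vector field read in a chart. -/
def vread (e : Chart n M) (X : VField n M) (u : Model n) : Model n :=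
  VectorField.mpullback (𝓡 n) (𝓡 n) e.1.symm X u

/-- The components `Xⁱ` of a vector field `X = Xⁱ ∂ᵢ` in a chart. -/
def vcoord (e : Chart n M) (X : VField n M) (i : Fin n) (u : Model n) : ℝ :=
  vread e X u i

/-- The partial derivative `∂ᵢ f` of a function of the coordinates `x`. -/
def pd (i : Fin n) (f : Model n → ℝ) (u : Model n) : ℝ :=
  fderiv ℝ f u (EuclideanSpace.single i 1)

theorem vcoord_add (e : Chart n M) (X Y : VField n M) (i : Fin n) :
    vcoord e (X + Y) i = fun u => vcoord e X i u + vcoord e Y i u := by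
  funext u
  simp [vcoord, vread, VectorField.mpullback_add_apply]
  rfl

theorem vcoord_smul (e : Chart n M) (c : ℝ) (X : VField n M) (i : Fin n) :
    vcoord e (c • X) i = fun u => c * vcoord e X i u := by
  funext u
  simp [vcoord, vread, VectorField.mpullback_const_smul_apply]
  rfl

variable [IsManifold (𝓡 n) ∞ M] (g : PseudoRiemannianMetric n M)

/-- `X` is a smooth vector field on `M`. -/
def IsSmoothField (X : VField n M) : Prop :=
  ContMDiff (𝓡 n) (𝓡 n).tangent ∞ (fun x => (⟨x, X x⟩ : TangentBundle (𝓡 n) M))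

/-- The coordinate vector field `∂ᵢ` of a chart, at the point with coordinates `u`. -/
def frame (e : Chart n M) (i : Fin n) (u : Model n) : TangentSpace (𝓡 n) (e.1.symm u) :=
  mfderiv (𝓡 n) (𝓡 n) e.1.symm u (EuclideanSpace.single i (1 : ℝ) : Model n)

/-- The components `gᵢⱼ = g(∂ᵢ, ∂ⱼ)` of the metric in a chart. -/
def gcoord (e : Chart n M) (i j : Fin n) (u : Model n) : ℝ :=
  g.val (e.1.symm u) (frame e i u) (frame e j u)

/-- The components `gⁱʲ` of the inverse metric in a chart. -/
def ginv (e : Chart n M) (i j : Fin n) (u : Model n) : ℝ :=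
  (Matrix.of fun a b => gcoord g e a b u)⁻¹ i j

/-- The Christoffel symbols `Γᵏᵢⱼ` of the Levi-Civita connection in a chart. -/
def christoffel (e : Chart n M) (k i j : Fin n) (u : Model n) : ℝ :=
  (1 / 2) * ∑ l, ginv g e k l u *
    (pd i (gcoord g e j l) u + pd j (gcoord g e i l) u - pd l (gcoord g e i j) u)

/-- The components `Xⱼ = gⱼₖ Xᵏ` of a vector field, index lowered by the metric. -/
def vlower (e : Chart n M) (X : VField n M) (j : Fin n) (u : Model n) : ℝ :=
  ∑ k, gcoord g e j k u * vcoord e X k u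

/-- The components of the Lie derivative of the metric,
`(L_X g)ᵢⱼ = Xᵏ ∂ₖ gᵢⱼ + gₖⱼ ∂ᵢ Xᵏ + gᵢₖ ∂ⱼ Xᵏ`. -/
def lieDerivMetric (e : Chart n M) (X : VField n M) (i j : Fin n) (u : Model n) : ℝ :=
  ∑ k, (vcoord e X k u * pd k (gcoord g e i j) u + gcoord g e k j u * pd i (vcoord e X k) u
    + gcoord g e i k u * pd j (vcoord e X k) u)

/-- The components of a smooth vector field are differentiable. -/
theorem differentiableAt_vcoord (e : Chart n M) {X : VField n M}
    (hX : IsSmoothField X)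
    (i : Fin n) {u : Model n} (hu : u ∈ e.1.target) : DifferentiableAt ℝ (vcoord e X i) u := by
  have hsymm : ContMDiffAt (𝓡 n) (𝓡 n) ∞ e.1.symm u :=
    contMDiffAt_symm_of_mem_maximalAtlas e.2 hu
  have hdiff : e.1.symm.MDifferentiable (𝓡 n) (𝓡 n) :=
    ⟨(contMDiffOn_symm_of_mem_maximalAtlas e.2).mdifferentiableOn (by simp),
      (contMDiffOn_of_mem_maximalAtlas e.2).mdifferentiableOn (by simp)⟩
  have hinv : (mfderiv (𝓡 n) (𝓡 n) e.1.symm u).IsInvertible := ⟨hdiff.mfderiv hu, rfl⟩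
  have h1 := ContMDiffAt.mpullback_vectorField_preimage (m := 1) (n := ∞)
    ((hX (e.1.symm u)).of_le (by simp)) hsymm hinv (by norm_num; exact WithTop.coe_le_coe.2 (le_top : (2 : ℕ∞) ≤ ⊤))
  have h2 : ContDiffAt ℝ 1 (vread e X) u := contMDiffAt_vectorSpace_iff_contDiffAt.1 h1
  have h3 : DifferentiableAt ℝ (vread e X) u := h2.differentiableAt (by simp)
  exact (EuclideanSpace.proj (𝕜 := ℝ) i).differentiableAt.comp u h3

/-- `X` is a smooth conformal vector field: `L_X g = λ g` for some smooth function `λ`. -/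
def IsConformal (X : VField n M) : Prop :=
  IsSmoothField X ∧ ∃ lam : M → ℝ, ContMDiff (𝓡 n) 𝓘(ℝ) ∞ lam ∧
    ∀ e : Chart n M, ∀ u ∈ e.1.target, ∀ i j,
      lieDerivMetric g e X i j u = lam (e.1.symm u) * gcoord g e i j u

/-- The space `conf(M, g)` of conformal vector fields. -/
def conf : Submodule ℝ (VField n M) where
  carrier := {X | IsConformal g X}
  zero_mem' := by
    refine ⟨Bundle.contMDiff_zeroSection ℝ (TangentSpace (𝓡 n) : M → Type _),
      fun _ => 0, contMDiff_const, fun e u _ i j => ?_⟩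
    have h0 : ∀ k, vcoord e (0 : VField n M) k = fun _ => 0 := fun k => by
      have := vcoord_smul e 0 (0 : VField n M) k
      simpa using this
    simp [lieDerivMetric, h0, pd]
  add_mem' := by
    rintro X Y ⟨hX, a, ha, hXa⟩ ⟨hY, b, hb, hYb⟩
    refine ⟨ContMDiff.add_section hX hY, fun x => a x + b x, ha.add hb, fun e u hu i j => ?_⟩
    have hpd : ∀ k l, pd k (vcoord e (X + Y) l) u
        = pd k (vcoord e X l) u + pd k (vcoord e Y l) u := fun k l => by
      rw [vcoord_add, pd, fderiv_fun_add (differentiableAt_vcoord e hX l hu)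
        (differentiableAt_vcoord e hY l hu)]
      rfl
    rw [add_mul, ← hXa e u hu i j, ← hYb e u hu i j]
    simp only [lieDerivMetric, hpd, ← Finset.sum_add_distrib]
    refine Finset.sum_congr rfl fun k _ => ?_
    rw [vcoord_add]
    ring
  smul_mem' := by
    rintro c X ⟨hX, a, ha, hXa⟩
    refine ⟨ContMDiff.const_smul_section hX, fun x => c * a x, contMDiff_const.mul ha,
      fun e u hu i j => ?_⟩
    have hpd : ∀ k l, pd k (vcoord e (c • X) l) u = c * pd k (vcoord e X l) u := fun k l => by
      rw [vcoord_smul, pd, fderiv_const_mul (differentiableAt_vcoord e hX l hu)]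
      rfl
    rw [mul_assoc, ← hXa e u hu i j]
    simp only [lieDerivMetric, hpd, Finset.mul_sum]
    refine Finset.sum_congr rfl fun k _ => ?_
    rw [vcoord_smul]
    ring

end Geometry

/-! ### The supercotangent bundle -/

section Supercotangent

variable {n : ℕ} {M : Type*} [TopologicalSpace M] [ChartedSpace (Model n) M]

/-- The part of the body `T*M` covered by the natural coordinates `(x, p)` of a chart. -/
def domain (e : Chart n M) : Set (Body n) := {z | z.1 ∈ e.1.target}

/-- The Jacobian matrix `∂x'ⁱ/∂xʲ` of the coordinates `x'` of `e'` with respect to the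
coordinates `x` of `e`. -/
def jacobian (e e' : Chart n M) (u : Model n) : Matrix (Fin n) (Fin n) ℝ :=
  Matrix.of fun i j => pd j (fun v => e'.1 (e.1.symm v) i) u

/-- The change of natural coordinates on `T*M`: `x' = x'(x)`, `p'ᵢ = pⱼ ∂xʲ/∂x'ⁱ`. -/
def transition (e e' : Chart n M) (z : Body n) : Body n :=
  let u' := e'.1 (e.1.symm z.1)
  (u', WithLp.toLp 2 fun i => ∑ j, z.2 j * jacobian e' e u' j i)

/-- A function of the natural coordinates of `e'`, rewritten in the natural coordinates of `e`
by substituting `x' = x'(x)`, `p'ᵢ = pⱼ ∂xʲ/∂x'ⁱ` and `ξ'ⁱ = ξʲ ∂x'ⁱ/∂xʲ`. -/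
def pullback (e e' : Chart n M) (F : LocalFun n) : LocalFun n :=
  fun z => Grassmann.subst (jacobian e e' z.1) (F (transition e e' z))

variable (n M) in
/-- The space `C^∞(𝓜)` of (complex) smooth functions on the supercotangent bundle
`𝓜 = T*M ×_M ΠTM`: a function is given by its smooth expressions `F(x, p, ξ)` in the natural
coordinates of all charts, which have to correspond to each other under the changes of natural
coordinates. The values outside the domains of the charts carry no information and are set
to `0`. -/
def SuperFun : Submodule ℂ (Chart n M → LocalFun n) where
  carrier := {F | (∀ e, ContDiffOn ℝ ∞ (F e) (domain e)) ∧
    (∀ e e', ∀ z ∈ domain e, e.1.symm z.1 ∈ e'.1.source → F e z = pullback e e' (F e') z) ∧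
    (∀ e, ∀ z ∉ domain e, F e z = 0)}
  zero_mem' := ⟨fun _ => contDiffOn_const, fun _ _ _ _ _ => by simp [pullback],
    fun _ _ _ => rfl⟩
  add_mem' := by
    rintro F G ⟨h1, h2, h3⟩ ⟨k1, k2, k3⟩
    refine ⟨fun e => (h1 e).add (k1 e), fun e e' z hz hz' => ?_, fun e z hz => ?_⟩
    · simp only [Pi.add_apply, pullback, map_add]
      exact congrArg₂ _ (h2 e e' z hz hz') (k2 e e' z hz hz')
    · simp [h3 e z hz, k3 e z hz]
  smul_mem' := by
    rintro c F ⟨h1, h2, h3⟩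
    refine ⟨fun e => (h1 e).const_smul c, fun e e' z hz hz' => ?_, fun e z hz => ?_⟩
    · simp only [Pi.smul_apply, pullback, map_smul]
      exact congrArg _ (h2 e e' z hz hz')
    · simp [h3 e z hz]

variable (n M) in
/-- A (smooth, complex) vector field on the supercotangent bundle: a smooth vector field in the
natural coordinates of every chart, such that the actions on functions correspond to each other
under the changes of natural coordinates. The values outside the domains of the charts carry no
information and are set to `0`. -/
@[ext]
structure SuperVF where
  /-- The coefficients in the natural coordinates of a chart. -/
  coeff : Chart n M → LocalVF n
  smooth : ∀ e a, ContDiffOn ℝ ∞ (coeff e a) (domain e)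
  compat : ∀ e e', ∀ F : LocalFun n, ContDiffOn ℝ ∞ F (domain e') →
    ∀ z ∈ domain e, e.1.symm z.1 ∈ e'.1.source →
      act (coeff e) (pullback e e' F) z = pullback e e' (act (coeff e') F) z
  off : ∀ e a, ∀ z ∉ domain e, coeff e a z = 0

/-- An even vector field: the coefficient of `∂ₐ` has the parity of the coordinate `zᵃ`. -/
def SuperVF.IsEven (V : SuperVF n M) : Prop :=
  ∀ e a, ∀ z ∈ domain e,
    Grassmann.parity (V.coeff e a z) = (-1 : Grassmann n) ^ a.par * V.coeff e a z

/-- A real number as an element of the Grassmann algebra. -/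
def sc (r : ℝ) : Grassmann n := algebraMap ℂ (Grassmann n) (r : ℂ)

variable [IsManifold (𝓡 n) ∞ M] (hbar : ℝ) (g : PseudoRiemannianMetric n M)

/-- The potential `1`-form `α = pᵢ dxⁱ + (ħ/2i) gᵢⱼ ξⁱ d^∇ξʲ`, where
`d^∇ξʲ = dξʲ + Γʲₖₗ ξᵏ dxˡ`. The coefficient of `dξʲ` is put on its right, by
`ξⁱ dξʲ = - dξʲ ξⁱ`. -/
def alpha (e : Chart n M) : LocalForm n
  | Idx.x l => fun z => sc (z.2 l) + ((hbar : ℂ) / (2 * Complex.I)) •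
      ∑ i, ∑ j, ∑ k, sc (gcoord g e i j z.1 * christoffel g e j k l z.1) *
        (Grassmann.xi i * Grassmann.xi k)
  | Idx.p _ => fun _ => 0
  | Idx.xi j => fun z => -(((hbar : ℂ) / (2 * Complex.I)) •
      ∑ i, sc (gcoord g e i j z.1) * Grassmann.xi i)

/-- The odd `1`-form `β = gᵢⱼ ξⁱ dxʲ`. -/
def beta (e : Chart n M) : LocalForm n
  | Idx.x j => fun z => ∑ i, sc (gcoord g e i j z.1) * Grassmann.xi i
  | Idx.p _ => fun _ => 0
  | Idx.xi _ => fun _ => 0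

/-- `V` is a Hamiltonian lift of the vector field `X` to the supercotangent bundle: an even vector
field which projects onto `X`, preserves `α`, i.e. `L_V α = 0`, and preserves the direction of
`β`, i.e. `L_V β = f β` for some smooth function `f` on `M`. -/
structure IsHamiltonianLift (X : VField n M) (V : SuperVF n M) : Prop where
  even : V.IsEven
  lift : ∀ e, ∀ z ∈ domain e, ∀ i, V.coeff e (Idx.x i) z = sc (vcoord e X i z.1)
  alpha : ∀ e, ∀ z ∈ domain e, ∀ b, lieDerivForm (V.coeff e) (alpha hbar g e) b z = 0
  beta : ∃ f : M → ℝ, ContMDiff (𝓡 n) 𝓘(ℝ) ∞ f ∧ ∀ e, ∀ z ∈ domain e, ∀ b,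
    lieDerivForm (V.coeff e) (beta g e) b z = sc (f (e.1.symm z.1)) * beta g e b z

/-- `V` is the Hamiltonian vector field of the function `F` for the symplectic form `ω = dα`:
`⟨V, ω⟩ = - dF`. -/
def IsHamiltonianVF (F : SuperFun n M) (V : SuperVF n M) : Prop :=
  ∀ e, ∀ z ∈ domain e, ∀ b, contractD (V.coeff e) (alpha hbar g e) b z = - diff (F.1 e) b z

/-- The function `H` is the Poisson bracket `{F, G}` of `(𝓜, dα)`: the function `F` has a
unique Hamiltonian vector field `V`, and `H = V G`. -/
def IsPoissonBracket (F G H : SuperFun n M) : Prop :=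
  (∃! V : SuperVF n M, IsHamiltonianVF hbar g F V) ∧
  ∀ V : SuperVF n M, IsHamiltonianVF hbar g F V →
    ∀ e, ∀ z ∈ domain e, H.1 e z = act (V.coeff e) (G.1 e) z

/-- The skew-symmetrization `∂_{[k} X_{j]} = (∂ₖ Xⱼ - ∂ⱼ Xₖ) / 2`. -/
def skewD (e : Chart n M) (X : VField n M) (k j : Fin n) (u : Model n) : ℝ :=
  (1 / 2) * (pd k (vlower g e X j) u - pd j (vlower g e X k) u)

end Supercotangent

end Supercotangent

end

open Supercotangent

set_option linter.unusedSectionVars false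

noncomputable section

namespace Supercotangent

/-! ### Algebra of the Grassmann variables: graded Leibniz rule, supercommutativity, linear
substitutions. -/

namespace Grassmann

variable {n : ℕ}

/-! The 2-form dα is nondegenerate (this is where ħ ≠ 0 enters). By Cartan's formula, a field V with
L_V α = 0 is therefore the Hamiltonian vector field of ⟨V, α⟩ and is determined by this function. As
α has no dp-part, ⟨V, α⟩ only involves the x- and ξ-components of V.

Local formula. Contracted with two odd variables, the Christoffel symbols leave only
skew-symmetrized derivatives of g. With βₗ = gᵢₗ ξⁱ this gives αₗ = pₗ − (ħ/2i) ξᵏ∂ₖβₗ for the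
dx-part and −(ħ/2i) βⱼ for the dξ-part (`alpha_x`, `alpha_xi`). For conformal X, a lift preserving
the direction of β must have ξ-components ξᵏ∂ₖXⁱ − c ξⁱ (`IsHamiltonianLift.isLiftAt`). Since ξʲβⱼ =
0, the number c drops out of ⟨V, α⟩, and the formula for J_X follows (`IsLiftAt.pairing_alpha`). All
lifts of X thus have the same Hamiltonian J_X, and nondegeneracy (`eq_zero_of_contractD_alpha`)
makes the lift unique.

Existence. If L_X g = 2f g, take c = f. Then L_V β = f β, and the same identity is the ξ-component
of L_V α = 0. The p-components of V are chosen to make the x-component vanish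
(`lieDerivForm_liftLocal_alpha`). The lifts in two charts agree: for x and ξ by differentiating the
transformation law of X, for p because both fields preserve the globally defined form α
(`alpha_change`, `lieDerivForm_change`, `act_natCoord_liftLocal`).

Morphism property. Conformal fields are closed under the bracket because L_{[X,Y]} = [L_X, L_Y]
(`mlieBracket_mem_conf`). Invariance of α gives {J_X, J_Y} = X̃⟨Ỹ, α⟩ = ⟨[X̃, Ỹ], α⟩
(`act_pairing`). The commutator has the x- and ξ-components of a lift of [X, Y], so the local
formula identifies this with J_{[X,Y]} (`isPoissonBracket_comoment`). -/

theorem induction_on {C : Grassmann n → Prop} (scalar : ∀ r : ℂ, C (algebraMap ℂ _ r))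
    (gen : ∀ i, C (xi i)) (mul : ∀ a b, C a → C b → C (a * b))
    (add : ∀ a b, C a → C b → C (a + b)) (a : Grassmann n) : C a := by
  refine ExteriorAlgebra.induction (C := C) scalar (fun v => ?_) mul add a
  have hv : (ExteriorAlgebra.ι ℂ v : Grassmann n)
      = ∑ i, algebraMap ℂ (Grassmann n) (v i) * xi i := by
    conv_lhs => rw [pi_eq_sum_univ' v]
    refine (map_sum (ExteriorAlgebra.ι ℂ : (Fin n → ℂ) →ₗ[ℂ] _) _ _).trans ?_
    refine Finset.sum_congr rfl fun i _ => ?_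
    rw [← Algebra.smul_def]
    refine (map_smul (ExteriorAlgebra.ι ℂ : (Fin n → ℂ) →ₗ[ℂ] _) _ _).trans ?_
    simp only [xi]
    congr 3
  have key : ∀ s : Finset (Fin n), C (∑ i ∈ s, algebraMap ℂ (Grassmann n) (v i) * xi i) := by
    intro s
    induction s using Finset.cons_induction with
    | empty => simpa using scalar 0
    | cons i s hi ih =>
      rw [Finset.sum_cons]
      exact add _ _ (mul _ _ (scalar _) (gen i)) ih
  exact hv ▸ key Finset.univ

theorem xi_mul_xi (i j : Fin n) : (xi i * xi j : Grassmann n) = -(xi j * xi i) :=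
  eq_neg_of_add_eq_zero_left (ExteriorAlgebra.ι_add_mul_swap (R := ℂ) _ _)

@[simp] theorem parity_xi (i : Fin n) : parity (xi i : Grassmann n) = -xi i :=
  CliffordAlgebra.involute_ι (Q := (0 : QuadraticForm ℂ (Fin n → ℂ))) _

@[simp] theorem parity_parity (a : Grassmann n) : parity (parity a) = a :=
  CliffordAlgebra.involute_involute (Q := (0 : QuadraticForm ℂ (Fin n → ℂ))) a

theorem dxi_xi (i j : Fin n) : dxi i (xi j : Grassmann n) = if i = j then 1 else 0 := by
  have h := CliffordAlgebra.contractLeft_ι (Q := (0 : QuadraticForm ℂ (Fin n → ℂ)))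
    (LinearMap.proj i : (Fin n → ℂ) →ₗ[ℂ] ℂ) (Pi.single j (1 : ℂ))
  refine Eq.trans (show dxi i (xi j : Grassmann n) = _ from h) ?_
  simp only [LinearMap.proj_apply, Pi.single_apply]
  split_ifs
  · exact map_one (algebraMap ℂ (Grassmann n))
  · exact map_zero (algebraMap ℂ (Grassmann n))

@[simp] theorem dxi_algebraMap (i : Fin n) (r : ℂ) :
    dxi i (algebraMap ℂ (Grassmann n) r) = 0 :=
  CliffordAlgebra.contractLeft_algebraMap (Q := (0 : QuadraticForm ℂ (Fin n → ℂ))) _ r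

@[simp] theorem dxi_one (i : Fin n) : dxi i (1 : Grassmann n) = 0 :=
  CliffordAlgebra.contractLeft_one (Q := (0 : QuadraticForm ℂ (Fin n → ℂ))) _

/-- Contraction obeys this rule when the left factor is a generator; induction on the left factor
gives the rest, `parity` being multiplicative. -/
theorem dxi_mul (i : Fin n) (a b : Grassmann n) :
    dxi i (a * b) = dxi i a * b + parity a * dxi i b := by
  induction a using induction_on generalizing b with
  | scalar r => simp [← Algebra.smul_def]
  | gen j =>
    have h := CliffordAlgebra.contractLeft_ι_mul (Q := (0 : QuadraticForm ℂ (Fin n → ℂ)))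
      (LinearMap.proj i : (Fin n → ℂ) →ₗ[ℂ] ℂ) (Pi.single j (1 : ℂ)) b
    refine Eq.trans (show dxi i (xi j * b : Grassmann n) = _ from h) ?_
    have h2 : dxi i (xi j : Grassmann n) * b
        = (Pi.single j (1 : ℂ) : Fin n → ℂ) i • b := by
      rw [dxi_xi, Pi.single_apply]
      split_ifs <;> simp
    rw [h2, parity_xi, neg_mul, ← sub_eq_add_neg]
    rfl
  | mul a c ha hc => rw [mul_assoc, ha, hc, ha c, map_mul]; noncomm_ring
  | add a c ha hc => rw [add_mul, map_add, ha, hc, map_add, map_add]; noncomm_ring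

theorem dxi_parity (i : Fin n) (a : Grassmann n) : dxi i (parity a) = -parity (dxi i a) := by
  induction a using induction_on with
  | scalar r => simp
  | gen j => rw [parity_xi, map_neg, dxi_xi]; split_ifs <;> simp
  | mul a b ha hb => simp only [map_mul, dxi_mul, ha, hb, map_add]; noncomm_ring
  | add a b ha hb => simp only [map_add, ha, hb, neg_add]

/-- The induction runs on the arbitrary factor b, with a of fixed parity. Both parts rest on moving
one generator past any element, ξⁱ a = parity(a) ξⁱ, which is a second induction. -/
theorem mul_comm_aux (b : Grassmann n) : (∀ a : Grassmann n, parity a = a → b * a = a * b) ∧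
    ∀ a : Grassmann n, parity a = -a → b * a = a * parity b := by
  induction b using induction_on with
  | scalar r =>
    exact ⟨fun a _ => Algebra.commutes r a, fun a _ => by
      rw [AlgHom.commutes]; exact Algebra.commutes r a⟩
  | gen i =>
    have key : ∀ a : Grassmann n, xi i * a = parity a * xi i := by
      intro a
      induction a using induction_on with
      | scalar r => rw [AlgHom.commutes]; exact (Algebra.commutes r _).symm
      | gen j => rw [parity_xi, xi_mul_xi, neg_mul]
      | mul a b ha hb => rw [← mul_assoc, ha, mul_assoc, hb, map_mul, mul_assoc]
      | add a b ha hb => rw [mul_add, ha, hb, map_add, add_mul]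
    exact ⟨fun a ha => by rw [key, ha], fun a ha => by rw [key, ha, parity_xi]; simp⟩
  | mul b c hb hc =>
    refine ⟨fun a ha => ?_, fun a ha => ?_⟩
    · rw [mul_assoc, hc.1 a ha, ← mul_assoc, hb.1 a ha, mul_assoc]
    · rw [mul_assoc, hc.2 a ha, ← mul_assoc, hb.2 a ha, map_mul, mul_assoc]
  | add b c hb hc =>
    refine ⟨fun a ha => ?_, fun a ha => ?_⟩
    · rw [add_mul, hb.1 a ha, hc.1 a ha, mul_add]
    · rw [add_mul, hb.2 a ha, hc.2 a ha, map_add, mul_add]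

/-- Even elements are central. -/
theorem mul_comm_of_even {a : Grassmann n} (ha : parity a = a) (b : Grassmann n) :
    b * a = a * b := (mul_comm_aux b).1 a ha

/-- Odd elements commute with everything up to the parity automorphism. -/
theorem mul_comm_of_odd {a : Grassmann n} (ha : parity a = -a) (b : Grassmann n) :
    b * a = a * parity b := (mul_comm_aux b).2 a ha

theorem subst_xi (A : Matrix (Fin n) (Fin n) ℝ) (i : Fin n) :
    subst A (xi i) = ∑ j, A i j • (xi j : Grassmann n) := by
  have h := ExteriorAlgebra.map_apply_ι (A.map (fun r : ℝ => (r : ℂ))).vecMulLinear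
    (Pi.single i (1 : ℂ))
  refine Eq.trans (show subst A (xi i) = _ from h) ?_
  have hv : (A.map (fun r : ℝ => (r : ℂ))).vecMulLinear (Pi.single i (1 : ℂ))
      = ∑ j, (A i j : ℂ) • (Pi.single j (1 : ℂ) : Fin n → ℂ) := by
    ext k
    simp [Pi.single_apply]
  rw [hv]
  refine (map_sum (ExteriorAlgebra.ι ℂ : (Fin n → ℂ) →ₗ[ℂ] _) _ _).trans ?_
  refine Finset.sum_congr rfl fun j _ => ?_
  exact map_smul (ExteriorAlgebra.ι ℂ : (Fin n → ℂ) →ₗ[ℂ] _) _ _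

theorem subst_real_smul (A : Matrix (Fin n) (Fin n) ℝ) (r : ℝ) (a : Grassmann n) :
    subst A (r • a) = r • subst A a := map_smul (subst A) (r : ℂ) a

theorem parity_real_smul (r : ℝ) (a : Grassmann n) :
    parity (r • a) = r • parity a := map_smul parity (r : ℂ) a

theorem subst_parity (A : Matrix (Fin n) (Fin n) ℝ) (a : Grassmann n) :
    subst A (parity a) = parity (subst A a) := by
  induction a using induction_on with
  | scalar r => simp
  | gen j => simp [subst_xi, parity_real_smul]
  | mul a b ha hb => simp only [map_mul, ha, hb]
  | add a b ha hb => simp only [map_add, ha, hb]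

/-- Both sides obey the same parity-twisted Leibniz rule along `subst A`, because linear
substitutions commute with `parity`; so generators suffice. -/
theorem dxi_subst (A : Matrix (Fin n) (Fin n) ℝ) (j : Fin n) (a : Grassmann n) :
    dxi j (subst A a) = ∑ i, A i j • subst A (dxi i a) := by
  induction a using induction_on with
  | scalar r => simp
  | gen k => simp [subst_xi, dxi_xi, apply_ite]
  | mul a b ha hb =>
    simp only [map_mul, dxi_mul, ha, hb, map_add, Finset.sum_mul, Finset.mul_sum,
      smul_add, Finset.sum_add_distrib, subst_parity, smul_mul_assoc, mul_smul_comm]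
  | add a b ha hb => simp only [map_add, ha, hb, smul_add, Finset.sum_add_distrib]

/-- Multiplication as a continuous real bilinear map. -/
def mulL (n : ℕ) : Grassmann n →L[ℝ] Grassmann n →L[ℝ] Grassmann n :=
  LinearMap.toContinuousLinearMap
    ((LinearMap.toContinuousLinearMap :
      (Grassmann n →ₗ[ℝ] Grassmann n) ≃ₗ[ℝ] Grassmann n →L[ℝ] Grassmann n).toLinearMap ∘ₗ
        (LinearMap.mul ℝ (Grassmann n)))

@[simp] theorem mulL_apply (a b : Grassmann n) : mulL n a b = a * b := rfl

/-- A complex linear map between Grassmann algebras as a continuous real linear map. -/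
def toRealL {n m : ℕ} (φ : Grassmann n →ₗ[ℂ] Grassmann m) : Grassmann n →L[ℝ] Grassmann m :=
  LinearMap.toContinuousLinearMap (φ.restrictScalars ℝ)

@[simp] theorem toRealL_apply {n m : ℕ} (φ : Grassmann n →ₗ[ℂ] Grassmann m) (a : Grassmann n) :
    toRealL φ a = φ a := rfl

/-! ### Smooth Grassmann-valued functions and substitutions depending on parameters. -/

section Calculus

variable {E : Type*} [NormedAddCommGroup E] [NormedSpace ℝ E] {z : E} {k : WithTop ℕ∞}

theorem _root_.HasFDerivAt.gmul {F G : E → Grassmann n} {F' G' : E →L[ℝ] Grassmann n}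
    (hF : HasFDerivAt F F' z) (hG : HasFDerivAt G G' z) :
    HasFDerivAt (fun w => F w * G w)
      ((mulL n).precompR E (F z) G' + (mulL n).precompL E F' (G z)) z :=
  (mulL n).hasFDerivAt_of_bilinear hF hG

theorem _root_.ContDiffAt.gmul {F G : E → Grassmann n}
    (hF : ContDiffAt ℝ k F z) (hG : ContDiffAt ℝ k G z) :
    ContDiffAt ℝ k (fun w => F w * G w) z :=
  ((mulL n).isBoundedBilinearMap.contDiff.contDiffAt).comp z (hF.prodMk hG)

theorem fderiv_gmul {F G : E → Grassmann n} (hF : DifferentiableAt ℝ F z)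
    (hG : DifferentiableAt ℝ G z) (v : E) :
    fderiv ℝ (fun w => F w * G w) z v = fderiv ℝ F z v * G z + F z * fderiv ℝ G z v := by
  rw [(hF.hasFDerivAt.gmul hG.hasFDerivAt).fderiv]
  simp [add_comm]

theorem _root_.ContDiffAt.linG {F : E → Grassmann n} (φ : Grassmann n →ₗ[ℂ] Grassmann n)
    (hF : ContDiffAt ℝ k F z) : ContDiffAt ℝ k (fun w => φ (F w)) z :=
  (toRealL φ).contDiff.contDiffAt.comp z hF

theorem fderiv_linG {F : E → Grassmann n} (φ : Grassmann n →ₗ[ℂ] Grassmann n)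
    (hF : DifferentiableAt ℝ F z) (v : E) :
    fderiv ℝ (fun w => φ (F w)) z v = φ (fderiv ℝ F z v) := by
  have h : HasFDerivAt (fun w => φ (F w)) ((toRealL φ).comp (fderiv ℝ F z)) z :=
    (toRealL φ).hasFDerivAt.comp z hF.hasFDerivAt
  rw [h.fderiv]
  simp

theorem contDiffAt_subst_const {A : E → Matrix (Fin n) (Fin n) ℝ}
    (hA : ∀ i j, ContDiffAt ℝ k (fun w => A w i j) z) (a : Grassmann n) :
    ContDiffAt ℝ k (fun w => subst (A w) a) z := by
  induction a using induction_on with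
  | scalar r =>
    simp only [AlgHom.commutes]
    exact contDiffAt_const (c := algebraMap ℂ (Grassmann n) r)
  | gen i =>
    simp only [subst_xi]
    exact ContDiffAt.sum fun j _ => (hA i j).smul (contDiffAt_const (c := (xi j : Grassmann n)))
  | mul a b ha hb => simpa only [map_mul] using ha.gmul hb
  | add a b ha hb => simpa only [map_add] using ha.add hb

/-- The parameter enters only through the substituted generators ξ'ⁱ = Aᵢⱼ ξʲ; this is the chain
rule through them. -/
theorem fderiv_subst_const {A : E → Matrix (Fin n) (Fin n) ℝ}
    (hA : ∀ i j, ContDiffAt ℝ 1 (fun w => A w i j) z) (v : E) (a : Grassmann n) :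
    fderiv ℝ (fun w => subst (A w) a) z v
      = ∑ i, (∑ j, fderiv ℝ (fun w => A w i j) z v • (xi j : Grassmann n)) *
          subst (A z) (dxi i a) := by
  induction a using induction_on with
  | scalar r => simp
  | gen i =>
    have hd : ∀ j ∈ Finset.univ, DifferentiableAt ℝ (fun w => A w i j • (xi j : Grassmann n)) z :=
      fun j _ => ((hA i j).differentiableAt one_ne_zero).smul_const _
    simp only [subst_xi]
    rw [fderiv_fun_sum hd, sum_apply]
    simp only [dxi_xi, apply_ite, map_one, map_zero, mul_one, mul_zero, Finset.sum_ite_eq',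
      Finset.mem_univ, if_true]
    refine Finset.sum_congr rfl fun j _ => ?_
    rw [fderiv_smul_const ((hA i j).differentiableAt one_ne_zero)]
    simp
  | mul a b ha hb =>
    simp only [map_mul]
    rw [fderiv_gmul ((contDiffAt_subst_const hA a).differentiableAt one_ne_zero)
      ((contDiffAt_subst_const hA b).differentiableAt one_ne_zero), ha, hb, Finset.sum_mul,
      Finset.mul_sum, ← Finset.sum_add_distrib]
    refine Finset.sum_congr rfl fun i _ => ?_
    -- The differentiated generator is odd: moving it in front of `subst (A z) a` produces the
    -- parity twist required by the graded Leibniz rule.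
    have hodd : parity (∑ j, fderiv ℝ (fun w => A w i j) z v • (xi j : Grassmann n))
        = -∑ j, fderiv ℝ (fun w => A w i j) z v • (xi j : Grassmann n) := by
      simp [parity_real_smul]
    rw [dxi_mul, map_add, map_mul, map_mul, subst_parity, mul_add, ← mul_assoc (subst (A z) a),
      mul_comm_of_odd hodd]
    simp only [mul_assoc]
  | add a b ha hb =>
    simp only [map_add]
    rw [fderiv_fun_add ((contDiffAt_subst_const hA a).differentiableAt one_ne_zero)
      ((contDiffAt_subst_const hA b).differentiableAt one_ne_zero),
      add_apply, ha, hb, ← Finset.sum_add_distrib]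
    simp only [mul_add]

/-- Expansion in a fixed basis separates the dependence on A from that on a: when both vary, each
summand is a scalar function times the substitution of a constant. -/
theorem subst_eq_sum_coord (A : Matrix (Fin n) (Fin n) ℝ) (a : Grassmann n) :
    subst A a = ∑ m, (Module.finBasis ℂ (Grassmann n)).coord m a •
      subst A (Module.finBasis ℂ (Grassmann n) m) := by
  conv_lhs => rw [← (Module.finBasis ℂ (Grassmann n)).sum_repr a]
  simp only [map_sum, map_smul]
  rfl

/-- The complex coordinates of a Grassmann element, as continuous real linear maps. -/
def coordL (m : Fin (Module.finrank ℂ (Grassmann n))) : Grassmann n →L[ℝ] ℂ :=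
  LinearMap.toContinuousLinearMap
    (((Module.finBasis ℂ (Grassmann n)).coord m).restrictScalars ℝ)

theorem coordL_apply (m : Fin (Module.finrank ℂ (Grassmann n))) (a : Grassmann n) :
    coordL m a = (Module.finBasis ℂ (Grassmann n)).coord m a := rfl

theorem _root_.ContDiffAt.subst {A : E → Matrix (Fin n) (Fin n) ℝ} {G : E → Grassmann n}
    (hA : ∀ i j, ContDiffAt ℝ k (fun w => A w i j) z) (hG : ContDiffAt ℝ k G z) :
    ContDiffAt ℝ k (fun w => Grassmann.subst (A w) (G w)) z := by
  have h : (fun w => Grassmann.subst (A w) (G w)) = fun w => ∑ m, coordL m (G w) •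
      Grassmann.subst (A w) (Module.finBasis ℂ (Grassmann n) m) := by
    funext w
    exact subst_eq_sum_coord _ _
  rw [h]
  exact ContDiffAt.sum fun m _ => ((coordL m).contDiff.contDiffAt.comp z hG).smul
    (contDiffAt_subst_const hA _)

theorem fderiv_subst {A : E → Matrix (Fin n) (Fin n) ℝ} {G : E → Grassmann n}
    (hA : ∀ i j, ContDiffAt ℝ 1 (fun w => A w i j) z) (hG : DifferentiableAt ℝ G z) (v : E) :
    fderiv ℝ (fun w => subst (A w) (G w)) z v = subst (A z) (fderiv ℝ G z v) +
      ∑ i, (∑ j, fderiv ℝ (fun w => A w i j) z v • (xi j : Grassmann n)) *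
        subst (A z) (dxi i (G z)) := by
  have h : (fun w => Grassmann.subst (A w) (G w)) = fun w => ∑ m, coordL m (G w) •
      Grassmann.subst (A w) (Module.finBasis ℂ (Grassmann n) m) := by
    funext w
    exact subst_eq_sum_coord _ _
  have hs : ∀ m, DifferentiableAt ℝ
      (fun w => Grassmann.subst (A w) (Module.finBasis ℂ (Grassmann n) m)) z := fun m =>
    (contDiffAt_subst_const hA _).differentiableAt one_ne_zero
  have hc : ∀ m : Fin (Module.finrank ℂ (Grassmann n)),
      HasFDerivAt (fun w => coordL m (G w)) ((coordL m).comp (fderiv ℝ G z)) z := fun m =>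
    (coordL m).hasFDerivAt.comp z hG.hasFDerivAt
  have hd : ∀ m ∈ Finset.univ, DifferentiableAt ℝ (fun w => coordL m (G w) •
      Grassmann.subst (A w) (Module.finBasis ℂ (Grassmann n) m)) z := fun m _ =>
    (hc m).differentiableAt.smul (hs m)
  rw [h, fderiv_fun_sum hd,
    sum_apply, subst_eq_sum_coord (A z) (fderiv ℝ G z v)]
  have h2 : ∀ i, subst (A z) (dxi i (G z)) = ∑ m, coordL m (G z) •
      subst (A z) (dxi i (Module.finBasis ℂ (Grassmann n) m)) := by
    intro i
    conv_lhs => rw [← (Module.finBasis ℂ (Grassmann n)).sum_repr (G z)]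
    simp only [map_sum, map_smul]
    rfl
  simp only [h2, Finset.mul_sum]
  rw [Finset.sum_comm, ← Finset.sum_add_distrib]
  refine Finset.sum_congr rfl fun m _ => ?_
  have hcs : HasFDerivAt (fun w => coordL m (G w) •
      Grassmann.subst (A w) (Module.finBasis ℂ (Grassmann n) m)) _ z :=
    (hc m).smul (hs m).hasFDerivAt
  rw [hcs.fderiv]
  simp only [add_apply, smul_apply,
    ContinuousLinearMap.smulRight_apply, ContinuousLinearMap.comp_apply, fderiv_subst_const hA,
    coordL_apply, Finset.smul_sum, mul_smul_comm]
  rw [add_comm]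

end Calculus

end Grassmann

end Supercotangent
end

/-! ### Calculus in the coordinates (x, p, ξ) of a superdomain. -/

noncomputable section

namespace Supercotangent

open Grassmann Filter Topology

variable {n : ℕ}

theorem sc_eq_smul (r : ℝ) : (sc r : Grassmann n) = r • (1 : Grassmann n) :=
  Algebra.algebraMap_eq_smul_one (r : ℂ)

theorem sc_mul (r : ℝ) (a : Grassmann n) : sc r * a = r • a := by
  rw [sc_eq_smul, smul_mul_assoc, one_mul]

theorem mul_sc (a : Grassmann n) (r : ℝ) : a * sc r = r • a := by
  rw [sc_eq_smul, mul_smul_comm, mul_one]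

@[simp] theorem parity_sc (r : ℝ) : parity (sc r : Grassmann n) = sc r := AlgHom.commutes _ _

@[simp] theorem subst_sc (A : Matrix (Fin n) (Fin n) ℝ) (r : ℝ) :
    subst A (sc r : Grassmann n) = sc r := AlgHom.commutes _ _

theorem sc_add (r s : ℝ) : (sc (r + s) : Grassmann n) = sc r + sc s := by simp [sc]

theorem sc_mul_sc (r s : ℝ) : (sc (r * s) : Grassmann n) = sc r * sc s := by simp [sc]

theorem sc_sum {ι : Type*} (s : Finset ι) (f : ι → ℝ) :
    (sc (∑ i ∈ s, f i) : Grassmann n) = ∑ i ∈ s, sc (f i) := by simp [sc]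

theorem contDiffAt_smul_const {E : Type*} [NormedAddCommGroup E] [NormedSpace ℝ E]
    {h : E → ℝ} {x : E} {k : WithTop ℕ∞} (hh : ContDiffAt ℝ k h x) (a : Grassmann n) :
    ContDiffAt ℝ k (fun w => h w • a) x :=
  hh.smul (contDiffAt_const (c := a))

/-! ### Sums over the coordinates -/

theorem sum_idx {β : Type*} [AddCommMonoid β] (f : Idx n → β) :
    ∑ a, f a = ∑ i, f (Idx.x i) + (∑ i, f (Idx.p i) + ∑ i, f (Idx.xi i)) := by
  rw [← (Idx.equivSum n).symm.sum_comp, Fintype.sum_sum_type, Fintype.sum_sum_type]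
  rfl

variable {F G : LocalFun n} {z : Body n}

/-! ### Partial derivatives -/

theorem partialD_congr (a : Idx n) (h : F =ᶠ[𝓝 z] G) : partialD a F z = partialD a G z := by
  cases a with
  | x i => simp only [partialD, h.fderiv_eq]
  | p i => simp only [partialD, h.fderiv_eq]
  | xi i => simp only [partialD, h.eq_of_nhds]

theorem _root_.ContDiffAt.partialD (a : Idx n) (hF : ContDiffAt ℝ ∞ F z) :
    ContDiffAt ℝ ∞ (Supercotangent.partialD a F) z := by
  cases a with
  | x i => exact (hF.fderiv_right (m := ∞) (by simp)).clm_apply contDiffAt_const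
  | p i => exact (hF.fderiv_right (m := ∞) (by simp)).clm_apply contDiffAt_const
  | xi i => exact hF.linG (dxi i)

theorem _root_.ContDiffAt.differentiableAt_of_infty {E E' : Type*} [NormedAddCommGroup E]
    [NormedSpace ℝ E] [NormedAddCommGroup E'] [NormedSpace ℝ E'] {f : E → E'} {x : E}
    (hf : ContDiffAt ℝ ∞ f x) : DifferentiableAt ℝ f x := hf.differentiableAt (by simp)

theorem partialD_add (a : Idx n) (hF : DifferentiableAt ℝ F z) (hG : DifferentiableAt ℝ G z) :
    partialD a (fun w => F w + G w) z = partialD a F z + partialD a G z := by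
  cases a with
  | xi i => simp [partialD]
  | _ i => simp [partialD, fderiv_fun_add hF hG]

theorem partialD_neg (a : Idx n) :
    partialD a (fun w => -F w) z = -partialD a F z := by
  cases a with
  | xi i => simp [partialD]
  | _ i => exact congrArg (fun L : Body n →L[ℝ] Grassmann n => L _) fderiv_fun_neg

theorem partialD_const_smul (a : Idx n) (c : ℂ) (hF : DifferentiableAt ℝ F z) :
    partialD a (fun w => c • F w) z = c • partialD a F z := by
  cases a with
  | xi i => simp [partialD]
  | _ i => simp [partialD, fderiv_fun_const_smul hF]

theorem partialD_sum {ι : Type*} (s : Finset ι) (a : Idx n) {F : ι → LocalFun n}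
    (hF : ∀ i ∈ s, DifferentiableAt ℝ (F i) z) :
    partialD a (fun w => ∑ i ∈ s, F i w) z = ∑ i ∈ s, partialD a (F i) z := by
  cases a with
  | xi i => simp [partialD]
  | _ i => simp [partialD, fderiv_fun_sum hF]

theorem partialD_mul (a : Idx n) (hF : DifferentiableAt ℝ F z) (hG : DifferentiableAt ℝ G z) :
    partialD a (fun w => F w * G w) z
      = partialD a F z * G z + parity^[a.par] (F z) * partialD a G z := by
  cases a with
  | xi i => simp [partialD, Idx.par, dxi_mul]
  | _ i => simp [partialD, Idx.par, fderiv_gmul hF hG]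

/-- Symmetry of second derivatives for the even coordinates; for ξ, the odd derivative is a constant
linear map and passes through `fderiv`. -/
theorem partialD_x_comm (i : Fin n) (c : Idx n) (hF : ContDiffAt ℝ ∞ F z) :
    partialD (Idx.x i) (partialD c F) z = partialD c (partialD (Idx.x i) F) z := by
  have hd : DifferentiableAt ℝ (fderiv ℝ F) z :=
    (hF.fderiv_right (m := ∞) (by simp)).differentiableAt_of_infty
  have hsymm : IsSymmSndFDerivAt ℝ F z :=
    (contDiffAt_infty.1 hF 2).isSymmSndFDerivAt (by simp)
  cases c with
  | xi j => exact fderiv_linG (dxi j) hF.differentiableAt_of_infty _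
  | _ j =>
    simp only [partialD]
    rw [fderiv_clm_apply hd (differentiableAt_const _),
      fderiv_clm_apply hd (differentiableAt_const _)]
    simpa using hsymm.eq _ _

/-! ### Functions of `x` alone -/

theorem differentiableAt_base {h : Model n → ℝ} (hh : DifferentiableAt ℝ h z.1)
    (a : Grassmann n) : DifferentiableAt ℝ (fun w : Body n => h w.1 • a) z := by
  have : DifferentiableAt ℝ (fun w : Body n => h w.1) z := hh.comp z differentiableAt_fst
  exact this.smul_const a

theorem contDiffAt_base {h : Model n → ℝ} (hh : ContDiffAt ℝ ∞ h z.1)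
    (a : Grassmann n) : ContDiffAt ℝ ∞ (fun w : Body n => h w.1 • a) z := by
  have : ContDiffAt ℝ ∞ (fun w : Body n => h w.1) z := hh.comp z contDiffAt_fst
  exact contDiffAt_smul_const this a

theorem partialD_x_base (i : Fin n) {h : Model n → ℝ} (hh : DifferentiableAt ℝ h z.1)
    (a : Grassmann n) :
    partialD (Idx.x i) (fun w : Body n => h w.1 • a) z = pd i h z.1 • a := by
  have h1 : HasFDerivAt (fun w : Body n => h w.1)
      ((fderiv ℝ h z.1).comp (ContinuousLinearMap.fst ℝ (Model n) (Model n))) z :=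
    hh.hasFDerivAt.comp z hasFDerivAt_fst
  simp only [partialD]
  rw [(h1.smul_const a).fderiv]
  simp [pd]

theorem partialD_p_base (i : Fin n) {h : Model n → ℝ} (hh : DifferentiableAt ℝ h z.1)
    (a : Grassmann n) :
    partialD (Idx.p i) (fun w : Body n => h w.1 • a) z = 0 := by
  have h1 : HasFDerivAt (fun w : Body n => h w.1)
      ((fderiv ℝ h z.1).comp (ContinuousLinearMap.fst ℝ (Model n) (Model n))) z :=
    hh.hasFDerivAt.comp z hasFDerivAt_fst
  simp only [partialD]
  rw [(h1.smul_const a).fderiv]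
  simp

theorem partialD_sc_p (a : Idx n) (j : Fin n) :
    partialD a (fun w : Body n => (sc (w.2 j) : Grassmann n)) z
      = match a with
        | Idx.p i => if i = j then 1 else 0
        | _ => 0 := by
  have h1 : HasFDerivAt (fun w : Body n => w.2 j)
      ((EuclideanSpace.proj (𝕜 := ℝ) j).comp
        (ContinuousLinearMap.snd ℝ (Model n) (Model n))) z :=
    (EuclideanSpace.proj (𝕜 := ℝ) j).hasFDerivAt.comp z hasFDerivAt_snd
  simp only [sc_eq_smul]
  have h2 := (h1.smul_const (1 : Grassmann n)).fderiv
  cases a with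
  | xi i => simp [partialD]
  | x i => simp only [partialD]; rw [h2]; simp
  | p i =>
    simp only [partialD]; rw [h2]
    simp [eq_comm]

theorem contDiffAt_sc_p (j : Fin n) :
    ContDiffAt ℝ ∞ (fun w : Body n => (sc (w.2 j) : Grassmann n)) z := by
  simp only [sc_eq_smul]
  have h1 : ContDiffAt ℝ ∞ (fun w : Body n => w.2 j) z :=
    (EuclideanSpace.proj (𝕜 := ℝ) j).contDiff.contDiffAt.comp z contDiffAt_snd
  exact contDiffAt_smul_const h1 _

/-! ### Even vector fields -/

/-- The coefficients of `V` at `z` have the parities of those of an even vector field. -/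
def EvenAt (V : LocalVF n) (z : Body n) : Prop :=
  ∀ a, parity (V a z) = (-1 : Grassmann n) ^ a.par * V a z

/-- The coefficients of `V` (a vector field or a `1`-form) are smooth at `z`. -/
def SmoothAt (V : Idx n → LocalFun n) (z : Body n) : Prop := ∀ a, ContDiffAt ℝ ∞ (V a) z

theorem SmoothAt.diff {V : Idx n → LocalFun n} (hV : SmoothAt V z) (a : Idx n) :
    DifferentiableAt ℝ (V a) z := (hV a).differentiableAt_of_infty

variable {V W : LocalVF n} {θ : LocalForm n}

/-- The parity twist in the Leibniz rule of ∂ₐ is exactly the price of moving Vᵃ past b; hence even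
fields act as ordinary derivations (`act_mul`). -/
theorem EvenAt.mul_parity (hV : EvenAt V z) (a : Idx n) (b : Grassmann n) :
    V a z * parity^[a.par] b = b * V a z := by
  have h := hV a
  cases a with
  | xi i =>
    simp only [Idx.par, pow_one, Function.iterate_one, neg_mul, one_mul] at h ⊢
    exact (mul_comm_of_odd h b).symm
  | _ i =>
    simp only [Idx.par, pow_zero, Function.iterate_zero, id, one_mul] at h ⊢
    exact (mul_comm_of_even h b).symm

theorem _root_.ContDiffAt.act (hV : SmoothAt V z) (hF : ContDiffAt ℝ ∞ F z) :
    ContDiffAt ℝ ∞ (Supercotangent.act V F) z :=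
  ContDiffAt.sum fun a _ => (hV a).gmul (hF.partialD a)

theorem SmoothAt.pairing (hV : SmoothAt V z) (hθ : SmoothAt θ z) :
    ContDiffAt ℝ ∞ (pairing V θ) z :=
  ContDiffAt.sum fun a _ => (hV a).gmul (hθ a)

theorem act_congr (V : LocalVF n) (h : F =ᶠ[𝓝 z] G) : act V F z = act V G z :=
  Finset.sum_congr rfl fun a _ => by rw [partialD_congr a h]

theorem act_sum {ι : Type*} (s : Finset ι) {F : ι → LocalFun n}
    (hF : ∀ i ∈ s, DifferentiableAt ℝ (F i) z) :
    act V (fun w => ∑ i ∈ s, F i w) z = ∑ i ∈ s, act V (F i) z := by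
  simp only [act, partialD_sum s _ hF, Finset.mul_sum]
  exact Finset.sum_comm

theorem act_mul (hV : EvenAt V z) (hF : DifferentiableAt ℝ F z) (hG : DifferentiableAt ℝ G z) :
    act V (fun w => F w * G w) z = act V F z * G z + F z * act V G z := by
  simp only [act, partialD_mul _ hF hG, mul_add, Finset.sum_add_distrib, Finset.sum_mul,
    Finset.mul_sum, ← mul_assoc, hV.mul_parity]

/-- Cartan's formula in coordinates: `(L_V θ)_b = ∑ (∂_b Vᶜ) θ_c + V θ_b` for even `V`. -/
theorem lieDerivForm_of_even (hV : EvenAt V z) (hs : SmoothAt V z) (hθ : SmoothAt θ z)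
    (b : Idx n) : lieDerivForm V θ b z
      = ∑ c, partialD b (V c) z * θ c z + act V (θ b) z := by
  have h1 : Supercotangent.diff (pairing V θ) b z = ∑ c, (partialD b (V c) z * θ c z
      + parity^[b.par] (V c z) * partialD b (θ c) z) := by
    simp only [Supercotangent.diff]
    refine (partialD_sum _ b fun c _ => ?_).trans
      (Finset.sum_congr rfl fun c _ => partialD_mul b (hs.diff c) (hθ.diff c))
    exact ((hs c).gmul (hθ c)).differentiableAt_of_infty
  simp only [lieDerivForm, h1, contractD, act, ← Finset.sum_add_distrib]
  refine Finset.sum_congr rfl fun c _ => ?_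
  -- For even V the twist of Vᶜ and the sign (-1)^{|b||c|} cancel. The other half of ⟨V, dθ⟩ keeps
  -- its twist and cancels against the corresponding terms of d⟨V, θ⟩.
  have h2 : parity^[b.par] (V c z) * (-1 : Grassmann n) ^ (b.par * c.par) = V c z := by
    have h := hV c
    cases b <;> cases c <;> simp_all [Idx.par]
  rw [mul_sub, ← mul_assoc, h2]
  abel

theorem partialD_x_act (hs : SmoothAt V z) (hF : ContDiffAt ℝ ∞ F z) (l : Fin n) :
    partialD (Idx.x l) (act V F) z = ∑ c, partialD (Idx.x l) (V c) z * partialD c F z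
      + act V (partialD (Idx.x l) F) z := by
  have h1 : partialD (Idx.x l) (act V F) z = ∑ c, (partialD (Idx.x l) (V c) z * partialD c F z
      + V c z * partialD (Idx.x l) (partialD c F) z) := by
    refine (partialD_sum _ _ fun c _ => ?_).trans (Finset.sum_congr rfl fun c _ =>
      partialD_mul _ (hs.diff c) (hF.partialD c).differentiableAt_of_infty)
    exact ((hs c).gmul (hF.partialD c)).differentiableAt_of_infty
  simp only [h1, act, ← Finset.sum_add_distrib]
  exact Finset.sum_congr rfl fun c _ => by rw [partialD_x_comm l c hF]

/-- If `L_V θ = 0` for an even `V`, then `V ⟨W, θ⟩ = ⟨[V, W], θ⟩`. -/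
theorem act_pairing (hV : EvenAt V z) (hs : SmoothAt V z) (hW : SmoothAt W z)
    (hθ : SmoothAt θ z) (h : ∀ b, lieDerivForm V θ b z = 0) :
    act V (pairing W θ) z = ∑ c, (act V (W c) z - act W (V c) z) * θ c z := by
  have h1 : act V (pairing W θ) z
      = ∑ a, (act V (W a) z * θ a z + W a z * act V (θ a) z) := by
    refine (act_sum _ fun a _ => ?_).trans (Finset.sum_congr rfl fun a _ =>
      act_mul hV (hW.diff a) (hθ.diff a))
    exact ((hW a).gmul (hθ a)).differentiableAt_of_infty
  -- Invariance of θ trades V θₐ for derivatives of the coefficients of V, which reassemble into −W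
  -- Vᶜ.
  have h2 : ∀ a, act V (θ a) z = -∑ c, partialD a (V c) z * θ c z := fun a => by
    have := h a
    rw [lieDerivForm_of_even hV hs hθ] at this
    exact eq_neg_of_add_eq_zero_right this
  rw [h1]
  simp only [h2]
  simp only [Finset.sum_add_distrib, sub_mul, Finset.sum_sub_distrib, mul_neg,
    Finset.sum_neg_distrib, act, Finset.mul_sum, Finset.sum_mul, ← mul_assoc]
  rw [← sub_eq_add_neg]
  congr 1
  exact Finset.sum_comm

/-! ### Changes of coordinates -/

section Change

variable (φ : Body n → Body n) (A : Body n → Matrix (Fin n) (Fin n) ℝ)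

/-- The new coordinates as functions of the old ones: `φ` gives the even ones, and
`ξ'ⁱ = Aᵢⱼ ξʲ`. -/
def newCoord : Idx n → LocalFun n
  | Idx.x i => fun w => (φ w).1 i • (1 : Grassmann n)
  | Idx.p i => fun w => (φ w).2 i • (1 : Grassmann n)
  | Idx.xi i => fun w => ∑ j, A w i j • (xi j : Grassmann n)

variable {φ A}

theorem fderiv_eq_sum {f : Body n → Grassmann n} (v : Body n) : fderiv ℝ f z v
    = ∑ i, v.1 i • partialD (Idx.x i) f z + ∑ i, v.2 i • partialD (Idx.p i) f z := by
  have hv : v = ∑ i, v.1 i • ((EuclideanSpace.single i 1, 0) : Body n)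
      + ∑ i, v.2 i • ((0, EuclideanSpace.single i 1) : Body n) := by
    ext j <;> simp [Prod.fst_sum, Prod.snd_sum, Pi.single_apply, Finset.sum_apply]
  conv_lhs => rw [hv]
  simp only [map_add, map_sum, map_smul, partialD]

variable (hφ : ContDiffAt ℝ ∞ φ z) (hA : ∀ i j, ContDiffAt ℝ ∞ (fun w => A w i j) z)
include hφ hA

theorem smoothAt_newCoord : SmoothAt (newCoord φ A) z := by
  intro b
  cases b with
  | x i =>
    have h : ContDiffAt ℝ ∞ (fun w => (φ w).1 i) z :=
      (EuclideanSpace.proj (𝕜 := ℝ) i).contDiff.contDiffAt.comp z hφ.fst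
    exact contDiffAt_smul_const h _
  | p i =>
    have h : ContDiffAt ℝ ∞ (fun w => (φ w).2 i) z :=
      (EuclideanSpace.proj (𝕜 := ℝ) i).contDiff.contDiffAt.comp z hφ.snd
    exact contDiffAt_smul_const h _
  | xi i => exact ContDiffAt.sum fun j _ => contDiffAt_smul_const (hA i j) _

theorem contDiffAt_change (hF : ContDiffAt ℝ ∞ F (φ z)) :
    ContDiffAt ℝ ∞ (fun w => subst (A w) (F (φ w))) z :=
  ContDiffAt.subst hA (hF.comp z hφ)

/-- The chain rule. -/
theorem partialD_change (hF : ContDiffAt ℝ ∞ F (φ z)) (a : Idx n) :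
    partialD a (fun w => subst (A w) (F (φ w))) z
      = ∑ b, partialD a (newCoord φ A b) z * subst (A z) (partialD b F (φ z)) := by
  have hA1 : ∀ i j, ContDiffAt ℝ 1 (fun w => A w i j) z := fun i j => (hA i j).of_le (by simp)
  have hFd := hF.differentiableAt_of_infty
  have hφd := hφ.differentiableAt_of_infty
  -- The x- and p-derivatives are directional derivatives on the body and are treated together; the
  -- ξ-derivatives reduce to `dxi_subst`.
  have key : ∀ v : Body n, fderiv ℝ (fun w => subst (A w) (F (φ w))) z v
      = ∑ b, fderiv ℝ (newCoord φ A b) z v * subst (A z) (partialD b F (φ z)) := by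
    intro v
    have hcomp : HasFDerivAt (fun w => F (φ w)) ((fderiv ℝ F (φ z)).comp (fderiv ℝ φ z)) z :=
      hFd.hasFDerivAt.comp z hφd.hasFDerivAt
    have hx : ∀ i, fderiv ℝ (newCoord φ A (Idx.x i)) z v
        = (fderiv ℝ φ z v).1 i • (1 : Grassmann n) := fun i => by
      have h : HasFDerivAt (fun w => (φ w).1 i) ((EuclideanSpace.proj (𝕜 := ℝ) i).comp
          ((ContinuousLinearMap.fst ℝ (Model n) (Model n)).comp (fderiv ℝ φ z))) z :=
        (EuclideanSpace.proj (𝕜 := ℝ) i).hasFDerivAt.comp z hφd.hasFDerivAt.fst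
      exact (congrArg (fun L : Body n →L[ℝ] Grassmann n => L v)
        (h.smul_const (1 : Grassmann n)).fderiv)
    have hp : ∀ i, fderiv ℝ (newCoord φ A (Idx.p i)) z v
        = (fderiv ℝ φ z v).2 i • (1 : Grassmann n) := fun i => by
      have h : HasFDerivAt (fun w => (φ w).2 i) ((EuclideanSpace.proj (𝕜 := ℝ) i).comp
          ((ContinuousLinearMap.snd ℝ (Model n) (Model n)).comp (fderiv ℝ φ z))) z :=
        (EuclideanSpace.proj (𝕜 := ℝ) i).hasFDerivAt.comp z hφd.hasFDerivAt.snd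
      exact (congrArg (fun L : Body n →L[ℝ] Grassmann n => L v)
        (h.smul_const (1 : Grassmann n)).fderiv)
    have hxi : ∀ i, fderiv ℝ (newCoord φ A (Idx.xi i)) z v
        = ∑ j, fderiv ℝ (fun w => A w i j) z v • (xi j : Grassmann n) := fun i => by
      have h : HasFDerivAt (newCoord φ A (Idx.xi i))
          (∑ j, (fderiv ℝ (fun w => A w i j) z).smulRight (xi j : Grassmann n)) z :=
        HasFDerivAt.fun_sum fun j _ =>
          ((hA i j).differentiableAt_of_infty.hasFDerivAt.smul_const (xi j : Grassmann n))
      rw [h.fderiv]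
      simp
    rw [fderiv_subst hA1 hcomp.differentiableAt, hcomp.fderiv, ContinuousLinearMap.comp_apply,
      fderiv_eq_sum, sum_idx]
    simp only [hx, hp, hxi, map_add, map_sum, subst_real_smul, smul_mul_assoc, one_mul]
    rw [add_assoc]
    rfl
  cases a with
  | x i => exact key _
  | p i => exact key _
  | xi i =>
    rw [sum_idx]
    simp [partialD, newCoord, dxi_subst, dxi_xi]

theorem act_change (hF : ContDiffAt ℝ ∞ F (φ z)) :
    act V (fun w => subst (A w) (F (φ w))) z
      = ∑ b, act V (newCoord φ A b) z * subst (A z) (partialD b F (φ z)) := by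
  simp only [act, partialD_change hφ hA hF, Finset.mul_sum, Finset.sum_mul, mul_assoc]
  exact Finset.sum_comm

/-- By the chain rule, two vector fields correspond on all smooth functions as soon as they
correspond on the new coordinate functions. -/
theorem act_change_of_coord {V' : LocalVF n}
    (h : ∀ b, act V (newCoord φ A b) z = subst (A z) (V' b (φ z)))
    (hF : ContDiffAt ℝ ∞ F (φ z)) :
    act V (fun w => subst (A w) (F (φ w))) z = subst (A z) (act V' F (φ z)) := by
  rw [act_change hφ hA hF]
  simp only [act, map_sum, map_mul, ← h]

/-- If the even vector fields `V`, `V'` preserve the form `θ`, which is the same in both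
coordinate systems, then their difference annihilates `θ`. -/
theorem lieDerivForm_change {V' : LocalVF n} {θ' : LocalForm n} (l : Fin n)
    (hV : EvenAt V z) (hVs : SmoothAt V z) (hθ : SmoothAt θ z)
    (hV' : EvenAt V' (φ z)) (hVs' : SmoothAt V' (φ z)) (hθ' : SmoothAt θ' (φ z))
    (hform : ∀ a, θ a =ᶠ[𝓝 z]
      fun w => ∑ b, partialD a (newCoord φ A b) w * subst (A w) (θ' b (φ w)))
    (hL : lieDerivForm V θ (Idx.x l) z = 0) (hL' : ∀ b, lieDerivForm V' θ' b (φ z) = 0)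
    (hcoord : ∀ b, θ' b (φ z) = 0 ∨
      act V (newCoord φ A b) =ᶠ[𝓝 z] fun w => subst (A w) (V' b (φ w))) :
    ∑ b, partialD (Idx.x l) (newCoord φ A b) z *
      ∑ d, (act V (newCoord φ A d) z - subst (A z) (V' d (φ z))) *
        subst (A z) (partialD d (θ' b) (φ z)) = 0 := by
  have hZ := smoothAt_newCoord hφ hA
  have e1 : act V (θ (Idx.x l)) z = ∑ b, (act V (partialD (Idx.x l) (newCoord φ A b)) z *
      subst (A z) (θ' b (φ z)) + partialD (Idx.x l) (newCoord φ A b) z *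
      ∑ d, act V (newCoord φ A d) z * subst (A z) (partialD d (θ' b) (φ z))) := by
    rw [act_congr V (hform (Idx.x l))]
    refine (act_sum _ fun b _ => ?_).trans (Finset.sum_congr rfl fun b _ => ?_)
    · exact (((hZ b).partialD _).gmul
        (contDiffAt_change hφ hA (hθ' b))).differentiableAt_of_infty
    · rw [act_mul hV ((hZ b).partialD _).differentiableAt_of_infty
        (contDiffAt_change hφ hA (hθ' b)).differentiableAt_of_infty, act_change hφ hA (hθ' b)]
  have e2 : ∑ c, partialD (Idx.x l) (V c) z * θ c z
      = ∑ b, (∑ c, partialD (Idx.x l) (V c) z * partialD c (newCoord φ A b) z) *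
        subst (A z) (θ' b (φ z)) := by
    simp only [(hform _).eq_of_nhds, Finset.mul_sum, Finset.sum_mul, mul_assoc]
    exact Finset.sum_comm
  -- The correspondence of V and V' is needed only along coordinates with θ'_b ≠ 0. For α this
  -- exempts the p-components, the very ones the lemma serves to compare.
  have e3 : ∀ b, partialD (Idx.x l) (act V (newCoord φ A b)) z * subst (A z) (θ' b (φ z))
      = (∑ d, partialD (Idx.x l) (newCoord φ A d) z *
        subst (A z) (partialD d (V' b) (φ z))) * subst (A z) (θ' b (φ z)) := by
    intro b
    rcases hcoord b with h | h
    · rw [h, map_zero, mul_zero, mul_zero]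
    · rw [partialD_congr _ h, partialD_change hφ hA (hVs' b)]
  have e4 : ∀ b, ∑ d, subst (A z) (partialD b (V' d) (φ z)) * subst (A z) (θ' d (φ z))
      = -∑ d, subst (A z) (V' d (φ z)) * subst (A z) (partialD d (θ' b) (φ z)) := by
    intro b
    have h := congrArg (subst (A z)) (hL' b)
    rw [lieDerivForm_of_even hV' hVs' hθ', map_add, map_zero] at h
    simpa only [act, map_sum, map_mul] using eq_neg_of_add_eq_zero_left h
  rw [lieDerivForm_of_even hV hVs hθ, e1, e2, ← Finset.sum_add_distrib] at hL
  -- With Zᵇ the new coordinates, ∑ ∂ₗ(V Zᵇ) θ'_b is evaluated here through the invariance of θ'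
  -- under V'. The invariance of θ under V, in the form given by `e1`, `e2` and `e6`, evaluates it a
  -- second time; the difference is the claim.
  have e5 : ∑ b, partialD (Idx.x l) (act V (newCoord φ A b)) z * subst (A z) (θ' b (φ z))
      = -∑ b, partialD (Idx.x l) (newCoord φ A b) z *
        ∑ d, subst (A z) (V' d (φ z)) * subst (A z) (partialD d (θ' b) (φ z)) := by
    simp only [e3, Finset.sum_mul]
    rw [Finset.sum_comm, ← Finset.sum_neg_distrib]
    refine Finset.sum_congr rfl fun d _ => ?_
    rw [← mul_neg, ← e4, Finset.mul_sum]
    simp only [mul_assoc]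
  rw [← hL]
  have e6 : ∀ b, partialD (Idx.x l) (act V (newCoord φ A b)) z
      = ∑ c, partialD (Idx.x l) (V c) z * partialD c (newCoord φ A b) z
        + act V (partialD (Idx.x l) (newCoord φ A b)) z := fun b =>
    partialD_x_act hVs (hZ b) l
  simp only [e6, add_mul, Finset.sum_add_distrib] at e5
  simp only [sub_mul, Finset.sum_sub_distrib, mul_sub, Finset.sum_add_distrib]
  rw [sub_eq_add_neg, ← e5]
  abel

end Change

end Supercotangent
end

noncomputable section

namespace Supercotangent

open Filter Topology

/-! ### Partial derivatives on the model space -/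

section Pd

variable {n : ℕ} {f h : Model n → ℝ} {u : Model n}

theorem pd_congr (i : Fin n) (hfh : f =ᶠ[𝓝 u] h) : pd i f u = pd i h u := by
  simp only [pd, hfh.fderiv_eq]

theorem _root_.ContDiffAt.pd (i : Fin n) (hf : ContDiffAt ℝ ∞ f u) :
    ContDiffAt ℝ ∞ (Supercotangent.pd i f) u :=
  (hf.fderiv_right (m := ∞) (by simp)).clm_apply contDiffAt_const

theorem pd_add (i : Fin n) (hf : DifferentiableAt ℝ f u) (hh : DifferentiableAt ℝ h u) :
    pd i (fun v => f v + h v) u = pd i f u + pd i h u := by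
  simp [pd, fderiv_fun_add hf hh]

theorem pd_sub (i : Fin n) (hf : DifferentiableAt ℝ f u) (hh : DifferentiableAt ℝ h u) :
    pd i (fun v => f v - h v) u = pd i f u - pd i h u := by
  simp [pd, fderiv_fun_sub hf hh]

theorem pd_mul (i : Fin n) (hf : DifferentiableAt ℝ f u) (hh : DifferentiableAt ℝ h u) :
    pd i (fun v => f v * h v) u = pd i f u * h u + f u * pd i h u := by
  simp [pd, fderiv_fun_mul hf hh]
  ring

theorem pd_sum {ι : Type*} (s : Finset ι) (i : Fin n) {f : ι → Model n → ℝ}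
    (hf : ∀ j ∈ s, DifferentiableAt ℝ (f j) u) :
    pd i (fun v => ∑ j ∈ s, f j v) u = ∑ j ∈ s, pd i (f j) u := by
  simp [pd, fderiv_fun_sum hf]

theorem fderiv_eq_sum_pd (v : Model n) : fderiv ℝ f u v = ∑ k, v k * pd k f u := by
  have hv : v = ∑ k, v k • EuclideanSpace.single k (1 : ℝ) := by
    ext j
    simp [Finset.sum_apply, Pi.single_apply]
  conv_lhs => rw [hv]
  simp only [map_sum, map_smul, pd, smul_eq_mul]

theorem pd_comm (i j : Fin n) (hf : ContDiffAt ℝ ∞ f u) :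
    pd i (pd j f) u = pd j (pd i f) u := by
  have hd : DifferentiableAt ℝ (fderiv ℝ f) u :=
    (hf.fderiv_right (m := ∞) (by simp)).differentiableAt_of_infty
  have hsymm : IsSymmSndFDerivAt ℝ f u := (contDiffAt_infty.1 hf 2).isSymmSndFDerivAt (by simp)
  change fderiv ℝ (fun v => fderiv ℝ f v _) u _ = fderiv ℝ (fun v => fderiv ℝ f v _) u _
  rw [fderiv_clm_apply hd (differentiableAt_const _),
    fderiv_clm_apply hd (differentiableAt_const _)]
  simpa using hsymm.eq _ _

theorem pd_comp {φ : Model n → Model n} (hf : DifferentiableAt ℝ f (φ u))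
    (hφ : DifferentiableAt ℝ φ u) (i : Fin n) :
    pd i (fun v => f (φ v)) u = ∑ k, pd i (fun v => φ v k) u * pd k f (φ u) := by
  have h1 : HasFDerivAt (fun v => f (φ v)) ((fderiv ℝ f (φ u)).comp (fderiv ℝ φ u)) u :=
    hf.hasFDerivAt.comp u hφ.hasFDerivAt
  have h2 : ∀ k, pd i (fun v => φ v k) u = fderiv ℝ φ u (EuclideanSpace.single i 1) k := by
    intro k
    have h3 : HasFDerivAt (fun v => φ v k)
        ((EuclideanSpace.proj (𝕜 := ℝ) k).comp (fderiv ℝ φ u)) u :=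
      (EuclideanSpace.proj (𝕜 := ℝ) k).hasFDerivAt.comp u hφ.hasFDerivAt
    simp only [pd, h3.fderiv]
    rfl
  simp only [h2, ← fderiv_eq_sum_pd]
  simp only [pd, h1.fderiv, ContinuousLinearMap.comp_apply]

end Pd

section Geometry

variable {n : ℕ} {M : Type*} [TopologicalSpace M] [ChartedSpace (Model n) M]

/-! ### Changes of charts -/

/-- The points of the image of the chart `e` which are covered by `e'`. -/
def overlap (e e' : Chart n M) : Set (Model n) := e.1.target ∩ e.1.symm ⁻¹' e'.1.source

/-- The change of charts `x ↦ x'`. -/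
def chartChange (e e' : Chart n M) (u : Model n) : Model n := e'.1 (e.1.symm u)

theorem isOpen_overlap (e e' : Chart n M) : IsOpen (overlap e e') :=
  (e.1.symm.trans e'.1).open_source

variable {e e' : Chart n M} {u : Model n}

theorem chartChange_mem (hu : u ∈ overlap e e') : chartChange e e' u ∈ overlap e' e := by
  refine ⟨e'.1.map_source hu.2, ?_⟩
  simp only [Set.mem_preimage, chartChange]
  rw [e'.1.left_inv hu.2]
  exact e.1.map_target hu.1

theorem symm_chartChange (hu : u ∈ overlap e e') :
    e'.1.symm (chartChange e e' u) = e.1.symm u := e'.1.left_inv hu.2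

theorem chartChange_chartChange (hu : u ∈ overlap e e') :
    chartChange e' e (chartChange e e' u) = u := by
  rw [chartChange, symm_chartChange hu, e.1.right_inv hu.1]

section

variable (e)
/-- The derivative of the inverse of a chart. -/
def symmDeriv (u : Model n) : Model n →L[ℝ] Model n := mfderiv (𝓡 n) (𝓡 n) e.1.symm u

end

variable [IsManifold (𝓡 n) ∞ M]

theorem contDiffAt_chartChange (hu : u ∈ overlap e e') :
    ContDiffAt ℝ ∞ (chartChange e e') u := by
  have h1 : ContMDiffAt (𝓡 n) (𝓡 n) ∞ e.1.symm u :=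
    contMDiffAt_symm_of_mem_maximalAtlas e.2 hu.1
  have h2 : ContMDiffAt (𝓡 n) (𝓡 n) ∞ e'.1 (e.1.symm u) :=
    contMDiffAt_of_mem_maximalAtlas e'.2 hu.2
  exact contMDiffAt_iff_contDiffAt.1 (h2.comp u h1)

theorem contDiffAt_chartChange_coord (hu : u ∈ overlap e e') (i : Fin n) :
    ContDiffAt ℝ ∞ (fun v => chartChange e e' v i) u :=
  (EuclideanSpace.proj (𝕜 := ℝ) i).contDiff.contDiffAt.comp u (contDiffAt_chartChange hu)

theorem contDiffAt_jacobian (hu : u ∈ overlap e e') (i j : Fin n) :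
    ContDiffAt ℝ ∞ (fun v => jacobian e e' v i j) u :=
  (contDiffAt_chartChange_coord hu i).pd j

theorem jacobian_eq_fderiv (hu : u ∈ overlap e e') (i j : Fin n) : jacobian e e' u i j
    = fderiv ℝ (chartChange e e') u (EuclideanSpace.single j 1) i := by
  have h3 : HasFDerivAt (fun v => chartChange e e' v i)
      ((EuclideanSpace.proj (𝕜 := ℝ) i).comp (fderiv ℝ (chartChange e e') u)) u :=
    (EuclideanSpace.proj (𝕜 := ℝ) i).hasFDerivAt.comp u
      (contDiffAt_chartChange hu).differentiableAt_of_infty.hasFDerivAt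
  exact congrArg (fun L : Model n →L[ℝ] ℝ => L _) h3.fderiv

theorem pd_jacobian_comm (hu : u ∈ overlap e e') (i j k : Fin n) :
    pd k (fun v => jacobian e e' v i j) u = pd j (fun v => jacobian e e' v i k) u :=
  pd_comm k j (contDiffAt_chartChange_coord hu i)

theorem fderiv_chartChange_comp (hu : u ∈ overlap e e') :
    (fderiv ℝ (chartChange e' e) (chartChange e e' u)).comp (fderiv ℝ (chartChange e e') u)
      = ContinuousLinearMap.id ℝ (Model n) := by
  have h1 := ((contDiffAt_chartChange
    (chartChange_mem hu)).differentiableAt_of_infty.hasFDerivAt.comp u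
    (contDiffAt_chartChange hu).differentiableAt_of_infty.hasFDerivAt)
  have h2 : chartChange e' e ∘ chartChange e e' =ᶠ[𝓝 u] id :=
    ((isOpen_overlap e e').eventually_mem hu).mono fun v hv => chartChange_chartChange hv
  exact h1.unique ((hasFDerivAt_id u).congr_of_eventuallyEq h2)

theorem fderiv_apply_coord (hu : u ∈ overlap e e') (v : Model n) (i : Fin n) :
    fderiv ℝ (chartChange e e') u v i = ∑ j, jacobian e e' u i j * v j := by
  have hv : v = ∑ k, v k • EuclideanSpace.single k (1 : ℝ) := by
    ext j
    simp [Finset.sum_apply, Pi.single_apply]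
  conv_lhs => rw [hv]
  simp [map_sum, map_smul, jacobian_eq_fderiv hu, Finset.sum_apply, mul_comm]

theorem jacobian_mul_jacobian (hu : u ∈ overlap e e') :
    jacobian e' e (chartChange e e' u) * jacobian e e' u = 1 := by
  ext i j
  have h := congrArg (fun L : Model n →L[ℝ] Model n => L (EuclideanSpace.single j 1) i)
    (fderiv_chartChange_comp hu)
  simp only [ContinuousLinearMap.comp_apply, fderiv_apply_coord (chartChange_mem hu),
    ← jacobian_eq_fderiv hu] at h
  rw [Matrix.mul_apply, h]
  simp [Matrix.one_apply]

theorem jacobian_mul_jacobian' (hu : u ∈ overlap e e') :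
    jacobian e e' u * jacobian e' e (chartChange e e' u) = 1 :=
  mul_eq_one_comm.1 (jacobian_mul_jacobian hu)

theorem mdifferentiableAt_symm (hu : u ∈ e.1.target) :
    MDifferentiableAt (𝓡 n) (𝓡 n) e.1.symm u :=
  (contMDiffAt_symm_of_mem_maximalAtlas e.2 hu).mdifferentiableAt (by simp)

theorem symmDeriv_isInvertible (hu : u ∈ e.1.target) : (symmDeriv e u).IsInvertible := by
  have hdiff : e.1.symm.MDifferentiable (𝓡 n) (𝓡 n) :=
    ⟨(contMDiffOn_symm_of_mem_maximalAtlas e.2).mdifferentiableOn (by simp),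
      (contMDiffOn_of_mem_maximalAtlas e.2).mdifferentiableOn (by simp)⟩
  exact ⟨hdiff.mfderiv hu, rfl⟩

theorem symmDeriv_change (hu : u ∈ overlap e e') (v : Model n) : symmDeriv e u v
    = symmDeriv e' (chartChange e e' u) (fderiv ℝ (chartChange e e') u v) := by
  have h1 : HasMFDerivAt (𝓡 n) (𝓡 n) (chartChange e e') u (fderiv ℝ (chartChange e e') u) :=
    (contDiffAt_chartChange hu).differentiableAt_of_infty.hasFDerivAt.hasMFDerivAt
  have h2 := (mdifferentiableAt_symm (chartChange_mem hu).1).hasMFDerivAt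
  have h3 := h2.comp u h1
  have h4 : e.1.symm =ᶠ[𝓝 u] e'.1.symm ∘ chartChange e e' :=
    ((isOpen_overlap e e').eventually_mem hu).mono fun v hv => (symm_chartChange hv).symm
  have h5 := (h3.congr_of_eventuallyEq h4).mfderiv
  exact congrArg (fun L : Model n →L[ℝ] Model n => L v) h5

/-! ### Components of vector fields -/

theorem symmDeriv_vread (X : VField n M) (hu : u ∈ e.1.target) :
    symmDeriv e u (vread e X u) = X (e.1.symm u) :=
  (symmDeriv_isInvertible hu).self_apply_inverse _

/-- Both sides are sent to the value of X by the injective derivative of the inverse of `e'`. -/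
theorem vread_change (X : VField n M) (hu : u ∈ overlap e e') :
    vread e' X (chartChange e e' u) = fderiv ℝ (chartChange e e') u (vread e X u) := by
  have hinj : Function.Injective (symmDeriv e' (chartChange e e' u)) :=
    (symmDeriv_isInvertible (chartChange_mem hu).1).injective
  apply hinj
  rw [← symmDeriv_change hu, symmDeriv_vread X hu.1, symmDeriv_vread X (chartChange_mem hu).1,
    symm_chartChange hu]

theorem vcoord_change (X : VField n M) (hu : u ∈ overlap e e') (i : Fin n) :
    vcoord e' X i (chartChange e e' u) = ∑ j, jacobian e e' u i j * vcoord e X j u := by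
  rw [vcoord, vread_change X hu, fderiv_apply_coord hu]
  rfl

theorem contDiffAt_vread {X : VField n M} (hX : IsSmoothField X) (hu : u ∈ e.1.target) :
    ContDiffAt ℝ ∞ (vread e X) u := by
  have h1 := ContMDiffAt.mpullback_vectorField_preimage (m := ∞) (n := ∞)
    (hX (e.1.symm u)) (contMDiffAt_symm_of_mem_maximalAtlas e.2 hu)
    (symmDeriv_isInvertible hu) (by simp)
  exact contMDiffAt_vectorSpace_iff_contDiffAt.1 h1

theorem contDiffAt_vcoord {X : VField n M} (hX : IsSmoothField X) (hu : u ∈ e.1.target)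
    (i : Fin n) : ContDiffAt ℝ ∞ (vcoord e X i) u :=
  (EuclideanSpace.proj (𝕜 := ℝ) i).contDiff.contDiffAt.comp u (contDiffAt_vread hX hu)

theorem mdifferentiableAt_of_isSmoothField {X : VField n M} (hX : IsSmoothField X) (x : M) :
    MDifferentiableAt (𝓡 n) (𝓡 n).tangent (fun x => (⟨x, X x⟩ : TangentBundle (𝓡 n) M)) x :=
  (hX x).mdifferentiableAt (by simp)

theorem two_le_infty : minSmoothness ℝ 2 ≤ (∞ : WithTop ℕ∞) := by
  simp only [minSmoothness_of_isRCLikeNormedField]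
  exact WithTop.coe_le_coe.2 (le_top : (2 : ℕ∞) ≤ ⊤)

/-- Pullback by the inverse chart commutes with brackets, and on the model space the manifold
bracket is the usual one. -/
theorem vcoord_mlieBracket {X Y : VField n M} (hX : IsSmoothField X) (hY : IsSmoothField Y)
    (hu : u ∈ e.1.target) (i : Fin n) :
    vcoord e (VectorField.mlieBracket (𝓡 n) X Y) i u
      = ∑ k, (vcoord e X k u * pd k (vcoord e Y i) u
          - vcoord e Y k u * pd k (vcoord e X i) u) := by
  have : IsManifold (𝓡 n) (minSmoothness ℝ 2) M := IsManifold.of_le two_le_infty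
  have h1 : vread e (VectorField.mlieBracket (𝓡 n) X Y) u
      = VectorField.lieBracket ℝ (vread e X) (vread e Y) u := by
    refine (VectorField.mpullback_mlieBracket (n := ∞)
      (mdifferentiableAt_of_isSmoothField hX _) (mdifferentiableAt_of_isSmoothField hY _)
      (contMDiffAt_symm_of_mem_maximalAtlas e.2 hu) two_le_infty).trans ?_
    rw [← VectorField.mlieBracketWithin_univ,
      VectorField.mlieBracketWithin_eq_lieBracketWithin]
    exact congrFun (VectorField.lieBracketWithin_univ (V := vread e X) (W := vread e Y)) u
  have h2 : ∀ {Z : VField n M}, IsSmoothField Z → ∀ v : Model n,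
      fderiv ℝ (vread e Z) u v i = fderiv ℝ (vcoord e Z i) u v := by
    intro Z hZ v
    have h3 : HasFDerivAt (vcoord e Z i)
        ((EuclideanSpace.proj (𝕜 := ℝ) i).comp (fderiv ℝ (vread e Z) u)) u :=
      (EuclideanSpace.proj (𝕜 := ℝ) i).hasFDerivAt.comp u
        (contDiffAt_vread hZ hu).differentiableAt_of_infty.hasFDerivAt
    rw [h3.fderiv]
    rfl
  rw [vcoord, h1, VectorField.lieBracket, PiLp.sub_apply, h2 hX, h2 hY, fderiv_eq_sum_pd,
    fderiv_eq_sum_pd, ← Finset.sum_sub_distrib]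
  rfl

theorem isSmoothField_mlieBracket {X Y : VField n M} (hX : IsSmoothField X)
    (hY : IsSmoothField Y) : IsSmoothField (VectorField.mlieBracket (𝓡 n) X Y) := by
  have : IsManifold (𝓡 n) (minSmoothness ℝ 2) M := IsManifold.of_le two_le_infty
  have : IsManifold (𝓡 n) (((⊤ : ℕ∞) : WithTop ℕ∞) + 1) M := by simpa
  intro x
  exact ContMDiffAt.mlieBracket_vectorField (m := ⊤) (n := ⊤) (hX x) (hY x) (by simp)

/-- A function on `M` whose expressions in all charts are smooth is smooth. -/
theorem contMDiff_of_charts {f : M → ℝ}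
    (hf : ∀ e : Chart n M, ∀ u ∈ e.1.target, ContDiffAt ℝ ∞ (fun v => f (e.1.symm v)) u) :
    ContMDiff (𝓡 n) 𝓘(ℝ) ∞ f := by
  intro x
  let e : Chart n M := ⟨chartAt (Model n) x, IsManifold.chart_mem_maximalAtlas x⟩
  have hx : x ∈ e.1.source := mem_chart_source _ x
  have h1 : ContMDiffAt (𝓡 n) 𝓘(ℝ) ∞ (fun v => f (e.1.symm v)) (e.1 x) :=
    (hf e _ (e.1.map_source hx)).contMDiffAt
  have h2 : ContMDiffAt (𝓡 n) (𝓡 n) ∞ e.1 x := contMDiffAt_of_mem_maximalAtlas e.2 hx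
  refine (h1.comp x h2).congr_of_eventuallyEq ?_
  filter_upwards [e.1.open_source.mem_nhds hx] with y hy
  simp [e.1.left_inv hy]

theorem contDiffAt_chart {f : M → ℝ} (hf : ContMDiff (𝓡 n) 𝓘(ℝ) ∞ f) (hu : u ∈ e.1.target) :
    ContDiffAt ℝ ∞ (fun v => f (e.1.symm v)) u :=
  contMDiffAt_iff_contDiffAt.1
    ((hf (e.1.symm u)).comp u (contMDiffAt_symm_of_mem_maximalAtlas e.2 hu))

/-! ### Components of the metric -/

variable (g : PseudoRiemannianMetric n M)

/-- The metric as a bilinear form on the model space. -/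
def PseudoRiemannianMetric.form (x : M) : Model n →L[ℝ] Model n →L[ℝ] ℝ := g.val x

theorem gcoord_eq (i j : Fin n) : gcoord g e i j u = g.form (e.1.symm u)
    (symmDeriv e u (EuclideanSpace.single i 1)) (symmDeriv e u (EuclideanSpace.single j 1)) := rfl

theorem gcoord_symm (i j : Fin n) : gcoord g e i j u = gcoord g e j i u := g.symm _ _ _

theorem form_symmDeriv (v w : Model n) :
    g.form (e.1.symm u) (symmDeriv e u v) (symmDeriv e u w)
      = ∑ i, ∑ j, v i * w j * gcoord g e i j u := by
  have hv : ∀ v : Model n, v = ∑ k, v k • EuclideanSpace.single k (1 : ℝ) := by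
    intro v
    ext j
    simp [Finset.sum_apply, Pi.single_apply]
  conv_lhs => rw [hv v, hv w]
  simp only [map_sum, map_smul, sum_apply, smul_apply, gcoord_eq,
    smul_eq_mul, Finset.mul_sum, mul_assoc]
  rw [Finset.sum_comm]
  exact Finset.sum_congr rfl fun i _ => Finset.sum_congr rfl fun j _ => by ring

theorem gcoord_change (hu : u ∈ overlap e e') (k l : Fin n) : gcoord g e k l u
    = ∑ a, ∑ b, jacobian e e' u a k * jacobian e e' u b l
        * gcoord g e' a b (chartChange e e' u) := by
  rw [gcoord_eq, symmDeriv_change hu, symmDeriv_change hu, ← symm_chartChange hu, form_symmDeriv]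
  simp only [jacobian_eq_fderiv hu]

/-- A vector killed by the Gram matrix represents a tangent vector orthogonal to all others, since
the derivative of the inverse chart is bijective. -/
theorem gcoord_mulVec_injective (hu : u ∈ e.1.target) (v : Fin n → ℝ)
    (hv : ∀ i, ∑ j, gcoord g e i j u * v j = 0) : v = 0 := by
  have h0 : symmDeriv e u (WithLp.toLp 2 v) = 0 := by
    refine g.nondegenerate (e.1.symm u) _ fun w => ?_
    obtain ⟨w', hw⟩ := (symmDeriv_isInvertible hu).surjective w
    have h1 := form_symmDeriv (u := u) (e := e) g (WithLp.toLp 2 v) w'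
    rw [hw] at h1
    refine h1.trans ?_
    rw [Finset.sum_comm]
    refine Finset.sum_eq_zero fun j _ => ?_
    have h2 : ∑ i, v i * w' j * gcoord g e i j u
        = w' j * ∑ i, gcoord g e j i u * v i := by
      rw [Finset.mul_sum]
      exact Finset.sum_congr rfl fun i _ => by rw [gcoord_symm]; ring
    exact h2.trans (by rw [hv, mul_zero])
  have h1 : (WithLp.toLp 2 v : Model n) = 0 :=
    (symmDeriv_isInvertible hu).injective (h0.trans (map_zero _).symm)
  simpa using congrArg WithLp.ofLp h1

theorem sum_gcoord_ginv (hu : u ∈ e.1.target) (i j : Fin n) :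
    ∑ k, gcoord g e i k u * ginv g e k j u = if i = j then 1 else 0 := by
  set G : Matrix (Fin n) (Fin n) ℝ := Matrix.of fun a b => gcoord g e a b u with hG
  have hdet : IsUnit G.det := by
    rw [isUnit_iff_ne_zero]
    intro h
    obtain ⟨v, hv, hv0⟩ := Matrix.exists_mulVec_eq_zero_iff.2 h
    exact hv (gcoord_mulVec_injective g hu v fun i => congrFun hv0 i)
  have h := congrFun (congrFun (Matrix.mul_nonsing_inv G hdet) i) j
  rw [Matrix.mul_apply, Matrix.one_apply] at h
  exact h

theorem contDiffAt_gcoord (hu : u ∈ e.1.target) (i j : Fin n) :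
    ContDiffAt ℝ ∞ (gcoord g e i j) u := by
  have hsymm : ContMDiffOn (𝓡 n) (𝓡 n) ∞ e.1.symm e.1.target :=
    contMDiffOn_symm_of_mem_maximalAtlas e.2
  -- The coordinate field ∂ᵢ is the tangent map of the inverse chart applied to a constant field,
  -- hence smooth.
  have hframe : ∀ i, ContMDiffAt (𝓡 n) (𝓡 n).tangent ∞
      (fun v => (⟨e.1.symm v, frame e i v⟩ : TangentBundle (𝓡 n) M)) u := by
    intro i
    have h1 := hsymm.contMDiffOn_tangentMapWithin (m := ∞) (by simp)
      e.1.open_target.uniqueMDiffOn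
    have h2 : ContMDiffAt (𝓡 n) (𝓡 n).tangent ∞ (fun v : Model n =>
        (⟨v, (EuclideanSpace.single i 1 : Model n)⟩ : TangentBundle (𝓡 n) (Model n))) u :=
      contMDiffAt_vectorSpace_iff_contDiffAt.2 contDiffAt_const
    have h3 := (h1 ⟨u, (EuclideanSpace.single i 1 : Model n)⟩ hu).contMDiffAt
      ((e.1.open_target.preimage
        (FiberBundle.continuous_proj (Model n) (TangentSpace (𝓡 n)))).mem_nhds hu)
    refine (h3.comp u h2).congr_of_eventuallyEq ?_
    filter_upwards [e.1.open_target.mem_nhds hu] with v hv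
    simp only [Function.comp, tangentMapWithin, frame]
    rw [mfderivWithin_of_isOpen e.1.open_target hv]
  have hmet := g.contMDiff.contMDiffAt.comp u
    (contMDiffAt_symm_of_mem_maximalAtlas (n := ∞) e.2 hu)
  have h : ContMDiffAt (𝓡 n) ((𝓡 n).prod 𝓘(ℝ)) ∞
      (fun v ↦ Bundle.TotalSpace.mk' ℝ (E := Bundle.Trivial M ℝ) (e.1.symm v)
        (g.val (e.1.symm v) (frame e i v) (frame e j v))) u :=
    ContMDiffAt.clm_bundle_apply₂ (F₁ := Model n) (F₂ := Model n) hmet (hframe i) (hframe j)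
  simp only [Bundle.contMDiffAt_totalSpace] at h
  exact contMDiffAt_iff_contDiffAt.1 h.2

end Geometry

end Supercotangent
end

noncomputable section

namespace Supercotangent

open Filter Topology

/-! ### The Lie bracket of conformal vector fields -/

section ConformalBracket

variable {n : ℕ}

/-- Serves both for tensor identities whose summands cancel in pairs and for symmetric coefficients
contracted with ξⁱξᵏ. Real scalars permit the division by 2. -/
theorem sum_sum_eq_zero_of_antisymm {β : Type*} [AddCommGroup β] [Module ℝ β]
    (f : Fin n → Fin n → β) (h : ∀ i k, f i k + f k i = 0) : ∑ i, ∑ k, f i k = 0 := by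
  have h1 : ∑ i, ∑ k, f i k + ∑ i, ∑ k, f i k = 0 := by
    conv_lhs => enter [2]; rw [Finset.sum_comm]
    simp only [← Finset.sum_add_distrib, h, Finset.sum_const_zero]
  rw [← two_smul ℝ] at h1
  simpa using h1

/-- The components of the Lie derivative of a symmetric tensor. -/
def lieDerivTensor (X : Fin n → Model n → ℝ) (G : Fin n → Fin n → Model n → ℝ)
    (i j : Fin n) (u : Model n) : ℝ :=
  ∑ k, (X k u * pd k (G i j) u + G k j u * pd i (X k) u + G i k u * pd j (X k) u)

/-- The components of the Lie bracket. -/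
def bracketCoord (X Y : Fin n → Model n → ℝ) (k : Fin n) (u : Model n) : ℝ :=
  ∑ m, (X m u * pd m (Y k) u - Y m u * pd m (X k) u)

variable {X Y : Fin n → Model n → ℝ} {G : Fin n → Fin n → Model n → ℝ} {u : Model n}

theorem pd_lieDerivTensor (hY : ∀ k, ContDiffAt ℝ ∞ (Y k) u)
    (hG : ∀ i j, ContDiffAt ℝ ∞ (G i j) u) (m i j : Fin n) :
    pd m (lieDerivTensor Y G i j) u = ∑ k,
      (pd m (Y k) u * pd k (G i j) u + Y k u * pd m (pd k (G i j)) u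
        + (pd m (G k j) u * pd i (Y k) u + G k j u * pd m (pd i (Y k)) u)
        + (pd m (G i k) u * pd j (Y k) u + G i k u * pd m (pd j (Y k)) u)) := by
  have dY := fun k => (hY k).differentiableAt_of_infty
  have dG := fun i j => (hG i j).differentiableAt_of_infty
  have dY' := fun i k => ((hY k).pd i).differentiableAt_of_infty
  have dG' := fun k i j => ((hG i j).pd k).differentiableAt_of_infty
  have h1 := fun k => (dY k).mul (dG' k i j)
  have h2 := fun k => (dG k j).mul (dY' i k)
  have h3 := fun k => (dG i k).mul (dY' j k)
  refine (pd_sum _ m fun k _ => ((h1 k).add (h2 k)).add (h3 k)).trans ?_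
  refine Finset.sum_congr rfl fun k _ => ?_
  refine (pd_add m ((h1 k).add (h2 k)) (h3 k)).trans ?_
  refine (congrArg₂ _ (pd_add m (h1 k) (h2 k)) rfl).trans ?_
  exact congrArg₂ _ (congrArg₂ _ (pd_mul m (dY k) (dG' k i j)) (pd_mul m (dG k j) (dY' i k)))
    (pd_mul m (dG i k) (dY' j k))

theorem pd_bracketCoord (hX : ∀ k, ContDiffAt ℝ ∞ (X k) u)
    (hY : ∀ k, ContDiffAt ℝ ∞ (Y k) u) (i k : Fin n) :
    pd i (bracketCoord X Y k) u = ∑ m,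
      ((pd i (X m) u * pd m (Y k) u + X m u * pd m (pd i (Y k)) u)
        - (pd i (Y m) u * pd m (X k) u + Y m u * pd m (pd i (X k)) u)) := by
  have dX := fun k => (hX k).differentiableAt_of_infty
  have dY := fun k => (hY k).differentiableAt_of_infty
  have dX' := fun i k => ((hX k).pd i).differentiableAt_of_infty
  have dY' := fun i k => ((hY k).pd i).differentiableAt_of_infty
  have h1 := fun m => (dX m).mul (dY' m k)
  have h2 := fun m => (dY m).mul (dX' m k)
  refine (pd_sum _ i fun m _ => (h1 m).sub (h2 m)).trans ?_
  refine Finset.sum_congr rfl fun m _ => ?_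
  refine (pd_sub i (h1 m) (h2 m)).trans ?_
  rw [pd_comm m i (hY k), pd_comm m i (hX k)]
  exact congrArg₂ _ (pd_mul i (dX m) (dY' m k)) (pd_mul i (dY m) (dX' m k))

/-- `L_{[X, Y]} = [L_X, L_Y]` on symmetric tensors. -/
theorem lieDerivTensor_bracketCoord (hX : ∀ k, ContDiffAt ℝ ∞ (X k) u)
    (hY : ∀ k, ContDiffAt ℝ ∞ (Y k) u) (hG : ∀ i j, ContDiffAt ℝ ∞ (G i j) u)
    (hsymm : ∀ i j, G i j u = G j i u) (i j : Fin n) :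
    lieDerivTensor (bracketCoord X Y) G i j u
      = lieDerivTensor X (lieDerivTensor Y G) i j u
        - lieDerivTensor Y (lieDerivTensor X G) i j u := by
  rw [← sub_eq_zero]
  have h1 : ∀ X Y : Fin n → Model n → ℝ, lieDerivTensor X (lieDerivTensor Y G) i j u
      = ∑ k, (X k u * pd k (lieDerivTensor Y G i j) u
        + lieDerivTensor Y G k j u * pd i (X k) u
        + lieDerivTensor Y G i k u * pd j (X k) u) := fun _ _ => rfl
  simp only [h1, pd_lieDerivTensor hY hG, pd_lieDerivTensor hX hG]
  simp only [lieDerivTensor, pd_bracketCoord hX hY, bracketCoord, Finset.mul_sum,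
    Finset.sum_mul, ← Finset.sum_add_distrib, ← Finset.sum_sub_distrib]
  -- The summands need not vanish individually: each cancels against the one with m and k exchanged,
  -- once the mixed second derivatives of Gᵢⱼ are identified.
  refine sum_sum_eq_zero_of_antisymm _ fun m k => ?_
  rw [pd_comm k m (hG i j), hsymm m k]
  ring

/-- If `L_X G = a G` and `L_Y G = b G` then `L_{[X, Y]} G = (X b - Y a) G`. -/
theorem lieDerivTensor_bracketCoord_of_conformal (hX : ∀ k, ContDiffAt ℝ ∞ (X k) u)
    (hY : ∀ k, ContDiffAt ℝ ∞ (Y k) u) (hG : ∀ i j, ContDiffAt ℝ ∞ (G i j) u)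
    (hsymm : ∀ i j, G i j u = G j i u) {a b : Model n → ℝ} (ha : ContDiffAt ℝ ∞ a u)
    (hb : ContDiffAt ℝ ∞ b u)
    (hXG : ∀ i j, lieDerivTensor X G i j =ᶠ[𝓝 u] fun v => a v * G i j v)
    (hYG : ∀ i j, lieDerivTensor Y G i j =ᶠ[𝓝 u] fun v => b v * G i j v) (i j : Fin n) :
    lieDerivTensor (bracketCoord X Y) G i j u
      = (∑ k, (X k u * pd k b u - Y k u * pd k a u)) * G i j u := by
  -- L_X(bG) = (X b) G + ab G, and ab is symmetric in the two fields, so it drops out of the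
  -- commutator.
  have key : ∀ (X Y : Fin n → Model n → ℝ) (a b : Model n → ℝ), ContDiffAt ℝ ∞ b u →
      (∀ i j, lieDerivTensor X G i j =ᶠ[𝓝 u] fun v => a v * G i j v) →
      (∀ i j, lieDerivTensor Y G i j =ᶠ[𝓝 u] fun v => b v * G i j v) →
      lieDerivTensor X (lieDerivTensor Y G) i j u
        = (∑ k, X k u * pd k b u) * G i j u + b u * a u * G i j u := by
    intro X Y a b hb hXG hYG
    have h1 : ∀ k, pd k (lieDerivTensor Y G i j) u
        = pd k b u * G i j u + b u * pd k (G i j) u := fun k =>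
      (pd_congr k (hYG i j)).trans (pd_mul k hb.differentiableAt_of_infty
        (hG i j).differentiableAt_of_infty)
    have h2 := (hXG i j).eq_of_nhds
    simp only [lieDerivTensor] at h2
    rw [mul_assoc, ← h2, lieDerivTensor, Finset.sum_mul, Finset.mul_sum,
      ← Finset.sum_add_distrib]
    refine Finset.sum_congr rfl fun k _ => ?_
    rw [h1, (hYG k j).eq_of_nhds, (hYG i k).eq_of_nhds]
    ring
  rw [lieDerivTensor_bracketCoord hX hY hG hsymm, key X Y a b hb hXG hYG,
    key Y X b a ha hYG hXG, Finset.sum_sub_distrib]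
  ring

end ConformalBracket

section

variable {n : ℕ} {M : Type*} [TopologicalSpace M] [ChartedSpace (Model n) M]
  [IsManifold (𝓡 n) ∞ M] (g : PseudoRiemannianMetric n M)

/-- The differential of a function on `M`, as a linear form on the model space. -/
def dfun (c : M → ℝ) (x : M) : Model n →L[ℝ] ℝ := mfderiv (𝓡 n) 𝓘(ℝ) c x

theorem dfun_apply {c : M → ℝ} (hc : ContMDiff (𝓡 n) 𝓘(ℝ) ∞ c) (Z : VField n M)
    {e : Chart n M} {u : Model n} (hu : u ∈ e.1.target) :
    dfun c (e.1.symm u) (Z (e.1.symm u))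
      = ∑ k, vcoord e Z k u * pd k (fun v => c (e.1.symm v)) u := by
  have h1 : HasFDerivAt (fun v => c (e.1.symm v)) ((dfun c (e.1.symm u)).comp (symmDeriv e u)) u :=
    hasMFDerivAt_iff_hasFDerivAt.1
      (((hc (e.1.symm u)).mdifferentiableAt (by simp)).hasMFDerivAt.comp u
        (mdifferentiableAt_symm hu).hasMFDerivAt)
  refine Eq.trans ?_ (fderiv_eq_sum_pd (vread e Z u))
  rw [h1.fderiv, ContinuousLinearMap.comp_apply, symmDeriv_vread Z hu]

theorem mlieBracket_mem_conf {X Y : VField n M} (hX : X ∈ conf g) (hY : Y ∈ conf g) :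
    VectorField.mlieBracket (𝓡 n) X Y ∈ conf g := by
  obtain ⟨hX, a, ha, hXa⟩ := hX
  obtain ⟨hY, b, hb, hYb⟩ := hY
  -- With L_X g = a g and L_Y g = b g, the factor of the bracket is X b − Y a; writing it with
  -- `dfun` makes it a function on M independent of charts.
  refine ⟨isSmoothField_mlieBracket hX hY, fun x => dfun b x (X x) - dfun a x (Y x), contMDiff_of_charts fun e u hu => ?_, fun e u hu i j => ?_⟩
  · have h1 : ContDiffAt ℝ ∞ (fun u => ∑ k, vcoord e X k u * pd k (fun v => b (e.1.symm v)) u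
        - ∑ k, vcoord e Y k u * pd k (fun v => a (e.1.symm v)) u) u :=
      (ContDiffAt.sum fun k _ => (contDiffAt_vcoord hX hu k).mul
        ((contDiffAt_chart hb hu).pd k)).sub
      (ContDiffAt.sum fun k _ => (contDiffAt_vcoord hY hu k).mul
        ((contDiffAt_chart ha hu).pd k))
    refine h1.congr_of_eventuallyEq ?_
    filter_upwards [e.1.open_target.mem_nhds hu] with v hv
    exact congrArg₂ _ (dfun_apply hb X hv) (dfun_apply ha Y hv)
  · have hev : ∀ {P : Model n → Prop}, (∀ v ∈ e.1.target, P v) → ∀ᶠ v in 𝓝 u, P v :=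
      fun h => (e.1.open_target.eventually_mem hu).mono h
    have h1 := lieDerivTensor_bracketCoord_of_conformal
      (X := fun k => vcoord e X k) (Y := fun k => vcoord e Y k)
      (G := fun i j => gcoord g e i j) (fun k => contDiffAt_vcoord hX hu k)
      (fun k => contDiffAt_vcoord hY hu k) (fun i j => contDiffAt_gcoord g hu i j)
      (fun i j => gcoord_symm g i j) (contDiffAt_chart ha hu) (contDiffAt_chart hb hu)
      (fun i j => hev fun v hv => hXa e v hv i j) (fun i j => hev fun v hv => hYb e v hv i j) i j
    refine Eq.trans ?_ (h1.trans ?_)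
    · refine Finset.sum_congr rfl fun k _ => ?_
      have hb' : vcoord e (VectorField.mlieBracket (𝓡 n) X Y) k =ᶠ[𝓝 u]
          bracketCoord (fun k => vcoord e X k) (fun k => vcoord e Y k) k :=
        hev fun v hv => vcoord_mlieBracket hX hY hv k
      rw [pd_congr i hb', pd_congr j hb', hb'.eq_of_nhds]
    · congr 1
      rw [Finset.sum_sub_distrib]
      exact congrArg₂ _ (dfun_apply hb X hu).symm (dfun_apply ha Y hu).symm

end

end Supercotangent
end

/-! ### Parity and smoothness of Lie derivatives; α, β and the comoment formula in one chart. -/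

noncomputable section

namespace Supercotangent

open Filter Topology Grassmann

variable {n : ℕ} {M : Type*} [TopologicalSpace M] [ChartedSpace (Model n) M]

theorem isOpen_domain (e : Chart n M) : IsOpen (domain e) :=
  e.1.open_target.preimage continuous_fst

theorem eventually_mem_domain {e : Chart n M} {z : Body n} (hz : z ∈ domain e) :
    ∀ᶠ w in 𝓝 z, w ∈ domain e := (isOpen_domain e).eventually_mem hz

theorem parity_partialD {F : LocalFun n} {z : Body n} (a : Idx n) (hF : DifferentiableAt ℝ F z) :
    parity (partialD a F z)
      = (-1 : Grassmann n) ^ a.par * partialD a (fun w => parity (F w)) z := by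
  cases a with
  | xi i => simp [partialD, Idx.par, dxi_parity]
  | _ i =>
    simp only [Idx.par, pow_zero, one_mul]
    exact (fderiv_linG parity.toLinearMap hF _).symm

theorem parity_partialD_of_eventuallyEq {F : LocalFun n} {z : Body n} (a b : Idx n)
    (hF : DifferentiableAt ℝ F z)
    (hp : ∀ᶠ w in 𝓝 z, parity (F w) = (-1 : Grassmann n) ^ b.par * F w) :
    parity (partialD a F z) = (-1 : Grassmann n) ^ (a.par + b.par) * partialD a F z := by
  rw [parity_partialD a hF]
  cases b with
  | xi i =>
    simp only [Idx.par, pow_one, neg_mul, one_mul] at hp ⊢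
    rw [partialD_congr a hp, partialD_neg, pow_succ]
    simp
  | _ i =>
    simp only [Idx.par, pow_zero, one_mul] at hp ⊢
    rw [partialD_congr a hp, add_zero]

/-- The Lie derivative of an even form along an even vector field is even. -/
theorem parity_lieDerivForm_x {V : LocalVF n} {θ : LocalForm n} {z : Body n}
    (hV : ∀ᶠ w in 𝓝 z, EvenAt V w) (hθ : ∀ᶠ w in 𝓝 z, EvenAt θ w)
    (hVs : SmoothAt V z) (hθs : SmoothAt θ z) (l : Fin n) :
    parity (lieDerivForm V θ (Idx.x l) z) = lieDerivForm V θ (Idx.x l) z := by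
  rw [lieDerivForm_of_even hV.self_of_nhds hVs hθs, map_add, act, map_sum, map_sum]
  congr 1
  · refine Finset.sum_congr rfl fun c _ => ?_
    rw [map_mul, parity_partialD_of_eventuallyEq _ c (hVs.diff c) (hV.mono fun w hw => hw c),
      hθ.self_of_nhds c]
    cases c <;> simp [Idx.par]
  · refine Finset.sum_congr rfl fun c _ => ?_
    rw [map_mul, parity_partialD_of_eventuallyEq c (Idx.x l) (hθs.diff _)
      (hθ.mono fun w hw => hw _), hV.self_of_nhds c]
    cases c <;> simp [Idx.par]

theorem contDiffAt_lieDerivForm {V : LocalVF n} {θ : LocalForm n} {z : Body n}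
    (hV : ∀ᶠ w in 𝓝 z, EvenAt V w) (hVs : ∀ᶠ w in 𝓝 z, SmoothAt V w)
    (hθs : ∀ᶠ w in 𝓝 z, SmoothAt θ w) (b : Idx n) :
    ContDiffAt ℝ ∞ (lieDerivForm V θ b) z := by
  have h : ContDiffAt ℝ ∞ (fun w => ∑ c, partialD b (V c) w * θ c w + act V (θ b) w) z :=
    (ContDiffAt.sum fun c _ => ((hVs.self_of_nhds c).partialD b).gmul
      (hθs.self_of_nhds c)).add (ContDiffAt.act hVs.self_of_nhds (hθs.self_of_nhds b))
  refine h.congr_of_eventuallyEq ?_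
  filter_upwards [hV, hVs, hθs] with w h1 h2 h3
  exact lieDerivForm_of_even h1 h2 h3 b

variable [IsManifold (𝓡 n) ∞ M] (hbar : ℝ) (g : PseudoRiemannianMetric n M)
  {e : Chart n M} {z : Body n}

/-! ### The forms `α` and `β` -/

/-- The components `βₗ = gᵢₗ ξⁱ` of `β`. -/
def betaX (e : Chart n M) (l : Fin n) : LocalFun n :=
  fun z => ∑ i, gcoord g e i l z.1 • (xi i : Grassmann n)

theorem beta_x (l : Fin n) : beta g e (Idx.x l) = betaX g e l := by
  funext z
  simp only [beta, betaX, sc_mul]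

theorem contDiffAt_betaX (hz : z ∈ domain e) (l : Fin n) : ContDiffAt ℝ ∞ (betaX g e l) z :=
  ContDiffAt.sum fun i _ => contDiffAt_base (contDiffAt_gcoord g hz i l) _

theorem partialD_x_betaX (hz : z ∈ domain e) (k l : Fin n) :
    partialD (Idx.x k) (betaX g e l) z
      = ∑ i, pd k (gcoord g e i l) z.1 • (xi i : Grassmann n) := by
  have hd := fun i => (contDiffAt_gcoord g hz i l).differentiableAt_of_infty
  refine (partialD_sum _ _ fun i _ => differentiableAt_base (hd i) _).trans ?_
  exact Finset.sum_congr rfl fun i _ => partialD_x_base k (hd i) _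

theorem partialD_p_betaX (hz : z ∈ domain e) (k l : Fin n) :
    partialD (Idx.p k) (betaX g e l) z = 0 := by
  have hd := fun i => (contDiffAt_gcoord g hz i l).differentiableAt_of_infty
  refine (partialD_sum _ _ fun i _ => differentiableAt_base (hd i) _).trans ?_
  exact Finset.sum_eq_zero fun i _ => partialD_p_base k (hd i) _

theorem partialD_xi_betaX (k l : Fin n) :
    partialD (Idx.xi k) (betaX g e l) z = gcoord g e k l z.1 • (1 : Grassmann n) := by
  simp [partialD, betaX, dxi_xi]

@[simp] theorem parity_betaX (l : Fin n) : parity (betaX g e l z) = -betaX g e l z := by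
  simp [betaX, parity_real_smul]

theorem act_betaX (hz : z ∈ domain e) (V : LocalVF n) (j : Fin n) :
    act V (betaX g e j) z
      = ∑ k, V (Idx.x k) z * ∑ i, pd k (gcoord g e i j) z.1 • (xi i : Grassmann n)
        + ∑ k, gcoord g e k j z.1 • V (Idx.xi k) z := by
  rw [act, sum_idx]
  simp [partialD_x_betaX g hz, partialD_p_betaX g hz, partialD_xi_betaX]

/-- The constant `ħ / 2i`. -/
def planck (hbar : ℝ) : ℂ := (hbar : ℂ) / (2 * Complex.I)

/-- The functions `ξᵏ ∂ₖ βₗ`. -/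
def extBeta (e : Chart n M) (l : Fin n) : LocalFun n :=
  fun z => ∑ k, xi k * partialD (Idx.x k) (betaX g e l) z

theorem extBeta_eq (hz : z ∈ domain e) (l : Fin n) : extBeta g e l z
    = ∑ k, ∑ i, pd k (gcoord g e i l) z.1 • (xi k * xi i : Grassmann n) := by
  simp only [extBeta, partialD_x_betaX g hz, Finset.mul_sum, mul_smul_comm]

theorem contDiffAt_extBeta (hz : z ∈ domain e) (l : Fin n) :
    ContDiffAt ℝ ∞ (extBeta g e l) z :=
  ContDiffAt.sum fun _ _ => contDiffAt_const.gmul ((contDiffAt_betaX g hz l).partialD _)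

theorem parity_extBeta (hz : z ∈ domain e) (l : Fin n) :
    parity (extBeta g e l z) = extBeta g e l z := by
  simp [extBeta_eq g hz, parity_real_smul]

theorem partialD_p_extBeta (hz : z ∈ domain e) (m l : Fin n) :
    partialD (Idx.p m) (extBeta g e l) z = 0 := by
  have h : extBeta g e l =ᶠ[𝓝 z] fun z => ∑ k, ∑ i,
      pd k (gcoord g e i l) z.1 • (xi k * xi i : Grassmann n) :=
    (eventually_mem_domain hz).mono fun w hw => extBeta_eq g hw l
  have hd := fun k i => ((contDiffAt_gcoord g hz i l).pd k).differentiableAt_of_infty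
  have hs : ∀ k, DifferentiableAt ℝ (fun z : Body n => ∑ i,
      pd k (gcoord g e i l) z.1 • (xi k * xi i : Grassmann n)) z := fun k =>
    DifferentiableAt.fun_sum fun i _ => differentiableAt_base (hd k i) _
  rw [partialD_congr _ h, partialD_sum _ _ fun k _ => hs k]
  refine Finset.sum_eq_zero fun k _ => ?_
  rw [partialD_sum _ _ fun i _ => differentiableAt_base (hd k i) _]
  exact Finset.sum_eq_zero fun i _ => partialD_p_base m (hd k i) _

/-- Lowering the upper index of Γ cancels the inverse metric in its definition. -/
theorem sum_gcoord_christoffel (hz : z ∈ domain e) (i k l : Fin n) :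
    ∑ j, gcoord g e i j z.1 * christoffel g e j k l z.1
      = (1 / 2) * (pd k (gcoord g e l i) z.1 + pd l (gcoord g e k i) z.1
        - pd i (gcoord g e k l) z.1) := by
  simp only [christoffel, Finset.mul_sum]
  rw [Finset.sum_comm]
  have h : ∀ a, ∑ j, gcoord g e i j z.1 * (1 / 2 * (ginv g e j a z.1 *
      (pd k (gcoord g e l a) z.1 + pd l (gcoord g e k a) z.1 - pd a (gcoord g e k l) z.1)))
      = (if i = a then 1 else 0) * (1 / 2 * (pd k (gcoord g e l a) z.1
        + pd l (gcoord g e k a) z.1 - pd a (gcoord g e k l) z.1)) := fun a => by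
    rw [← sum_gcoord_ginv g hz i a, Finset.sum_mul]
    exact Finset.sum_congr rfl fun j _ => by ring
  simp only [h, ite_mul, one_mul, zero_mul, Finset.sum_ite_eq, Finset.mem_univ, if_true]

theorem gcoord_symm_fun (i j : Fin n) : gcoord g e i j = gcoord g e j i :=
  funext fun _ => gcoord_symm g i j

/-- The Christoffel symbols enter `α` only through `ξᵏ ∂ₖ βₗ`. -/
theorem alpha_x (hz : z ∈ domain e) (l : Fin n) :
    alpha hbar g e (Idx.x l) z = sc (z.2 l) - planck hbar • extBeta g e l z := by
  simp only [alpha, extBeta_eq g hz, sub_eq_add_neg, ← smul_neg, planck]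
  congr 2
  have h1 : ∀ i, ∑ j, ∑ k, sc (gcoord g e i j z.1 * christoffel g e j k l z.1) *
      (xi i * xi k : Grassmann n) = ∑ k, ((1 / 2) * (pd k (gcoord g e l i) z.1
        + pd l (gcoord g e k i) z.1 - pd i (gcoord g e k l) z.1)) • (xi i * xi k) := by
    intro i
    rw [Finset.sum_comm]
    refine Finset.sum_congr rfl fun k _ => ?_
    simp only [sc_mul, ← Finset.sum_smul, sum_gcoord_christoffel g hz]
  simp only [h1]
  rw [← sub_eq_zero, sub_neg_eq_add, Finset.sum_comm, ← Finset.sum_add_distrib]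
  simp only [← Finset.sum_add_distrib]
  -- Against ξⁱξᵏ the part ∂ₗgₖᵢ of the lowered symbol, symmetric in i and k, vanishes, and the
  -- other two parts become equal, absorbing the factor 1/2.
  refine sum_sum_eq_zero_of_antisymm _ fun k i => ?_
  rw [xi_mul_xi i k, gcoord_symm_fun g l i, gcoord_symm_fun g l k, gcoord_symm_fun g k i]
  module

theorem alpha_p (l : Fin n) : alpha hbar g e (Idx.p l) = fun _ => 0 := rfl

theorem alpha_xi (j : Fin n) :
    alpha hbar g e (Idx.xi j) = fun z => -(planck hbar • betaX g e j z) := by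
  funext z
  simp only [alpha, betaX, sc_mul, planck]

theorem alpha_x_eventuallyEq (hz : z ∈ domain e) (l : Fin n) :
    alpha hbar g e (Idx.x l) =ᶠ[𝓝 z] fun z => sc (z.2 l) - planck hbar • extBeta g e l z :=
  (eventually_mem_domain hz).mono fun _ hw => alpha_x hbar g hw l

theorem smoothAt_alpha (hz : z ∈ domain e) : SmoothAt (alpha hbar g e) z := by
  intro a
  cases a with
  | x l =>
    exact ((contDiffAt_sc_p l).sub ((contDiffAt_extBeta g hz l).const_smul
      (planck hbar))).congr_of_eventuallyEq (alpha_x_eventuallyEq hbar g hz l)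
  | p l => exact contDiffAt_const (c := (0 : Grassmann n))
  | xi l =>
    rw [alpha_xi]
    exact ((contDiffAt_betaX g hz l).const_smul (planck hbar)).neg

theorem evenAt_alpha (hz : z ∈ domain e) : EvenAt (alpha hbar g e) z := by
  intro a
  cases a with
  | x l => simp [alpha_x hbar g hz, parity_extBeta g hz, Idx.par]
  | p l => simp [alpha_p]
  | xi l => simp [alpha_xi, Idx.par]

theorem smoothAt_beta (hz : z ∈ domain e) : SmoothAt (beta g e) z := by
  intro a
  cases a with
  | x l =>
    rw [beta_x]
    exact contDiffAt_betaX g hz l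
  | _ l => exact contDiffAt_const (c := (0 : Grassmann n))

/-- The variable p enters α only through pₗ dxˡ. Hence the p-components of V occur in L_V α and in
⟨V, dα⟩ with coefficient one and can be solved for. -/
theorem partialD_p_alpha (hz : z ∈ domain e) (m : Fin n) (b : Idx n) :
    partialD (Idx.p m) (alpha hbar g e b) z
      = match b with
        | Idx.x l => if m = l then 1 else 0
        | _ => 0 := by
  cases b with
  | x l =>
    have h1 := (contDiffAt_extBeta g hz l).const_smul (planck hbar)
    have h2 : ContDiffAt ℝ ∞ (fun w => -(planck hbar • extBeta g e l w)) z := h1.neg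
    rw [partialD_congr _ (alpha_x_eventuallyEq hbar g hz l)]
    simp only [sub_eq_add_neg]
    rw [partialD_add _ (contDiffAt_sc_p l).differentiableAt_of_infty
      h2.differentiableAt_of_infty, partialD_neg,
      partialD_const_smul _ _ (contDiffAt_extBeta g hz l).differentiableAt_of_infty,
      partialD_p_extBeta g hz, partialD_sc_p]
    simp
  | p l => simp [alpha_p, partialD]
  | xi l =>
    rw [alpha_xi, partialD_neg,
      partialD_const_smul _ _ (contDiffAt_betaX g hz l).differentiableAt_of_infty,
      partialD_p_betaX g hz]
    simp

/-! ### The local expression of the lift -/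

/-- `V` has the components at `z` of a lift of `X` multiplying `β` by the factor `f`. -/
structure IsLiftAt (e : Chart n M) (X : VField n M) (f : ℝ) (V : LocalVF n) (z : Body n) :
    Prop where
  coeff_x : ∀ i, V (Idx.x i) z = vcoord e X i z.1 • (1 : Grassmann n)
  coeff_xi : ∀ i, V (Idx.xi i) z = ∑ k, pd k (vcoord e X i) z.1 • (xi k : Grassmann n)
    - f • (xi i : Grassmann n)

variable {g} {X : VField n M} {V : LocalVF n} {f : ℝ}

/-- The local expression of the comoment map. -/
theorem IsLiftAt.pairing_alpha (hV : IsLiftAt e X f V z) (hX : IsSmoothField X)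
    (hz : z ∈ domain e) : pairing V (alpha hbar g e) z
      = ∑ i, sc (z.2 i * vcoord e X i z.1) + ((hbar : ℂ) / (2 * Complex.I)) •
        ∑ j, ∑ k, xi j * xi k * sc (skewD g e X k j z.1) := by
  have hlow : ∀ k j, pd k (vlower g e X j) z.1 = ∑ l, (pd k (gcoord g e j l) z.1
      * vcoord e X l z.1 + gcoord g e j l z.1 * pd k (vcoord e X l) z.1) := by
    intro k j
    have h1 := fun l => (contDiffAt_gcoord g hz j l).differentiableAt_of_infty
    have h2 := fun l => (contDiffAt_vcoord hX hz l).differentiableAt_of_infty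
    refine (pd_sum _ k fun l _ => (h1 l).mul (h2 l)).trans ?_
    exact Finset.sum_congr rfl fun l _ => pd_mul k (h1 l) (h2 l)
  -- This is gᵢⱼ ξʲξⁱ = 0; it removes the factor f from the pairing, which therefore depends on X
  -- alone.
  have hxb : ∑ j, xi j * betaX g e j z = 0 := by
    simp only [betaX, Finset.mul_sum, mul_smul_comm]
    refine sum_sum_eq_zero_of_antisymm _ fun j i => ?_
    rw [xi_mul_xi i j, gcoord_symm g j i]
    module
  -- Product rule for ∂ₖ(gᵢₗ Xˡ): the derivatives of g come from the dx-part of α, those of X from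
  -- its dξ-part.
  have hcore : ∑ l, vcoord e X l z.1 • extBeta g e l z
      + ∑ j, (∑ k, pd k (vcoord e X j) z.1 • (xi k : Grassmann n)) * betaX g e j z
      = ∑ k, ∑ i, pd k (vlower g e X i) z.1 • (xi k * xi i) := by
    have h1 : ∀ j, (∑ k, pd k (vcoord e X j) z.1 • (xi k : Grassmann n)) * betaX g e j z
        = ∑ k, ∑ i, pd k (vcoord e X j) z.1 • gcoord g e i j z.1 • (xi k * xi i) := by
      intro j
      rw [Finset.sum_mul]
      simp only [betaX, Finset.mul_sum, smul_mul_assoc, mul_smul_comm]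
      exact Finset.sum_congr rfl fun k _ => Finset.sum_congr rfl fun i _ => smul_comm _ _ _
    simp only [h1, extBeta_eq g hz, Finset.smul_sum, hlow, Finset.sum_smul]
    rw [← Finset.sum_add_distrib]
    rw [Finset.sum_congr rfl fun (k : Fin n) _ => Finset.sum_comm (s := Finset.univ)
      (t := Finset.univ) (f := fun (i l : Fin n) => (pd k (gcoord g e i l) z.1 * vcoord e X l z.1
        + gcoord g e i l z.1 * pd k (vcoord e X l) z.1) • (xi k * xi i : Grassmann n))]
    rw [Finset.sum_comm]
    simp only [← Finset.sum_add_distrib]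
    refine Finset.sum_congr rfl fun l _ => Finset.sum_congr rfl fun k _ =>
      Finset.sum_congr rfl fun i _ => ?_
    module
  -- Only the skew part survives against ξᵏξⁱ; the sign is due to the opposite order of the odd
  -- factors on the right.
  have hskew : ∑ k, ∑ i, pd k (vlower g e X i) z.1 • (xi k * xi i : Grassmann n)
      = -∑ j, ∑ k, xi j * xi k * sc (skewD g e X k j z.1) := by
    rw [eq_neg_iff_add_eq_zero]
    simp only [← Finset.sum_add_distrib, mul_sc]
    refine sum_sum_eq_zero_of_antisymm _ fun j k => ?_
    rw [xi_mul_xi k j, skewD, skewD]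
    module
  have h1 : pairing V (alpha hbar g e) z = ∑ l, vcoord e X l z.1 • (sc (z.2 l) : Grassmann n)
      - planck hbar • (∑ l, vcoord e X l z.1 • extBeta g e l z
        + ∑ j, (∑ k, pd k (vcoord e X j) z.1 • (xi k : Grassmann n)) * betaX g e j z
        - f • ∑ j, xi j * betaX g e j z) := by
    rw [pairing, sum_idx]
    simp only [hV.coeff_x, hV.coeff_xi, alpha_x hbar g hz, alpha_p, alpha_xi, mul_zero,
      Finset.sum_const_zero, smul_mul_assoc, one_mul, sub_mul, mul_neg, mul_smul_comm, smul_sub,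
      smul_add, Finset.sum_sub_distrib, Finset.smul_sum, Finset.sum_neg_distrib,
      smul_comm _ (planck hbar)]
    abel
  rw [h1, hxb, hcore, hskew, smul_zero, sub_zero, smul_neg, sub_neg_eq_add]
  simp only [planck]
  congr 1
  exact Finset.sum_congr rfl fun i _ => by rw [mul_comm, sc_mul_sc, sc_mul]

/-- `L_V β = f β` in components. -/
theorem IsLiftAt.act_betaX (hV : IsLiftAt e X f V z) (hz : z ∈ domain e)
    (hconf : ∀ i j, lieDerivMetric g e X i j z.1 = 2 * f * gcoord g e i j z.1) (j : Fin n) :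
    ∑ l, pd j (vcoord e X l) z.1 • betaX g e l z + act V (betaX g e j) z
      = f • betaX g e j z := by
  rw [Supercotangent.act_betaX g hz]
  simp only [hV.coeff_x, hV.coeff_xi, betaX, Finset.smul_sum, smul_mul_assoc, one_mul, smul_sub, smul_smul,
    Finset.sum_sub_distrib]
  have h : ∀ i, (∑ k, (vcoord e X k z.1 * pd k (gcoord g e i j) z.1
      + gcoord g e k j z.1 * pd i (vcoord e X k) z.1
      + gcoord g e i k z.1 * pd j (vcoord e X k) z.1)) • (xi i : Grassmann n)
      = (2 * f * gcoord g e i j z.1) • xi i := fun i => by rw [← hconf]; rfl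
  have h2 := Finset.sum_congr rfl fun (i : Fin n) (_ : i ∈ Finset.univ) => h i
  simp only [Finset.sum_smul] at h2
  rw [Finset.sum_comm] at h2
  simp only [add_smul, Finset.sum_add_distrib] at h2
  -- Of the two copies of f in L_X g = 2f g, one is cancelled by the term −f ξⁱ of V and the other
  -- is the factor of β.
  have h3 : ∑ i, (2 * f * gcoord g e i j z.1) • (xi i : Grassmann n)
      = ∑ i, (gcoord g e i j z.1 * f) • xi i + ∑ i, (f * gcoord g e i j z.1) • xi i := by
    rw [← Finset.sum_add_distrib]
    exact Finset.sum_congr rfl fun i _ => by module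
  rw [h3] at h2
  have h4 : ∑ l, ∑ i, (pd j (vcoord e X l) z.1 * gcoord g e i l z.1) • (xi i : Grassmann n)
      = ∑ l, ∑ i, (gcoord g e i l z.1 * pd j (vcoord e X l) z.1) • xi i :=
    Finset.sum_congr rfl fun l _ => Finset.sum_congr rfl fun i _ => by rw [mul_comm]
  rw [h4, ← sub_eq_iff_eq_add'.2 h2]
  abel

end Supercotangent
end

/-! ### Construction of the lift in one chart. -/

noncomputable section

namespace Supercotangent

open Filter Topology Grassmann

variable {n : ℕ} {M : Type*} [TopologicalSpace M] [ChartedSpace (Model n) M]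

/-- The local lift of `X` with factor `f`, without its components along `∂_p`. -/
def liftCore (e : Chart n M) (X : VField n M) (f : Model n → ℝ) : LocalVF n
  | Idx.x i => fun z => vcoord e X i z.1 • (1 : Grassmann n)
  | Idx.p _ => fun _ => 0
  | Idx.xi i => fun z => ∑ k, pd k (vcoord e X i) z.1 • (xi k : Grassmann n)
      - f z.1 • (xi i : Grassmann n)

section Core

variable [IsManifold (𝓡 n) ∞ M] {e : Chart n M} {z : Body n} {X : VField n M} {f : Model n → ℝ}
  (hX : IsSmoothField X) (hf : ∀ u ∈ e.1.target, ContDiffAt ℝ ∞ f u) (hz : z ∈ domain e)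
include hX hf hz

theorem smoothAt_liftCore : SmoothAt (liftCore e X f) z := by
  intro a
  cases a with
  | x i => exact contDiffAt_base (contDiffAt_vcoord hX hz i) _
  | p i => exact contDiffAt_const (c := (0 : Grassmann n))
  | xi i =>
    exact (ContDiffAt.sum fun k _ => contDiffAt_base ((contDiffAt_vcoord hX hz i).pd k) _).sub
      (contDiffAt_base (hf _ hz) _)

omit hX hf hz in
theorem evenAt_liftCore : EvenAt (liftCore e X f) z := by
  intro a
  cases a with
  | x i => simp [liftCore, Idx.par, parity_real_smul]
  | p i => simp [liftCore]
  | xi i => simp [liftCore, Idx.par, parity_real_smul, add_comm, sub_eq_add_neg]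

omit hf in
theorem partialD_liftCore_x (a : Idx n) (i : Fin n) :
    partialD a (liftCore e X f (Idx.x i)) z = match a with
      | Idx.x k => pd k (vcoord e X i) z.1 • (1 : Grassmann n)
      | _ => 0 := by
  have hd := (contDiffAt_vcoord hX hz i).differentiableAt_of_infty
  cases a with
  | x k => exact partialD_x_base k hd _
  | p k => exact partialD_p_base k hd _
  | xi k => simp [partialD, liftCore]

theorem partialD_p_liftCore_xi (k i : Fin n) :
    partialD (Idx.p k) (liftCore e X f (Idx.xi i)) z = 0 := by
  have hd := fun k => ((contDiffAt_vcoord hX hz i).pd k).differentiableAt_of_infty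
  have h1 : ∀ k, DifferentiableAt ℝ
      (fun z : Body n => pd k (vcoord e X i) z.1 • (xi k : Grassmann n)) z := fun k =>
    differentiableAt_base (hd k) _
  have h2 : DifferentiableAt ℝ (fun z : Body n => -(f z.1 • (xi i : Grassmann n))) z :=
    (differentiableAt_base (hf _ hz).differentiableAt_of_infty _).neg
  simp only [liftCore, sub_eq_add_neg]
  rw [partialD_add _ (DifferentiableAt.fun_sum fun k _ => h1 k) h2,
    partialD_sum _ _ fun k _ => h1 k, partialD_neg,
    partialD_p_base _ (hf _ hz).differentiableAt_of_infty, neg_zero, add_zero]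
  exact Finset.sum_eq_zero fun m _ => partialD_p_base k (hd m) _

omit hX hf hz in
theorem partialD_xi_liftCore_xi (k i : Fin n) :
    partialD (Idx.xi k) (liftCore e X f (Idx.xi i)) z
      = pd k (vcoord e X i) z.1 • (1 : Grassmann n) - f z.1 • (if k = i then 1 else 0) := by
  simp [partialD, liftCore, dxi_xi]

end Core

variable [IsManifold (𝓡 n) ∞ M] (hbar : ℝ) (g : PseudoRiemannianMetric n M)

/-- The local lift of `X` with factor `f`, preserving `α`. -/
def liftLocal (e : Chart n M) (X : VField n M) (f : Model n → ℝ) : LocalVF n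
  | Idx.x i => liftCore e X f (Idx.x i)
  -- A component along ∂_{pⱼ} adds itself to the dxʲ-coefficient of L_V α, so it is set to cancel
  -- what the other components leave there.
  | Idx.p j => fun z => -lieDerivForm (liftCore e X f) (alpha hbar g e) (Idx.x j) z
  | Idx.xi i => liftCore e X f (Idx.xi i)

theorem isLiftAt_liftLocal (e : Chart n M) (X : VField n M) (f : Model n → ℝ) (z : Body n) :
    IsLiftAt e X (f z.1) (liftLocal hbar g e X f) z := ⟨fun _ => rfl, fun _ => rfl⟩

section LiftLocal

variable {e : Chart n M} {z : Body n} {X : VField n M} {f : Model n → ℝ}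
  (hX : IsSmoothField X) (hf : ∀ u ∈ e.1.target, ContDiffAt ℝ ∞ f u) (hz : z ∈ domain e)
include hX hf hz

theorem smoothAt_liftLocal : SmoothAt (liftLocal hbar g e X f) z := by
  intro a
  have hc := smoothAt_liftCore hX hf hz
  cases a with
  | x i => exact hc (Idx.x i)
  | p j =>
    exact (contDiffAt_lieDerivForm (Eventually.of_forall fun w => evenAt_liftCore)
      ((eventually_mem_domain hz).mono fun w hw => smoothAt_liftCore hX hf hw)
      ((eventually_mem_domain hz).mono fun w hw => smoothAt_alpha hbar g hw) _).neg
  | xi i => exact hc (Idx.xi i)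

theorem evenAt_liftLocal : EvenAt (liftLocal hbar g e X f) z := by
  intro a
  have hc : EvenAt (liftCore e X f) z := evenAt_liftCore
  cases a with
  | x i => exact hc (Idx.x i)
  | p j =>
    simp only [liftLocal, Idx.par, pow_zero, one_mul, map_neg]
    rw [parity_lieDerivForm_x (Eventually.of_forall fun w => evenAt_liftCore)
      ((eventually_mem_domain hz).mono fun w hw => evenAt_alpha hbar g hw)
      (smoothAt_liftCore hX hf hz) (smoothAt_alpha hbar g hz)]
  | xi i => exact hc (Idx.xi i)

variable {g}
variable (hconf : ∀ i j, lieDerivMetric g e X i j z.1 = 2 * f z.1 * gcoord g e i j z.1)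
include hconf

/-- The dx-part vanishes by the choice of the p-components. The dp-part vanishes because α has no
dp-part and the x- and ξ-components do not depend on p. The dξ-part is −ħ/2i times the identity
expressing L_V β = f β. -/
theorem lieDerivForm_liftLocal_alpha (b : Idx n) :
    lieDerivForm (liftLocal hbar g e X f) (alpha hbar g e) b z = 0 := by
  rw [lieDerivForm_of_even (evenAt_liftLocal hbar g hX hf hz)
    (smoothAt_liftLocal hbar g hX hf hz) (smoothAt_alpha hbar g hz)]
  cases b with
  | x j =>
    have h1 : lieDerivForm (liftCore e X f) (alpha hbar g e) (Idx.x j) z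
        = -liftLocal hbar g e X f (Idx.p j) z := (neg_neg _).symm
    rw [lieDerivForm_of_even evenAt_liftCore (smoothAt_liftCore hX hf hz)
      (smoothAt_alpha hbar g hz), ← sub_eq_zero, sub_neg_eq_add, act, sum_idx, sum_idx] at h1
    rw [act, sum_idx, sum_idx]
    simp only [alpha_p, mul_zero, Finset.sum_const_zero, zero_add, partialD_p_alpha hbar g hz,
      mul_ite, mul_one, Finset.sum_ite_eq', Finset.mem_univ, if_true] at h1 ⊢
    rw [← h1]
    simp only [liftLocal, liftCore]
    abel
  | p m =>
    have h2 : ∀ i, partialD (Idx.p m) (liftLocal hbar g e X f (Idx.x i)) z = 0 := fun i =>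
      partialD_liftCore_x hX hz (f := f) _ i
    have h3 : ∀ i, partialD (Idx.p m) (liftLocal hbar g e X f (Idx.xi i)) z = 0 := fun i =>
      partialD_p_liftCore_xi hX hf hz m i
    have h4 : act (liftLocal hbar g e X f) (alpha hbar g e (Idx.p m)) z = 0 := by
      rw [act, sum_idx]
      simp [alpha_p, partialD]
    rw [sum_idx, h4]
    simp [h2, h3, alpha_p]
  | xi j =>
    have h2 : ∀ i, partialD (Idx.xi j) (liftLocal hbar g e X f (Idx.x i)) z = 0 := fun i =>
      partialD_liftCore_x hX hz (f := f) _ i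
    have h3 : ∀ i, partialD (Idx.xi j) (liftLocal hbar g e X f (Idx.xi i)) z
        = pd j (vcoord e X i) z.1 • (1 : Grassmann n) - f z.1 • (if j = i then 1 else 0) :=
      fun i => partialD_xi_liftCore_xi j i
    have hb := fun k => (contDiffAt_betaX g hz k).differentiableAt_of_infty
    have h4 : act (liftLocal hbar g e X f) (alpha hbar g e (Idx.xi j)) z
        = -(planck hbar • act (liftLocal hbar g e X f) (betaX g e j) z) := by
      simp only [act, alpha_xi, partialD_neg, partialD_const_smul _ _ (hb j), mul_neg,
        mul_smul_comm, Finset.sum_neg_distrib, Finset.smul_sum]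
    have h5 := (isLiftAt_liftLocal hbar g e X f z).act_betaX hz hconf j
    rw [sum_idx, h4, eq_sub_of_add_eq' h5]
    simp only [h2, h3, alpha_p, alpha_xi, zero_mul, mul_zero, Finset.sum_const_zero, zero_add,
      sub_mul, smul_mul_assoc, one_mul, ite_mul, Finset.sum_sub_distrib, smul_ite, smul_zero,
      Finset.sum_ite_eq, Finset.mem_univ, if_true, smul_neg, smul_sub, Finset.smul_sum,
      Finset.sum_neg_distrib, smul_comm _ (planck hbar)]
    abel

theorem lieDerivForm_liftLocal_beta (b : Idx n) :
    lieDerivForm (liftLocal hbar g e X f) (beta g e) b z = sc (f z.1) * beta g e b z := by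
  rw [lieDerivForm_of_even (evenAt_liftLocal hbar g hX hf hz)
    (smoothAt_liftLocal hbar g hX hf hz) (smoothAt_beta g hz)]
  have h0 : ∀ (a : Idx n) i, partialD a (liftLocal hbar g e X f (Idx.x i)) z = match a with
      | Idx.x k => pd k (vcoord e X i) z.1 • (1 : Grassmann n)
      | _ => 0 := fun a i => partialD_liftCore_x hX hz (f := f) a i
  have hp : ∀ i, beta g e (Idx.p i) = fun _ => 0 := fun _ => rfl
  have hxi : ∀ i, beta g e (Idx.xi i) = fun _ => 0 := fun _ => rfl
  have hact : act (liftLocal hbar g e X f) (fun _ => 0) z = 0 := by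
    rw [act, sum_idx]
    simp [partialD]
  rw [sum_idx]
  cases b with
  | x j =>
    simp only [h0, hp, hxi, beta_x, sc_mul, mul_zero, Finset.sum_const_zero, add_zero,
      smul_mul_assoc, one_mul]
    exact (isLiftAt_liftLocal hbar g e X f z).act_betaX hz hconf j
  | p j => simp [h0, hp, hxi, hact]
  | xi j => simp [h0, hp, hxi, hact]

end LiftLocal

end Supercotangent
end

/-! ### Changes of natural coordinates and gluing of the local lifts. -/

noncomputable section

namespace Supercotangent

open Filter Topology Grassmann

variable {n : ℕ} {M : Type*} [TopologicalSpace M] [ChartedSpace (Model n) M]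
  [IsManifold (𝓡 n) ∞ M]

section Transition

variable {e e' : Chart n M} {z : Body n} (hu : z.1 ∈ overlap e e')

variable (e e') in
/-- The new natural coordinates as functions of the old ones. -/
abbrev natCoord : Idx n → LocalFun n :=
  newCoord (transition e e') (fun w => jacobian e e' w.1)

theorem transition_fst (w : Body n) : (transition e e' w).1 = chartChange e e' w.1 := rfl

include hu

theorem eventually_overlap : ∀ᶠ w : Body n in 𝓝 z, w.1 ∈ overlap e e' :=
  ((isOpen_overlap e e').preimage continuous_fst).eventually_mem hu

theorem transition_mem_domain : transition e e' z ∈ domain e' := (chartChange_mem hu).1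

theorem contDiffAt_transition : ContDiffAt ℝ ∞ (transition e e') z := by
  have h1 : ContDiffAt ℝ ∞ (fun w : Body n => chartChange e e' w.1) z :=
    (contDiffAt_chartChange hu).comp z contDiffAt_fst
  have h2 : ContDiffAt ℝ ∞ (fun w : Body n => (WithLp.toLp 2 fun i => ∑ j, w.2 j *
      jacobian e' e (chartChange e e' w.1) j i : Model n)) z := by
    have h3 : ∀ i j, ContDiffAt ℝ ∞ (fun w : Body n => w.2 j *
        jacobian e' e (chartChange e e' w.1) j i) z := fun i j =>
      ((EuclideanSpace.proj (𝕜 := ℝ) j).contDiff.contDiffAt.comp z contDiffAt_snd).mul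
        (show ContDiffAt ℝ ∞ ((fun v => jacobian e' e v j i) ∘
          fun w : Body n => chartChange e e' w.1) z from
          ContDiffAt.comp z (contDiffAt_jacobian (chartChange_mem hu) j i) h1)
    have h4 : ∀ i, ContDiffAt ℝ ∞ (fun w : Body n => ∑ j, w.2 j *
        jacobian e' e (chartChange e e' w.1) j i) z := fun i => ContDiffAt.sum fun j _ => h3 i j
    exact contDiffAt_euclidean.2 h4
  exact h1.prodMk h2

theorem contDiffAt_jacobian_fst (i j : Fin n) :
    ContDiffAt ℝ ∞ (fun w : Body n => jacobian e e' w.1 i j) z :=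
  (contDiffAt_jacobian hu i j).comp z contDiffAt_fst

theorem partialD_natCoord_x (a : Idx n) (i : Fin n) : partialD a (natCoord e e' (Idx.x i)) z
    = match a with
      | Idx.x k => jacobian e e' z.1 i k • (1 : Grassmann n)
      | _ => 0 := by
  have hd := (contDiffAt_chartChange_coord hu i).differentiableAt_of_infty
  cases a with
  | x k => exact partialD_x_base k hd _
  | p k => exact partialD_p_base k hd _
  | xi k => simp [partialD, newCoord]

theorem partialD_natCoord_xi (a : Idx n) (i : Fin n) : partialD a (natCoord e e' (Idx.xi i)) z
    = match a with
      | Idx.x k => ∑ j, pd k (fun v => jacobian e e' v i j) z.1 • (xi j : Grassmann n)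
      | Idx.p _ => 0
      | Idx.xi k => jacobian e e' z.1 i k • (1 : Grassmann n) := by
  have hd := fun j => (contDiffAt_jacobian hu i j).differentiableAt_of_infty
  have h1 := fun j => differentiableAt_base (hd j) (xi j : Grassmann n)
  cases a with
  | x k =>
    exact (partialD_sum _ _ fun j _ => h1 j).trans
      (Finset.sum_congr rfl fun j _ => partialD_x_base k (hd j) _)
  | p k =>
    exact (partialD_sum _ _ fun j _ => h1 j).trans
      (Finset.sum_eq_zero fun j _ => partialD_p_base k (hd j) _)
  | xi k => simp [partialD, newCoord, dxi_xi]

end Transition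

section Forms

variable (hbar : ℝ) (g : PseudoRiemannianMetric n M) {e e' : Chart n M} {z : Body n}
  (hu : z.1 ∈ overlap e e')
include hu

/-- One of the two Jacobians in the transformation of g is absorbed into ξ'; the other is the one of
a covector. -/
theorem betaX_change (l : Fin n) : betaX g e l z = ∑ m, jacobian e e' z.1 m l •
    subst (jacobian e e' z.1) (betaX g e' m (transition e e' z)) := by
  simp only [betaX, gcoord_change g hu, map_sum, subst_real_smul, subst_xi, Finset.smul_sum,
    Finset.sum_smul, transition_fst, smul_smul]
  rw [Finset.sum_comm]
  rw [Finset.sum_congr rfl fun (a : Fin n) _ => Finset.sum_comm]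
  rw [Finset.sum_comm]
  refine Finset.sum_congr rfl fun b _ => Finset.sum_congr rfl fun a _ =>
    Finset.sum_congr rfl fun i _ => ?_
  congr 1
  ring

/-- Apply ξᵏ∂ₖ to the covector law of β. Where it hits the Jacobian, symmetry of second derivatives
turns the result into ∂ₗξ'ᵐ; where it hits β', it becomes ξ'ᵇ∂'_b. The inhomogeneous term is what
the dξ-part of α compensates in `alpha_change`. -/
theorem extBeta_change (l : Fin n) : extBeta g e l z
    = ∑ m, partialD (Idx.x l) (natCoord e e' (Idx.xi m)) z *
        subst (jacobian e e' z.1) (betaX g e' m (transition e e' z))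
      + ∑ m, jacobian e e' z.1 m l •
        subst (jacobian e e' z.1) (extBeta g e' m (transition e e' z)) := by
  have hφ := contDiffAt_transition hu
  have hA := contDiffAt_jacobian_fst hu
  have hz' := transition_mem_domain hu
  set B : Fin n → LocalFun n := fun m w =>
    subst (jacobian e e' w.1) (betaX g e' m (transition e e' w)) with hB
  have hBs : ∀ m, ContDiffAt ℝ ∞ (B m) z := fun m =>
    contDiffAt_change hφ hA (contDiffAt_betaX g hz' m)
  have hev : betaX g e l =ᶠ[𝓝 z] fun w => ∑ m, (jacobian e e' w.1 m l • (1 : Grassmann n)) * B m w :=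
    (eventually_overlap hu).mono fun w hw => by
      simp only [betaX_change g hw, hB, smul_mul_assoc, one_mul]
  have hJ : ∀ m, DifferentiableAt ℝ
      (fun w : Body n => jacobian e e' w.1 m l • (1 : Grassmann n)) z := fun m =>
    differentiableAt_base (contDiffAt_jacobian hu m l).differentiableAt_of_infty _
  have h1 : ∀ k, partialD (Idx.x k) (betaX g e l) z
      = ∑ m, (pd k (fun v => jacobian e e' v m l) z.1 • B m z
        + jacobian e e' z.1 m l • partialD (Idx.x k) (B m) z) := by
    intro k
    rw [partialD_congr _ hev]
    refine (partialD_sum _ _ fun m _ => ?_).trans (Finset.sum_congr rfl fun m _ => ?_)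
    · exact ((contDiffAt_base (contDiffAt_jacobian hu m l) _).gmul
        (hBs m)).differentiableAt_of_infty
    · rw [partialD_mul _ (hJ m) (hBs m).differentiableAt_of_infty,
        partialD_x_base k (contDiffAt_jacobian hu m l).differentiableAt_of_infty]
      simp [Idx.par]
  have h2 : ∀ m, ∑ k, xi k * partialD (Idx.x k) (B m) z
      = subst (jacobian e e' z.1) (extBeta g e' m (transition e e' z)) := by
    intro m
    have h3 : ∀ k, partialD (Idx.x k) (B m) z
        = ∑ b, jacobian e e' z.1 b k •
          subst (jacobian e e' z.1) (partialD (Idx.x b) (betaX g e' m) (transition e e' z))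
          + ∑ a, partialD (Idx.x k) (natCoord e e' (Idx.xi a)) z *
            subst (jacobian e e' z.1) (partialD (Idx.xi a) (betaX g e' m) (transition e e' z)) := by
      intro k
      refine (partialD_change hφ hA (contDiffAt_betaX g hz' m) (Idx.x k)).trans ?_
      rw [sum_idx]
      simp [partialD_natCoord_x hu, partialD_p_betaX g hz']
    -- ξ'ᵃ is itself annihilated by ξᵏ∂ₖ: a second derivative of x'ᵃ is contracted with ξᵏξʲ.
    have h4 : ∀ a, ∑ k, xi k * partialD (Idx.x k) (natCoord e e' (Idx.xi a)) z = 0 := by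
      intro a
      simp only [partialD_natCoord_xi hu, Finset.mul_sum, mul_smul_comm]
      refine sum_sum_eq_zero_of_antisymm _ fun k j => ?_
      rw [xi_mul_xi j k, pd_jacobian_comm hu a k j]
      module
    simp only [h3, mul_add, Finset.sum_add_distrib, Finset.mul_sum, ← mul_assoc]
    rw [Finset.sum_comm (γ := Fin n)]
    conv_lhs => enter [2]; rw [Finset.sum_comm]
    simp only [← Finset.sum_mul, h4, zero_mul, Finset.sum_const_zero, add_zero]
    simp only [extBeta, map_sum, map_mul, subst_xi, Finset.sum_mul, smul_mul_assoc, mul_smul_comm]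
  have h5 : extBeta g e l z = ∑ m, (∑ k, pd k (fun v => jacobian e e' v m l) z.1 • xi k) * B m z
      + ∑ m, jacobian e e' z.1 m l • ∑ k, xi k * partialD (Idx.x k) (B m) z := by
    simp only [extBeta, h1, Finset.mul_sum, Finset.sum_mul, Finset.smul_sum, smul_mul_assoc]
    rw [Finset.sum_comm, ← Finset.sum_add_distrib]
    simp only [← Finset.sum_add_distrib, mul_add, mul_smul_comm]
  simp only [h5, h2, partialD_natCoord_xi hu, pd_jacobian_comm hu _ l]
  rfl

/-- The form `α` is globally defined. -/
theorem alpha_change (a : Idx n) : alpha hbar g e a z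
    = ∑ b, partialD a (natCoord e e' b) z *
        subst (jacobian e e' z.1) (alpha hbar g e' b (transition e e' z)) := by
  have hz : z ∈ domain e := hu.1
  have hz' := transition_mem_domain hu
  rw [sum_idx]
  cases a with
  | x l =>
    -- The new momenta carry the inverse Jacobian, so the Jacobian recovers the old ones.
    have hp : ∑ m, jacobian e e' z.1 m l * (transition e e' z).2 m = z.2 l := by
      have h1 : ∀ m, (transition e e' z).2 m
          = ∑ j, z.2 j * jacobian e' e (chartChange e e' z.1) j m := fun _ => rfl
      have h2 := fun j => congrFun (congrFun (jacobian_mul_jacobian hu) j) l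
      simp only [Matrix.mul_apply] at h2
      simp only [h1, Finset.mul_sum]
      rw [Finset.sum_comm]
      have h3 : ∀ j, ∑ m, jacobian e e' z.1 m l *
          (z.2 j * jacobian e' e (chartChange e e' z.1) j m)
          = z.2 j * (1 : Matrix (Fin n) (Fin n) ℝ) j l := fun j => by
        rw [← h2, Finset.mul_sum]
        exact Finset.sum_congr rfl fun m _ => by ring
      simp [h3, Matrix.one_apply]
    rw [alpha_x hbar g hz, extBeta_change g hu, ← hp, sc_sum]
    simp only [alpha_x hbar g hz', alpha_p, alpha_xi, partialD_natCoord_x hu, map_sub, map_neg,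
      map_smul, subst_sc, map_zero, mul_zero, Finset.sum_const_zero, zero_add, smul_mul_assoc,
      one_mul, smul_sub, mul_neg, mul_smul_comm, Finset.sum_sub_distrib, Finset.sum_neg_distrib,
      smul_add, Finset.smul_sum, sc_mul_sc, sc_mul, smul_comm _ (planck hbar)]
    abel
  | p l =>
    simp [alpha_p, partialD_natCoord_x hu, partialD_natCoord_xi hu]
  | xi l =>
    simp only [alpha_p, alpha_xi, partialD_natCoord_x hu, partialD_natCoord_xi hu, zero_mul,
      map_zero, mul_zero, Finset.sum_const_zero, zero_add, betaX_change g hu, map_neg, map_smul,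
      smul_mul_assoc, one_mul, smul_neg, Finset.sum_neg_distrib, Finset.smul_sum,
      smul_comm _ (planck hbar)]

end Forms

section LiftChange

variable {hbar : ℝ} {g : PseudoRiemannianMetric n M} {e e' : Chart n M} {z : Body n}
  {X : VField n M} {V V' : LocalVF n} {f : ℝ}

theorem IsLiftAt.act_natCoord_x (hu : z.1 ∈ overlap e e') (hV : IsLiftAt e X f V z)
    (hV' : IsLiftAt e' X f V' (transition e e' z)) (i : Fin n) :
    act V (natCoord e e' (Idx.x i)) z
      = subst (jacobian e e' z.1) (V' (Idx.x i) (transition e e' z)) := by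
  rw [act, sum_idx]
  simp only [hV.coeff_x, hV'.coeff_x, partialD_natCoord_x hu, mul_zero, Finset.sum_const_zero,
    add_zero, transition_fst, vcoord_change X hu, subst_real_smul, map_one,
    smul_mul_assoc, one_mul, smul_smul, mul_comm, ← Finset.sum_smul]

/-- Differentiating the transformation law of X produces the Jacobian of the ξ-components and a
second-derivative term; the latter is X acting on the coefficients of ξ'ⁱ. The terms in f match
because the factor is the same in both charts. -/
theorem IsLiftAt.act_natCoord_xi (hX : IsSmoothField X) (hu : z.1 ∈ overlap e e')
    (hV : IsLiftAt e X f V z) (hV' : IsLiftAt e' X f V' (transition e e' z)) (i : Fin n) :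
    act V (natCoord e e' (Idx.xi i)) z
      = subst (jacobian e e' z.1) (V' (Idx.xi i) (transition e e' z)) := by
  have hJ := fun j => (contDiffAt_jacobian hu i j).differentiableAt_of_infty
  have hv := fun j => (contDiffAt_vcoord hX hu.1 j).differentiableAt_of_infty
  have h1 : ∀ m, ∑ k, jacobian e e' z.1 k m * pd k (vcoord e' X i) (chartChange e e' z.1)
      = ∑ j, (pd m (fun v => jacobian e e' v i j) z.1 * vcoord e X j z.1
        + jacobian e e' z.1 i j * pd m (vcoord e X j) z.1) := by
    intro m
    have hev : (fun v => vcoord e' X i (chartChange e e' v)) =ᶠ[𝓝 z.1]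
        fun v => ∑ j, jacobian e e' v i j * vcoord e X j v :=
      ((isOpen_overlap e e').eventually_mem hu).mono fun v hv => vcoord_change X hv i
    have h2 := (pd_comp (contDiffAt_vcoord hX (chartChange_mem hu).1 i).differentiableAt_of_infty
      (contDiffAt_chartChange hu).differentiableAt_of_infty m).symm
    refine Eq.trans h2 ((pd_congr m hev).trans ?_)
    refine (pd_sum _ m fun j _ => (hJ j).mul (hv j)).trans ?_
    exact Finset.sum_congr rfl fun j _ => pd_mul m (hJ j) (hv j)
  have h3 : ∑ k, pd k (vcoord e' X i) (chartChange e e' z.1) •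
      ∑ m, jacobian e e' z.1 k m • (xi m : Grassmann n)
      = ∑ j, ∑ m, (pd m (fun v => jacobian e e' v i j) z.1 * vcoord e X j z.1
        + jacobian e e' z.1 i j * pd m (vcoord e X j) z.1) • xi m := by
    rw [Finset.sum_comm]
    simp only [← Finset.sum_smul, ← h1]
    simp only [Finset.smul_sum, Finset.sum_smul, smul_smul]
    rw [Finset.sum_comm]
    simp only [mul_comm]
  rw [act, sum_idx, hV'.coeff_xi]
  simp only [map_sub, map_sum, subst_real_smul, subst_xi, transition_fst, h3]
  simp only [hV.coeff_x, hV.coeff_xi, partialD_natCoord_xi hu, mul_zero, Finset.sum_const_zero,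
    zero_add, smul_mul_assoc, one_mul, mul_smul_comm, mul_one, smul_sub, Finset.smul_sum,
    Finset.sum_sub_distrib, add_smul, Finset.sum_add_distrib, smul_smul, pd_jacobian_comm hu i]
  rw [add_sub_assoc]
  congr 1
  · exact Finset.sum_congr rfl fun j _ => Finset.sum_congr rfl fun m _ => by rw [mul_comm]
  · congr 1
    exact Finset.sum_congr rfl fun j _ => by rw [mul_comm]

end LiftChange

section LiftCompat

variable (hbar : ℝ) (g : PseudoRiemannianMetric n M) {e e' : Chart n M} {z : Body n}
  {X : VField n M} {f : M → ℝ}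

/-- The x- and ξ-components are compared directly. For the p-components no explicit formula is
needed: both local lifts preserve α, so `lieDerivForm_change` controls their difference. -/
theorem act_natCoord_liftLocal (hX : IsSmoothField X) (hf : ContMDiff (𝓡 n) 𝓘(ℝ) ∞ f)
    (hconf : ∀ e : Chart n M, ∀ u ∈ e.1.target, ∀ i j,
      lieDerivMetric g e X i j u = 2 * f (e.1.symm u) * gcoord g e i j u)
    (hu : z.1 ∈ overlap e e') (b : Idx n) :
    act (liftLocal hbar g e X fun v => f (e.1.symm v)) (natCoord e e' b) z
      = subst (jacobian e e' z.1)
        (liftLocal hbar g e' X (fun v => f (e'.1.symm v)) b (transition e e' z)) := by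
  have hV : ∀ w : Body n, IsLiftAt e X (f (e.1.symm w.1))
      (liftLocal hbar g e X fun v => f (e.1.symm v)) w := fun w =>
    isLiftAt_liftLocal hbar g e X (fun v => f (e.1.symm v)) w
  have hV' : ∀ w : Body n, w.1 ∈ overlap e e' → IsLiftAt e' X (f (e.1.symm w.1))
      (liftLocal hbar g e' X fun v => f (e'.1.symm v)) (transition e e' w) := fun w hw => by
    have h := isLiftAt_liftLocal hbar g e' X (fun v => f (e'.1.symm v)) (transition e e' w)
    rwa [transition_fst, symm_chartChange hw] at h
  have hfe : ∀ e : Chart n M, ∀ u ∈ e.1.target, ContDiffAt ℝ ∞ (fun v => f (e.1.symm v)) u :=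
    fun e u hu => contDiffAt_chart hf hu
  have hx : ∀ i, ∀ w : Body n, w.1 ∈ overlap e e' → _ := fun i w hw =>
    (hV w).act_natCoord_x hw (hV' w hw) i
  have hxi : ∀ i, ∀ w : Body n, w.1 ∈ overlap e e' → _ := fun i w hw =>
    (hV w).act_natCoord_xi hX hw (hV' w hw) i
  cases b with
  | x i => exact hx i z hu
  | xi i => exact hxi i z hu
  | p i =>
    have hz : z ∈ domain e := hu.1
    have hz' := transition_mem_domain hu
    have key := fun l => lieDerivForm_change (contDiffAt_transition hu) (contDiffAt_jacobian_fst hu)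
      l (evenAt_liftLocal hbar g hX (hfe e) hz) (smoothAt_liftLocal hbar g hX (hfe e) hz)
      (smoothAt_alpha hbar g hz) (evenAt_liftLocal hbar g hX (hfe e') hz')
      (smoothAt_liftLocal hbar g hX (hfe e') hz') (smoothAt_alpha hbar g hz')
      (fun a => (eventually_overlap hu).mono fun w hw => alpha_change hbar g hw a)
      (lieDerivForm_liftLocal_alpha hbar hX (hfe e) hz (hconf e _ hz) _)
      (lieDerivForm_liftLocal_alpha hbar hX (hfe e') hz' (hconf e' _ hz'))
      (fun b => match b with
        | Idx.x i => Or.inr ((eventually_overlap hu).mono fun w hw => hx i w hw)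
        | Idx.p _ => Or.inl rfl
        | Idx.xi i => Or.inr ((eventually_overlap hu).mono fun w hw => hxi i w hw))
    -- Only the dx-coefficients of α depend on p and the other differences vanish, so a single
    -- p-difference survives.
    have hd : ∀ b : Idx n, ∑ d, (act (liftLocal hbar g e X fun v => f (e.1.symm v))
          (natCoord e e' d) z - subst (jacobian e e' z.1)
            (liftLocal hbar g e' X (fun v => f (e'.1.symm v)) d (transition e e' z))) *
          subst (jacobian e e' z.1) (partialD d (alpha hbar g e' b) (transition e e' z))
        = match b with
          | Idx.x m => act (liftLocal hbar g e X fun v => f (e.1.symm v))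
              (natCoord e e' (Idx.p m)) z - subst (jacobian e e' z.1)
              (liftLocal hbar g e' X (fun v => f (e'.1.symm v)) (Idx.p m) (transition e e' z))
          | _ => 0 := by
      intro b
      rw [sum_idx]
      simp only [hx _ z hu, hxi _ z hu, sub_self, zero_mul, Finset.sum_const_zero, zero_add,
        add_zero, partialD_p_alpha hbar g hz']
      cases b with
      | x m => simp [apply_ite]
      | _ m => simp
    simp only [hd] at key
    have key2 := fun l => (sum_idx _).symm.trans (key l)
    simp only [partialD_natCoord_x hu, mul_zero, Finset.sum_const_zero, add_zero,
      smul_mul_assoc, one_mul] at key2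
    rw [← sub_eq_zero]
    set W : Fin n → Grassmann n := fun m => act (liftLocal hbar g e X fun v => f (e.1.symm v))
      (natCoord e e' (Idx.p m)) z - subst (jacobian e e' z.1)
      (liftLocal hbar g e' X (fun v => f (e'.1.symm v)) (Idx.p m) (transition e e' z)) with hW
    have key3 : ∀ l, ∑ m, jacobian e e' z.1 m l • W m = 0 := key2
    -- Inverting the Jacobian isolates each p-difference from the linear system `key3`.
    have h1 : ∑ l, jacobian e' e (chartChange e e' z.1) l i • ∑ m, jacobian e e' z.1 m l • W m
        = W i := by
      simp only [Finset.smul_sum, smul_smul]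
      rw [Finset.sum_comm]
      have h2 := fun m => congrFun (congrFun (jacobian_mul_jacobian' hu) m) i
      simp only [Matrix.mul_apply] at h2
      simp only [mul_comm (jacobian e' e _ _ _), ← Finset.sum_smul, h2]
      simp [Matrix.one_apply]
    refine h1.symm.trans ?_
    simp only [key3, smul_zero, Finset.sum_const_zero]

/-- The local lifts define a vector field on the supercotangent bundle. -/
def liftVF (hX : IsSmoothField X) (hf : ContMDiff (𝓡 n) 𝓘(ℝ) ∞ f)
    (hconf : ∀ e : Chart n M, ∀ u ∈ e.1.target, ∀ i j,
      lieDerivMetric g e X i j u = 2 * f (e.1.symm u) * gcoord g e i j u) : SuperVF n M where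
  coeff e a := (domain e).indicator (liftLocal hbar g e X (fun v => f (e.1.symm v)) a)
  smooth e a := by
    intro z hz
    refine (smoothAt_liftLocal hbar g hX (fun u hu => contDiffAt_chart hf hu) hz
      a).contDiffWithinAt.congr (fun w hw => Set.indicator_of_mem hw _)
      (Set.indicator_of_mem hz _)
  compat e e' F hF z hz hz' := by
    have hu : z.1 ∈ overlap e e' := ⟨hz, hz'⟩
    have hφz := transition_mem_domain hu
    have h1 := act_change_of_coord (contDiffAt_transition hu) (contDiffAt_jacobian_fst hu)
      (act_natCoord_liftLocal hbar g hX hf hconf hu)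
      ((hF _ hφz).contDiffAt ((isOpen_domain e').mem_nhds hφz))
    simp only [act, pullback, Set.indicator_of_mem hz, Set.indicator_of_mem hφz] at h1 ⊢
    exact h1
  off e a z hz := Set.indicator_of_notMem hz _

end LiftCompat

end Supercotangent
end

noncomputable section

namespace Supercotangent

open Filter Topology Grassmann

variable {n : ℕ} {M : Type*} [TopologicalSpace M] [ChartedSpace (Model n) M]
  [IsManifold (𝓡 n) ∞ M] (hbar : ℝ) (g : PseudoRiemannianMetric n M)

/-! ### Nondegeneracy of the symplectic form -/

section Nondegenerate

variable {e : Chart n M} {z : Body n}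

theorem eq_zero_of_sum_gcoord (hz : z ∈ domain e) {D : Fin n → Grassmann n}
    (hD : ∀ j, ∑ k, gcoord g e k j z.1 • D k = 0) (i : Fin n) : D i = 0 := by
  have h1 : ∑ j, ginv g e j i z.1 • ∑ k, gcoord g e k j z.1 • D k = D i := by
    simp only [Finset.smul_sum, smul_smul]
    rw [Finset.sum_comm]
    simp only [mul_comm (ginv g e _ _ _), ← Finset.sum_smul, sum_gcoord_ginv g hz]
    simp
  rw [← h1]
  simp only [hD, smul_zero, Finset.sum_const_zero]

variable {g} (hbar_ne : hbar ≠ 0) (hz : z ∈ domain e)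
include hbar_ne hz

/-- The system is triangular: the dp-coefficients give the x-components, then the dξ-coefficients
give the ξ-components by invertibility of g and ħ ≠ 0, and then the dx-coefficients give the
p-components. -/
theorem eq_zero_of_contractD_alpha {U : LocalVF n}
    (h : ∀ b, contractD U (alpha hbar g e) b z = 0) (a : Idx n) : U a z = 0 := by
  have hx : ∀ i, U (Idx.x i) z = 0 := by
    intro i
    have h1 := h (Idx.p i)
    rw [contractD, sum_idx] at h1
    have h0 : ∀ c, partialD c (alpha hbar g e (Idx.p i)) z = 0 := by
      intro c
      cases c <;> simp [alpha_p, partialD]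
    simpa [h0, partialD_p_alpha hbar g hz, Idx.par] using h1
  have hxi : ∀ i, U (Idx.xi i) z = 0 := by
    -- The sign rule of `contractD` twists the coefficients in the odd slots; `parity` is an
    -- involution, so the twist is harmless.
    have hp : ∀ i, parity (U (Idx.xi i) z) = 0 := by
      refine eq_zero_of_sum_gcoord g hz fun j => ?_
      have h1 := h (Idx.xi j)
      have h0 : ∀ k l, partialD (Idx.xi k) (alpha hbar g e (Idx.xi l)) z
          = -(planck hbar • gcoord g e k l z.1 • (1 : Grassmann n)) := by
        intro k l
        rw [alpha_xi, partialD_neg, partialD_const_smul _ _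
          (contDiffAt_betaX g hz l).differentiableAt_of_infty, partialD_xi_betaX]
      have h2 : ∀ k, partialD (Idx.xi j) (alpha hbar g e (Idx.p k)) z = 0 := by
        intro k
        simp [alpha_p, partialD]
      rw [contractD, sum_idx] at h1
      simp only [hx, h0, h2, Idx.par, Function.iterate_one, map_zero, zero_mul,
        Finset.sum_const_zero, zero_add, partialD_p_alpha hbar g hz, sub_zero, mul_zero,
        one_mul, pow_one, mul_neg, neg_mul, neg_neg, sub_neg_eq_add,
        gcoord_symm g j] at h1
      -- In the odd-odd block the two terms of dα add up instead of cancelling, hence the 2.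
      have hc : (2 : ℂ) * planck hbar ≠ 0 := by simp [planck, hbar_ne]
      have h3 : ((2 : ℂ) * planck hbar) • ∑ k, gcoord g e k j z.1 • parity (U (Idx.xi k) z) = 0 := by
        rw [← h1, Finset.smul_sum]
        refine Finset.sum_congr rfl fun k _ => ?_
        rw [mul_add, mul_smul_comm, mul_smul_comm, mul_one]
        module
      exact (smul_eq_zero.1 h3).resolve_left hc
    intro i
    rw [← parity_parity (U (Idx.xi i) z), hp, map_zero]
  cases a with
  | x i => exact hx i
  | xi i => exact hxi i
  | p i =>
    have h1 := h (Idx.x i)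
    rw [contractD, sum_idx] at h1
    have h0 : ∀ c, partialD (Idx.x i) (alpha hbar g e (Idx.p c)) z = 0 := by
      intro c
      simp [alpha_p, partialD]
    simpa [h0, hx, hxi, partialD_p_alpha hbar g hz, Idx.par] using h1

/-- The form `dα` is nondegenerate. -/
theorem contractD_alpha_injective {V W : LocalVF n}
    (h : ∀ b, contractD V (alpha hbar g e) b z = contractD W (alpha hbar g e) b z) (a : Idx n) :
    V a z = W a z := by
  refine sub_eq_zero.1 (eq_zero_of_contractD_alpha (g := g) (U := fun a w => V a w - W a w) hbar hbar_ne hz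
    (fun b => ?_) a)
  have h1 : ∀ b c : Idx n, parity^[b.par] (V c z - W c z)
      = parity^[b.par] (V c z) - parity^[b.par] (W c z) := by
    intro b c
    cases b <;> simp [Idx.par]
  simp only [contractD, h1, sub_mul, Finset.sum_sub_distrib] at h ⊢
  rw [h b, sub_self]

end Nondegenerate

variable {g}

theorem isHamiltonianVF_unique (hbar_ne : hbar ≠ 0) {F : SuperFun n M} {V W : SuperVF n M}
    (hV : IsHamiltonianVF hbar g F V) (hW : IsHamiltonianVF hbar g F W) : V = W := by
  ext e a z
  by_cases hz : z ∈ domain e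
  · exact contractD_alpha_injective hbar hbar_ne hz
      (fun b => (hV e z hz b).trans (hW e z hz b).symm) a
  · rw [V.off e a z hz, W.off e a z hz]

/-! ### The comoment map -/

theorem lieDerivForm_congr {V W : LocalVF n} {θ : LocalForm n} {z : Body n}
    (h : ∀ a, V a =ᶠ[𝓝 z] W a) (b : Idx n) : lieDerivForm V θ b z = lieDerivForm W θ b z := by
  have h1 : pairing V θ =ᶠ[𝓝 z] pairing W θ := by
    filter_upwards [eventually_all.2 h] with w hw
    simp only [pairing, hw]
  simp only [lieDerivForm, Supercotangent.diff, contractD, partialD_congr b h1,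
    (h _).eq_of_nhds]

/-- The factor `f` with `L_X g = 2 f g`. -/
theorem exists_factor (X : conf g) : ∃ f : M → ℝ, ContMDiff (𝓡 n) 𝓘(ℝ) ∞ f ∧
    ∀ e : Chart n M, ∀ u ∈ e.1.target, ∀ i j,
      lieDerivMetric g e X.1 i j u = 2 * f (e.1.symm u) * gcoord g e i j u := by
  obtain ⟨lam, hlam, h⟩ := X.2.2
  refine ⟨fun x => (1 / 2) * lam x, contMDiff_const.mul hlam, fun e u hu i j => ?_⟩
  rw [h e u hu]
  ring

/-- A factor `f` with `L_X g = 2 f g`. -/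
def factor (X : conf g) : M → ℝ := (exists_factor X).choose

theorem contMDiff_factor (X : conf g) : ContMDiff (𝓡 n) 𝓘(ℝ) ∞ (factor X) :=
  (exists_factor X).choose_spec.1

theorem lieDerivMetric_eq_factor (X : conf g) : ∀ e : Chart n M, ∀ u ∈ e.1.target, ∀ i j,
    lieDerivMetric g e X.1 i j u = 2 * factor X (e.1.symm u) * gcoord g e i j u :=
  (exists_factor X).choose_spec.2

/-- The expression of the lift of a conformal vector field in a chart. -/
abbrev confLiftLocal (X : conf g) (e : Chart n M) : LocalVF n :=
  liftLocal hbar g e X.1 fun v => factor X (e.1.symm v)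

/-- The lift of a conformal vector field to the supercotangent bundle. -/
def confLift (X : conf g) : SuperVF n M :=
  liftVF hbar g X.2.1 (contMDiff_factor X) (lieDerivMetric_eq_factor X)

section ConfLift

variable {e : Chart n M} {z : Body n} (hz : z ∈ domain e) (X Y : conf g)
include hz

theorem confLift_coeff (a : Idx n) : (confLift hbar X).coeff e a z = confLiftLocal hbar X e a z :=
  Set.indicator_of_mem hz _

theorem confLift_coeff_eventuallyEq (a : Idx n) :
    (confLift hbar X).coeff e a =ᶠ[𝓝 z] confLiftLocal hbar X e a :=
  (eventually_mem_domain hz).mono fun _ hw => confLift_coeff hbar hw X a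

theorem smoothAt_confLiftLocal : SmoothAt (confLiftLocal hbar X e) z :=
  smoothAt_liftLocal hbar g X.2.1 (fun _ hu => contDiffAt_chart (contMDiff_factor X) hu) hz

theorem evenAt_confLiftLocal : EvenAt (confLiftLocal hbar X e) z :=
  evenAt_liftLocal hbar g X.2.1 (fun _ hu => contDiffAt_chart (contMDiff_factor X) hu) hz

theorem lieDerivForm_confLiftLocal_alpha (b : Idx n) :
    lieDerivForm (confLiftLocal hbar X e) (alpha hbar g e) b z = 0 :=
  lieDerivForm_liftLocal_alpha hbar X.2.1
    (fun _ hu => contDiffAt_chart (contMDiff_factor X) hu) hz (lieDerivMetric_eq_factor X e _ hz) b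

theorem lieDerivForm_confLiftLocal_beta (b : Idx n) :
    lieDerivForm (confLiftLocal hbar X e) (beta g e) b z
      = sc (factor X (e.1.symm z.1)) * beta g e b z :=
  lieDerivForm_liftLocal_beta hbar X.2.1
    (fun _ hu => contDiffAt_chart (contMDiff_factor X) hu) hz (lieDerivMetric_eq_factor X e _ hz) b

end ConfLift

theorem isHamiltonianLift_confLift (X : conf g) :
    IsHamiltonianLift hbar g X.1 (confLift hbar X) where
  even e a z hz := by
    rw [confLift_coeff hbar hz]
    exact evenAt_confLiftLocal hbar hz X a
  lift e z hz i := by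
    rw [confLift_coeff hbar hz, sc_eq_smul]
    rfl
  alpha e z hz b := by
    rw [lieDerivForm_congr (confLift_coeff_eventuallyEq hbar hz X)]
    exact lieDerivForm_confLiftLocal_alpha hbar hz X b
  beta := ⟨factor X, contMDiff_factor X, fun e z hz b => by
    rw [lieDerivForm_congr (confLift_coeff_eventuallyEq hbar hz X)]
    exact lieDerivForm_confLiftLocal_beta hbar hz X b⟩

/-- The components along `∂_x` and `∂_ξ` of a Hamiltonian lift. -/
theorem IsHamiltonianLift.isLiftAt {X : conf g} {V : SuperVF n M}
    (hV : IsHamiltonianLift hbar g X.1 V) {e : Chart n M} {z : Body n} (hz : z ∈ domain e) :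
    ∃ f : ℝ, IsLiftAt e X.1 f (V.coeff e) z := by
  obtain ⟨f, -, hf⟩ := hV.beta
  -- The β-equations of V and of the constructed lift differ by (f − factor) β, so their
  -- ξ-components differ by (f − factor) ξ. Equality of f and `factor X` is not needed, since the
  -- pairing with α ignores this number.
  refine ⟨2 * factor X (e.1.symm z.1) - f (e.1.symm z.1),
    fun i => by rw [hV.lift e z hz, sc_eq_smul], ?_⟩
  have hVs : SmoothAt (V.coeff e) z := fun a =>
    (V.smooth e a z hz).contDiffAt ((isOpen_domain e).mem_nhds hz)
  have hx : ∀ i, V.coeff e (Idx.x i) =ᶠ[𝓝 z] confLiftLocal hbar X e (Idx.x i) := fun i =>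
    (eventually_mem_domain hz).mono fun w hw => by
      rw [hV.lift e w hw, sc_eq_smul]
      rfl
  have hp : ∀ i, Supercotangent.beta g e (Idx.p i) = fun _ => 0 := fun _ => rfl
  have hxi : ∀ i, Supercotangent.beta g e (Idx.xi i) = fun _ => 0 := fun _ => rfl
  have hW := isLiftAt_liftLocal hbar g e X.1 (fun v => factor X (e.1.symm v)) z
  have key : ∀ j, ∑ k, gcoord g e k j z.1 • (V.coeff e (Idx.xi k) z
      - (∑ l, pd l (vcoord e X.1 k) z.1 • (xi l : Grassmann n)
        - (2 * factor X (e.1.symm z.1) - f (e.1.symm z.1)) • (xi k : Grassmann n))) = 0 := by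
    intro j
    have h1 := hf e z hz (Idx.x j)
    have h2 := lieDerivForm_confLiftLocal_beta hbar hz X (Idx.x j)
    rw [lieDerivForm_of_even (fun a => hV.even e a z hz) hVs (smoothAt_beta g hz), sum_idx,
      beta_x, act_betaX g hz] at h1
    rw [lieDerivForm_of_even (evenAt_confLiftLocal hbar hz X) (smoothAt_confLiftLocal hbar hz X)
      (smoothAt_beta g hz), sum_idx, beta_x, act_betaX g hz] at h2
    simp only [hp, hxi, mul_zero, Finset.sum_const_zero, add_zero, partialD_congr _ (hx _),
      (hx _).eq_of_nhds] at h1 h2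
    have h3 := congrArg₂ (· - ·) h1 h2
    simp only [add_sub_add_left_eq_sub, hW.coeff_xi, sc_mul] at h3
    simp only [smul_sub, Finset.sum_sub_distrib] at h3 ⊢
    have h4 : ∀ r : ℝ, ∑ k, gcoord g e k j z.1 • r • (xi k : Grassmann n) = r • betaX g e j z := by
      intro r
      rw [betaX, Finset.smul_sum]
      exact Finset.sum_congr rfl fun k _ => smul_comm _ _ _
    rw [h4] at h3 ⊢
    rw [← sub_eq_zero] at h3
    rw [← h3, sub_smul, two_mul, add_smul]
    abel
  exact fun i => sub_eq_zero.1 (eq_zero_of_sum_gcoord g hz key i)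

variable (g)

/-- The expression of the comoment map in a chart. -/
def comomentLocal (e : Chart n M) (X : VField n M) : LocalFun n := fun z =>
  ∑ i, sc (z.2 i * vcoord e X i z.1) + ((hbar : ℂ) / (2 * Complex.I)) •
    ∑ j, ∑ k, xi j * xi k * sc (skewD g e X k j z.1)

variable {g}

theorem comomentLocal_eq_pairing {e : Chart n M} {z : Body n} (hz : z ∈ domain e) (X : conf g) :
    comomentLocal hbar g e X.1 z = pairing (confLiftLocal hbar X e) (alpha hbar g e) z :=
  ((isLiftAt_liftLocal hbar g e X.1 _ z).pairing_alpha hbar X.2.1 hz).symm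

theorem comomentLocal_eventuallyEq {e : Chart n M} {z : Body n} (hz : z ∈ domain e)
    (X : conf g) :
    comomentLocal hbar g e X.1 =ᶠ[𝓝 z] pairing (confLiftLocal hbar X e) (alpha hbar g e) :=
  (eventually_mem_domain hz).mono fun _ hw => comomentLocal_eq_pairing hbar hw X

/-- In each chart it is the pairing of a vector field with α, and both transform tensorially; no
transformation of the explicit formula is needed. -/
theorem comomentLocal_change {e e' : Chart n M} {z : Body n} (hu : z.1 ∈ overlap e e')
    (X : conf g) : comomentLocal hbar g e X.1 z
      = pullback e e' (comomentLocal hbar g e' X.1) z := by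
  have h1 : pullback e e' (comomentLocal hbar g e' X.1) z = subst (jacobian e e' z.1)
      (pairing (confLiftLocal hbar X e') (alpha hbar g e') (transition e e' z)) :=
    congrArg _ (comomentLocal_eq_pairing hbar (transition_mem_domain hu) X)
  rw [h1, comomentLocal_eq_pairing hbar hu.1 X]
  simp only [pairing, map_sum, map_mul, alpha_change hbar g hu, Finset.mul_sum,
    ← act_natCoord_liftLocal hbar g X.2.1 (contMDiff_factor X) (lieDerivMetric_eq_factor X) hu,
    act, Finset.sum_mul, mul_assoc]
  exact Finset.sum_comm

theorem skewD_add {e : Chart n M} {u : Model n} (hu : u ∈ e.1.target) (X Y : conf g)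
    (k j : Fin n) : skewD g e (X.1 + Y.1) k j u = skewD g e X.1 k j u + skewD g e Y.1 k j u := by
  have hd : ∀ (X : conf g) j, DifferentiableAt ℝ (vlower g e X.1 j) u := fun X j =>
    DifferentiableAt.fun_sum fun k _ => (contDiffAt_gcoord g hu j k).differentiableAt_of_infty.mul
      (contDiffAt_vcoord X.2.1 hu k).differentiableAt_of_infty
  have h1 : ∀ j, vlower g e (X.1 + Y.1) j = fun v => vlower g e X.1 j v + vlower g e Y.1 j v := by
    intro j
    funext v
    simp only [vlower, vcoord_add, mul_add, Finset.sum_add_distrib]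
  simp only [skewD, h1, pd_add _ (hd X _) (hd Y _)]
  ring

theorem skewD_smul {e : Chart n M} {u : Model n} (c : ℝ) (X : VField n M)
    (k j : Fin n) : skewD g e (c • X) k j u = c * skewD g e X k j u := by
  have h1 : ∀ j, vlower g e (c • X) j = fun v => c * vlower g e X j v := by
    intro j
    funext v
    simp only [vlower, vcoord_smul, Finset.mul_sum]
    exact Finset.sum_congr rfl fun _ _ => by ring
  have h2 : ∀ k (f : Model n → ℝ), pd k (fun v => c * f v) u = c * pd k f u := by
    intro k f
    exact congrArg (fun L : Model n → Model n →L[ℝ] ℝ => L u _) (fderiv_const_smul_field (f := f) c)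
  simp only [skewD, h1, h2]
  ring

/-- The even comoment map. -/
def comoment : conf g →ₗ[ℝ] SuperFun n M where
  toFun X := ⟨fun e => (domain e).indicator (comomentLocal hbar g e X.1), by
    refine ⟨fun e z hz => ?_, fun e e' z hz hz' => ?_, fun e z hz => Set.indicator_of_notMem hz _⟩
    · have h1 := (smoothAt_confLiftLocal hbar hz X).pairing (smoothAt_alpha hbar g hz)
      exact (h1.congr_of_eventuallyEq (comomentLocal_eventuallyEq hbar hz X)).contDiffWithinAt.congr
        (fun w hw => Set.indicator_of_mem hw _) (Set.indicator_of_mem hz _)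
    · have hu : z.1 ∈ overlap e e' := ⟨hz, hz'⟩
      beta_reduce
      rw [Set.indicator_of_mem hz, comomentLocal_change hbar hu X]
      simp only [pullback, Set.indicator_of_mem (transition_mem_domain hu)]⟩
  map_add' X Y := by
    ext e z
    by_cases hz : z ∈ domain e
    · simp only [Submodule.coe_add, Pi.add_apply, Set.indicator_of_mem hz, comomentLocal,
        vcoord_add, skewD_add hz, mul_add, sc_add, Finset.sum_add_distrib, smul_add]
      abel
    · simp only [Submodule.coe_add, Pi.add_apply, Set.indicator_of_notMem hz, add_zero]
  map_smul' c X := by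
    ext e z
    change (domain e).indicator (comomentLocal hbar g e (c • X).1) z
      = c • (domain e).indicator (comomentLocal hbar g e X.1) z
    by_cases hz : z ∈ domain e
    · simp only [Submodule.coe_smul, Set.indicator_of_mem hz, comomentLocal,
        vcoord_smul, skewD_smul, smul_add, Finset.smul_sum, mul_sc]
      congr 1
      · exact Finset.sum_congr rfl fun i _ => by rw [mul_left_comm, sc_mul_sc, sc_mul]
      · exact Finset.sum_congr rfl fun j _ => Finset.sum_congr rfl fun k _ => by
          rw [mul_smul, smul_comm]
    · simp only [Set.indicator_of_notMem hz, smul_zero]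

theorem comoment_apply {e : Chart n M} {z : Body n} (hz : z ∈ domain e) (X : conf g) :
    (comoment hbar X).1 e z = comomentLocal hbar g e X.1 z := Set.indicator_of_mem hz _

theorem comoment_eventuallyEq {e : Chart n M} {z : Body n} (hz : z ∈ domain e) (X : conf g) :
    (comoment hbar X).1 e =ᶠ[𝓝 z] comomentLocal hbar g e X.1 :=
  (eventually_mem_domain hz).mono fun _ hw => comoment_apply hbar hw X

theorem IsHamiltonianLift.pairing_alpha {X : conf g} {V : SuperVF n M}
    (hV : IsHamiltonianLift hbar g X.1 V) {e : Chart n M} {z : Body n} (hz : z ∈ domain e) :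
    (comoment hbar X).1 e z = pairing (V.coeff e) (Supercotangent.alpha hbar g e) z := by
  obtain ⟨f, hf⟩ := hV.isLiftAt hbar hz
  rw [comoment_apply hbar hz, hf.pairing_alpha hbar X.2.1 hz]
  rfl

/-- Cartan's formula: 0 = L_V α = d⟨V, α⟩ + ⟨V, dα⟩. -/
theorem IsHamiltonianLift.isHamiltonianVF {X : conf g} {V : SuperVF n M}
    (hV : IsHamiltonianLift hbar g X.1 V) : IsHamiltonianVF hbar g (comoment hbar X) V := by
  intro e z hz b
  have h1 : (comoment hbar X).1 e =ᶠ[𝓝 z] pairing (V.coeff e) (Supercotangent.alpha hbar g e) :=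
    (eventually_mem_domain hz).mono fun w hw => hV.pairing_alpha hbar hw
  have h2 : Supercotangent.diff ((comoment hbar X).1 e) b z
      = Supercotangent.diff (pairing (V.coeff e) (Supercotangent.alpha hbar g e)) b z := partialD_congr b h1
  rw [h2]
  exact eq_neg_of_add_eq_zero_right (hV.alpha e z hz b)

/-! ### The Poisson bracket -/

theorem act_liftLocal_x {e : Chart n M} {z : Body n} (hz : z ∈ domain e) {X Y : VField n M}
    (hY : IsSmoothField Y) (f h : Model n → ℝ) (i : Fin n) :
    act (liftLocal hbar g e X f) (liftLocal hbar g e Y h (Idx.x i)) z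
      = ∑ k, (vcoord e X k z.1 * pd k (vcoord e Y i) z.1) • (1 : Grassmann n) := by
  have h1 : ∀ a, partialD a (liftLocal hbar g e Y h (Idx.x i)) z = match a with
      | Idx.x k => pd k (vcoord e Y i) z.1 • (1 : Grassmann n)
      | _ => 0 := fun a => partialD_liftCore_x hY hz (f := h) a i
  rw [act, sum_idx]
  simp only [h1, (isLiftAt_liftLocal hbar g e X f z).coeff_x, mul_zero, Finset.sum_const_zero,
    add_zero, smul_mul_assoc, one_mul, smul_smul]

/-- Everything in f and h without derivatives is symmetric under exchanging (X, f) and (Y, h), hence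
disappears from the commutator. -/
theorem act_liftLocal_xi {e : Chart n M} {z : Body n} (hz : z ∈ domain e) {X Y : VField n M}
    (hY : IsSmoothField Y) {f h : Model n → ℝ}
    (hh : ∀ u ∈ e.1.target, ContDiffAt ℝ ∞ h u) (i : Fin n) :
    act (liftLocal hbar g e X f) (liftLocal hbar g e Y h (Idx.xi i)) z
      = ∑ k, (∑ m, (vcoord e X m z.1 * pd m (pd k (vcoord e Y i)) z.1
          + pd k (vcoord e X m) z.1 * pd m (vcoord e Y i) z.1)) • (xi k : Grassmann n)
        - (∑ m, vcoord e X m z.1 * pd m h z.1) • (xi i : Grassmann n)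
        - (f z.1 • ∑ k, pd k (vcoord e Y i) z.1 • (xi k : Grassmann n)
          + h z.1 • ∑ k, pd k (vcoord e X i) z.1 • (xi k : Grassmann n))
        + (f z.1 * h z.1) • (xi i : Grassmann n) := by
  have hd := fun k => ((contDiffAt_vcoord hY hz i).pd k).differentiableAt_of_infty
  have h0 := (hh _ hz).differentiableAt_of_infty
  have hx : ∀ m, partialD (Idx.x m) (liftLocal hbar g e Y h (Idx.xi i)) z
      = ∑ k, pd m (pd k (vcoord e Y i)) z.1 • (xi k : Grassmann n)
        - pd m h z.1 • (xi i : Grassmann n) := by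
    intro m
    have h1 : ∀ k, DifferentiableAt ℝ
        (fun z : Body n => pd k (vcoord e Y i) z.1 • (xi k : Grassmann n)) z := fun k =>
      differentiableAt_base (hd k) _
    have h2 : DifferentiableAt ℝ (fun z : Body n => -(h z.1 • (xi i : Grassmann n))) z :=
      (differentiableAt_base h0 _).neg
    simp only [liftLocal, liftCore, sub_eq_add_neg]
    rw [partialD_add _ (DifferentiableAt.fun_sum fun k _ => h1 k) h2,
      partialD_sum _ _ fun k _ => h1 k, partialD_neg, partialD_x_base _ h0]
    congr 1
    exact Finset.sum_congr rfl fun k _ => partialD_x_base m (hd k) _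
  have hp : ∀ k, partialD (Idx.p k) (liftLocal hbar g e Y h (Idx.xi i)) z = 0 := fun k =>
    partialD_p_liftCore_xi hY hh hz k i
  have hxi : ∀ k, partialD (Idx.xi k) (liftLocal hbar g e Y h (Idx.xi i)) z
      = pd k (vcoord e Y i) z.1 • (1 : Grassmann n) - h z.1 • (if k = i then 1 else 0) :=
    fun k => partialD_xi_liftCore_xi k i
  have hV := isLiftAt_liftLocal hbar g e X f z
  rw [act, sum_idx]
  simp only [hx, hp, hxi, hV.coeff_x, hV.coeff_xi, mul_zero, Finset.sum_const_zero, zero_add,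
    smul_mul_assoc, one_mul, smul_sub, mul_sub, mul_smul_comm, mul_one, mul_ite, smul_ite,
    smul_zero, Finset.sum_sub_distrib, Finset.sum_ite_eq', Finset.mem_univ, if_true,
    Finset.smul_sum, smul_smul, Finset.sum_smul, add_smul, Finset.sum_add_distrib]
  rw [Finset.sum_comm (f := fun m k => (vcoord e X m z.1 * pd m (pd k (vcoord e Y i)) z.1) •
    (xi k : Grassmann n))]
  rw [Finset.sum_comm (f := fun m k => (pd m (vcoord e Y i) z.1 * pd k (vcoord e X m) z.1) •
    (xi k : Grassmann n))]
  simp only [mul_comm (pd _ (vcoord e Y i) z.1) _, mul_comm (h z.1) (f z.1),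
    mul_comm (pd _ h z.1) _]
  abel

/-- The bracket is ⟨[X̃, Ỹ], α⟩ by invariance of α under X̃. Since α has no dp-part, it is enough
that the commutator has the x- and ξ-components of a lift of [X, Y]. -/
theorem isPoissonBracket_comoment (hbar_ne : hbar ≠ 0) (X Y : conf g)
    (h : VectorField.mlieBracket (𝓡 n) X.1 Y.1 ∈ conf g) :
    IsPoissonBracket hbar g (comoment hbar X) (comoment hbar Y)
      (comoment hbar ⟨VectorField.mlieBracket (𝓡 n) X.1 Y.1, h⟩) := by
  have hV := (isHamiltonianLift_confLift hbar X).isHamiltonianVF hbar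
  refine ⟨⟨confLift hbar X, hV, fun V hV' => isHamiltonianVF_unique hbar hbar_ne hV' hV⟩,
    fun V hV' e z hz => ?_⟩
  obtain rfl := isHamiltonianVF_unique hbar hbar_ne hV' hV
  have hfac : ∀ X : conf g, ∀ u ∈ e.1.target,
      ContDiffAt ℝ ∞ (fun v => factor X (e.1.symm v)) u := fun X u hu =>
    contDiffAt_chart (contMDiff_factor X) hu
  have h1 : act ((confLift hbar X).coeff e) ((comoment hbar Y).1 e) z
      = act (confLiftLocal hbar X e) (pairing (confLiftLocal hbar Y e) (alpha hbar g e)) z := by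
    rw [act_congr _ ((comoment_eventuallyEq hbar hz Y).trans
      (comomentLocal_eventuallyEq hbar hz Y))]
    simp only [act, confLift_coeff hbar hz]
  rw [h1, act_pairing (evenAt_confLiftLocal hbar hz X) (smoothAt_confLiftLocal hbar hz X)
    (smoothAt_confLiftLocal hbar hz Y) (smoothAt_alpha hbar g hz)
    (lieDerivForm_confLiftLocal_alpha hbar hz X), comoment_apply hbar hz]
  have hbr : ∀ i, vcoord e (VectorField.mlieBracket (𝓡 n) X.1 Y.1) i =ᶠ[𝓝 z.1]
      bracketCoord (fun k => vcoord e X.1 k) (fun k => vcoord e Y.1 k) i := fun i =>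
    (e.1.open_target.eventually_mem hz).mono fun u hu => vcoord_mlieBracket X.2.1 Y.2.1 hu i
  -- The factor is X(f_Y) − Y(f_X), with f_X and f_Y the factors of the two lifts.
  have hlift : IsLiftAt e (VectorField.mlieBracket (𝓡 n) X.1 Y.1)
      (∑ m, vcoord e X.1 m z.1 * pd m (fun v => factor Y (e.1.symm v)) z.1
        - ∑ m, vcoord e Y.1 m z.1 * pd m (fun v => factor X (e.1.symm v)) z.1)
      (fun c w => act (confLiftLocal hbar X e) (confLiftLocal hbar Y e c) w
        - act (confLiftLocal hbar Y e) (confLiftLocal hbar X e c) w) z := by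
    refine ⟨fun i => ?_, fun i => ?_⟩
    · rw [act_liftLocal_x hbar hz Y.2.1, act_liftLocal_x hbar hz X.2.1, (hbr i).eq_of_nhds,
        bracketCoord, ← Finset.sum_smul, ← Finset.sum_smul, ← sub_smul, Finset.sum_sub_distrib]
    · have h2 : ∀ k, pd k (vcoord e (VectorField.mlieBracket (𝓡 n) X.1 Y.1) i) z.1 = _ := fun k =>
        (pd_congr k (hbr i)).trans (pd_bracketCoord (fun k => contDiffAt_vcoord X.2.1 hz k)
          (fun k => contDiffAt_vcoord Y.2.1 hz k) k i)
      rw [act_liftLocal_xi hbar hz Y.2.1 (hfac Y), act_liftLocal_xi hbar hz X.2.1 (hfac X)]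
      simp only [h2, Finset.sum_sub_distrib, sub_smul, add_comm (_ * pd _ (pd _ _) _),
        mul_comm (factor Y _)]
      abel
  exact (hlift.pairing_alpha hbar (isSmoothField_mlieBracket X.2.1 Y.2.1) hz).symm

end Supercotangent
end

open Supercotangent

theorem proposition3p6 {n : ℕ} {M : Type*} [TopologicalSpace M]
    [ChartedSpace (EuclideanSpace ℝ (Fin n)) M] [IsManifold (𝓡 n) ∞ M]
    (g : PseudoRiemannianMetric n M) (hbar : ℝ) (hbar_ne : hbar ≠ 0) :
    -- the Hamiltonian action `X ↦ X̃` and the even comoment map `J`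
    ∃ (lift : conf g → SuperVF n M) (J : conf g →ₗ[ℝ] SuperFun n M),
      -- `X̃` is the unique lift of `X` preserving `α` and the direction of `β`
      (∀ X : conf g, IsHamiltonianLift hbar g X.1 (lift X) ∧
        ∀ V : SuperVF n M, IsHamiltonianLift hbar g X.1 V → V = lift X) ∧
      -- `J` is a comoment map of this action: `X̃` is the Hamiltonian vector field of `J_X`
      (∀ X : conf g, IsHamiltonianVF hbar g (J X) (lift X)) ∧
      -- `J` is a morphism of Lie algebras
      (∀ X Y : conf g, ∃ h : VectorField.mlieBracket (𝓡 n) X.1 Y.1 ∈ conf g,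
        IsPoissonBracket hbar g (J X) (J Y) (J ⟨VectorField.mlieBracket (𝓡 n) X.1 Y.1, h⟩)) ∧
      -- `J_X = ⟨X̃, α⟩`
      (∀ X : conf g, ∀ e : Chart n M, ∀ z ∈ domain e,
        (J X).1 e z = pairing ((lift X).coeff e) (alpha hbar g e) z) ∧
      -- `J_X = pᵢ Xⁱ + (ħ/2i) ξʲ ξᵏ ∂_{[k} X_{j]}`
      (∀ X : conf g, ∀ e : Chart n M, ∀ z ∈ domain e,
        (J X).1 e z = ∑ i, sc (z.2 i * vcoord e X.1 i z.1) +
          ((hbar : ℂ) / (2 * Complex.I)) •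
            ∑ j, ∑ k, Grassmann.xi j * Grassmann.xi k * sc (skewD g e X.1 k j z.1)) := by
  have hlift := fun X : conf g => isHamiltonianLift_confLift hbar X
  refine ⟨confLift hbar, comoment hbar, fun X => ⟨hlift X, fun V hV => ?_⟩,
    fun X => (hlift X).isHamiltonianVF hbar, fun X Y => ?_,
    fun X e z hz => (hlift X).pairing_alpha hbar hz, fun X e z hz => comoment_apply hbar hz X⟩
  -- Any two lifts of X are Hamiltonian for the same function J_X, hence equal.
  · exact isHamiltonianVF_unique hbar hbar_ne (hV.isHamiltonianVF hbar)
      ((hlift X).isHamiltonianVF hbar)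
  · have h := mlieBracket_mem_conf g X.2 Y.2
    exact ⟨h, isPoissonBracket_comoment hbar hbar_ne X Y h⟩
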